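/- A series extension of a multigraph is obtained by subdividing an edge, and a parallel extension by adding a new edge with the same ends as an existing one. A multigraph is called series-parallel if it can be constructed from a 2-cycle (two edges joining two distinct vertices) by a finite (possibly empty) sequence of series and parallel extensions; by convention, a single edge and a single loop are also series-parallel. A series-parallel matroid is a matroid associated with a series-parallel multigraph, that is, the matroid on its edge set whose independent sets are the sets of edges containing no cycle. A matroid is simple if it has no loops and no pairs of distinct parallel elements. Let $E_{n,k}$ denote the number of simple series-parallel matroids of rank $k$ on the ground set $[n]=\{1,\dots,n\}$ (labelled matroids, not isomorphism classes). Let $\left[\!\left[{n\atop k}\right]\!\right]$ denote the unsigned associated Stirling number of the first kind, i.e. the number of derangements (fixed-point-free permutations) of $[n]$ with exactly $k$ cycles; in particular $\left[\!\left[{0\atop 0}\right]\!\right]=1$. **Theorem.** For all integers $0\le r\le k$, $$E_{2k-r,\,k} \;=\; \sum_{p=1}^{r} \left[\!\left[{2k-p-1\atop k-p}\right]\!\right] \sum_{i=0}^{r-p} \frac{(-1)^{i+p+1}\,(2k-p-i)^{k-p-1}}{i!\,(r-p-i)!},$$ as an identity of rational numbers, where the exponent $k-p-1$ is an integer that equals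 $-1$ when $p=k$. (An empty sum is $0$, so $E_{2k,k}=0$.) -/

import Mathlib

open scoped Graph

namespace SeriesParallel

/-- `H` is a series extension of the multigraph `G`: some edge `e` of `G`, with ends `x` and `y`,
is subdivided by a new vertex `w`, so that `e` becomes an edge from `x` to `w` and a new edge `f`
goes from `w` to `y`. -/
def IsSeriesExtension {α β : Type*} (G H : Graph α β) : Prop :=
  ∃ (e f : β) (x y w : α), G.IsLink e x y ∧ f ∉ E(G) ∧ w ∉ V(G) ∧
    V(H) = insert w V(G) ∧
    ∀ (g : β) (a b : α), H.IsLink g a b ↔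
      (g ≠ e ∧ G.IsLink g a b) ∨ (g = e ∧ s(a, b) = s(x, w)) ∨ (g = f ∧ s(a, b) = s(w, y))

/-- `H` is a parallel extension of the multigraph `G`: a new edge `f` is added which has the same
ends `x` and `y` as some edge `e` of `G`. -/
def IsParallelExtension {α β : Type*} (G H : Graph α β) : Prop :=
  ∃ (e f : β) (x y : α), G.IsLink e x y ∧ f ∉ E(G) ∧
    V(H) = V(G) ∧
    ∀ (g : β) (a b : α), H.IsLink g a b ↔ G.IsLink g a b ∨ (g = f ∧ s(a, b) = s(x, y))

/-- The multigraphs that arise from a 2-cycle (two distinct edges joining two distinct vertices)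
by a finite, possibly empty, sequence of series and parallel extensions. -/
inductive IsBuiltFromTwoCycle {α β : Type*} : Graph α β → Prop
  | twoCycle (u v : α) (e f : β) (huv : u ≠ v) (hef : e ≠ f) :
      IsBuiltFromTwoCycle (Graph.banana u v {e, f})
  | series (G H : Graph α β) (hG : IsBuiltFromTwoCycle G) (hGH : IsSeriesExtension G H) :
      IsBuiltFromTwoCycle H
  | parallel (G H : Graph α β) (hG : IsBuiltFromTwoCycle G) (hGH : IsParallelExtension G H) :
      IsBuiltFromTwoCycle H

/-- Series-parallel multigraphs: those built from a 2-cycle and, by convention, a single (non-loop)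
edge and a single loop. -/
def IsSeriesParallelGraph {α β : Type*} (G : Graph α β) : Prop :=
  IsBuiltFromTwoCycle G ∨
    (∃ (u v : α) (e : β), u ≠ v ∧ G = Graph.banana u v {e}) ∨
    (∃ (u : α) (e : β), G = Graph.bouquet u {e})

/-- A set `I` of edges of `G` is acyclic (contains no cycle of `G`) if the ends of an edge `e` in
`I` are never joined by a walk, possibly of length zero, all of whose edges lie in `I \ {e}`.
In particular an acyclic set contains no loops and no two parallel edges. -/
def IsAcyclicSet {α β : Type*} (G : Graph α β) (I : Set β) : Prop :=
  ∀ e ∈ I, ∀ x y : α, G.IsLink e x y →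
    ¬ Relation.ReflTransGen (fun a b : α => ∃ f ∈ I \ {e}, G.IsLink f a b) x y

/-- `M` is the matroid associated with `G` (its cycle matroid): the elements of `M` are the edges
of `G`, and the independent sets are the acyclic sets of edges. -/
def IsCycleMatroidOf {α β : Type*} (M : Matroid β) (G : Graph α β) : Prop :=
  M.E = E(G) ∧ ∀ I : Set β, M.Indep I ↔ I ⊆ E(G) ∧ IsAcyclicSet G I

/-- A series-parallel matroid is a matroid associated with a series-parallel graph. The vertices
are taken from the infinite set `ℕ`, so a new vertex is always available. -/
def IsSeriesParallelMatroid {β : Type*} (M : Matroid β) : Prop :=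
  ∃ G : Graph ℕ β, IsSeriesParallelGraph G ∧ IsCycleMatroidOf M G

/-- A matroid is simple if it has no loops and no pairs of distinct parallel elements, that is, any
(at most) two of its elements form an independent set. -/
def IsSimpleMatroid {β : Type*} (M : Matroid β) : Prop :=
  ∀ e ∈ M.E, ∀ f ∈ M.E, M.Indep {e, f}

/-- The number of simple series-parallel matroids of rank `k` with ground set `Fin n`. -/
noncomputable def numSimpleSeriesParallel (n k : ℕ) : ℕ :=
  Set.ncard {M : Matroid (Fin n) |
    M.E = Set.univ ∧ M.eRank = k ∧ IsSimpleMatroid M ∧ IsSeriesParallelMatroid M}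

/-- The unsigned associated Stirling number of the first kind: the number of derangements of an
`n`-element set with exactly `k` cycles. (`Equiv.Perm.cycleType` lists the lengths of the cycles
of length at least 2, which are all the cycles when there are no fixed points.) -/
def assocStirlingFirst (n k : ℕ) : ℕ :=
  Fintype.card {σ : Equiv.Perm (Fin n) // (∀ i, σ i ≠ i) ∧ Multiset.card σ.cycleType = k}

end SeriesParallel

namespace SeriesParallel

open Set Matroid

variable {β : Type*} {M M' N : Matroid β} {a b c d e x : β}

/-- Two distinct parallel elements of a matroid. -/
def IsPar (M : Matroid β) (a b : β) : Prop :=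
  a ≠ b ∧ M.IsNonloop a ∧ M.IsNonloop b ∧ M.closure {a} = M.closure {b}

lemma IsPar.symm (h : IsPar M a b) : IsPar M b a :=
  ⟨h.1.symm, h.2.2.1, h.2.1, h.2.2.2.symm⟩

lemma isPar_comm : IsPar M a b ↔ IsPar M b a := ⟨IsPar.symm, IsPar.symm⟩

lemma IsPar.trans (h : IsPar M a b) (h' : IsPar M b c) (hac : a ≠ c) : IsPar M a c :=
  ⟨hac, h.2.1, h'.2.2.1, h.2.2.2.trans h'.2.2.2⟩

lemma IsPar.congr_left (h : IsPar M a b) (hac : a ≠ c) (hbc : b ≠ c) :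
    IsPar M a c ↔ IsPar M b c :=
  ⟨fun h' => h.symm.trans h' hbc, fun h' => h.trans h' hac⟩

lemma IsPar.left_mem (h : IsPar M a b) : a ∈ M.E := h.2.1.mem_ground

lemma IsPar.right_mem (h : IsPar M a b) : b ∈ M.E := h.2.2.1.mem_ground

lemma IsPar.isCircuit (h : IsPar M a b) : M.IsCircuit {a, b} :=
  (h.2.1.closure_eq_closure_iff_isCircuit_of_ne h.1).1 h.2.2.2

lemma isPar_of_isCircuit (hab : a ≠ b) (h : M.IsCircuit {a, b}) : IsPar M a b := by
  have hn : ({a, b} : Set β).Nontrivial := nontrivial_pair hab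
  have ha := h.isNonloop_of_mem hn (by simp : a ∈ _)
  exact ⟨hab, ha, h.isNonloop_of_mem hn (by simp : b ∈ _),
    (ha.closure_eq_closure_iff_isCircuit_of_ne hab).2 h⟩

lemma isPar_iff_isCircuit : IsPar M a b ↔ a ≠ b ∧ M.IsCircuit {a, b} :=
  ⟨fun h => ⟨h.1, h.isCircuit⟩, fun h => isPar_of_isCircuit h.1 h.2⟩

lemma isPar_delete_iff : IsPar (M ＼ {d}) a b ↔ IsPar M a b ∧ a ≠ d ∧ b ≠ d := by
  simp only [isPar_iff_isCircuit, delete_isCircuit_iff]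
  simp only [disjoint_singleton_right, mem_insert_iff, mem_singleton_iff, not_or]
  grind

lemma IsPar.mem_of_series (h : IsPar M a b) (h' : IsPar M✶ c d) (ha : a ∈ ({c, d} : Set β)) :
    b ∈ ({c, d} : Set β) := by
  by_contra hb
  refine h.isCircuit.inter_isCocircuit_ne_singleton (K := {c, d}) (e := a) ?_ ?_
  · rw [isCocircuit_def]; exact h'.isCircuit
  · ext z; simp only [mem_inter_iff, mem_insert_iff, mem_singleton_iff] at *
    grind

lemma notMem_closure_of_series (h : IsPar M✶ c d) {X : Set β} (hc : c ∉ X) (hd : d ∉ X) :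
    c ∉ M.closure X := by
  intro hcl
  rw [mem_closure_iff_exists_isCircuit hc] at hcl
  obtain ⟨C, hCX, hC, hcC⟩ := hcl
  refine hC.inter_isCocircuit_ne_singleton (K := {c, d}) (e := c) ?_ ?_
  · rw [isCocircuit_def]; exact h.isCircuit
  · ext z; simp only [mem_inter_iff, mem_insert_iff, mem_singleton_iff] at *
    have := h.1
    constructor
    · rintro ⟨hz, rfl | rfl⟩
      · rfl
      · rcases hCX hz with h1 | h1
        · exact h1
        · exact absurd h1 hd
    · rintro rfl; exact ⟨hcC, Or.inl rfl⟩

lemma isNonloop_of_series (h : IsPar M✶ c d) : M.IsNonloop c := by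
  have hc : c ∈ M.E := h.left_mem
  exact isNonloop_of_notMem_closure (notMem_closure_of_series h (notMem_empty c) (notMem_empty d))

/-- Contracting an element of a series pair does not change parallelism away from the pair. -/
lemma isPar_contract_iff (h : IsPar M✶ c d) (hac : a ≠ c) (hbc : b ≠ c) (had : a ≠ d)
    (hbd : b ≠ d) : IsPar (M ／ {d}) a b ↔ IsPar M a b := by
  have key : ∀ x, x ≠ c → x ≠ d → M.IsNonloop x → x ∉ M.closure {d} := by
    intro x hxc hxd hx hcl
    have hd : M.IsNonloop d := isNonloop_of_series h.symm
    have : IsPar M x d := ⟨hxd, hx, hd, hx.closure_eq_of_mem_closure hcl⟩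
    have := this.symm.mem_of_series h (by simp)
    simp at this; tauto
  constructor
  · rintro ⟨hab, ha, hb, hcl⟩
    have ha' := ha.of_contract
    have hb' := hb.of_contract
    refine ⟨hab, ha', hb', ?_⟩
    have h1 : a ∈ M.closure {b, d} := by
      have : a ∈ (M ／ {d}).closure {b} := by
        rw [← hcl]; exact mem_closure_self _ _ ha.mem_ground
      rw [contract_closure_eq] at this
      exact this.1
    refine ha'.closure_eq_of_mem_closure ?_
    by_contra hn
    have h2 : a ∈ M.closure (insert d {b}) := by rwa [pair_comm d b]
    have h3 := M.closure_exchange ⟨h2, hn⟩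
    refine notMem_closure_of_series h.symm ?_ ?_ h3.1
    · simp; exact ⟨had.symm, hbd.symm⟩
    · simp; exact ⟨hac.symm, hbc.symm⟩
  · rintro ⟨hab, ha, hb, hcl⟩
    refine ⟨hab, ?_, ?_, ?_⟩
    · rw [contract_isNonloop_iff]; exact ⟨ha.mem_ground, key a hac had ha⟩
    · rw [contract_isNonloop_iff]; exact ⟨hb.mem_ground, key b hbc hbd hb⟩
    · rw [contract_closure_eq, contract_closure_eq, M.closure_union_congr_left hcl]

/-- Deleting an element of a parallel pair does not change seriality away from the pair. -/
lemma isPar_dual_delete_iff (h : IsPar M c d) (hac : a ≠ c) (hbc : b ≠ c) (had : a ≠ d)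
    (hbd : b ≠ d) : IsPar (M ＼ {d})✶ a b ↔ IsPar M✶ a b := by
  rw [dual_delete]
  exact isPar_contract_iff (by rwa [dual_dual]) hac hbc had hbd

/-- A matroid is determined by a parallel pair and the deletion of one of its elements. -/
lemma eq_of_isPar_of_delete_eq (hE : M.E = M'.E) (h : IsPar M a b) (h' : IsPar M' a b)
    (hd : M ＼ {b} = M' ＼ {b}) : M = M' := by
  have aux : ∀ {M : Matroid β}, IsPar M a b → ∀ I ⊆ M.E, M.Indep I ↔
      (b ∉ I ∧ (M ＼ {b}).Indep I) ∨ (b ∈ I ∧ a ∉ I ∧ (M ＼ {b}).Indep (insert a (I \ {b}))) := by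
    intro M h I hIE
    by_cases hb : b ∈ I
    · simp only [hb, not_true, false_and, true_and, false_or, deleteElem_indep_iff]
      constructor
      · intro hI
        have haI : a ∉ I := fun ha =>
          h.isCircuit.not_indep (hI.subset (by rintro z (rfl | rfl) <;> assumption))
        refine ⟨haI, ?_, by simp [h.1.symm]⟩
        have h0 : M.Indep (I \ {b}) := hI.subset sdiff_subset
        rw [h0.insert_indep_iff]
        left
        refine ⟨h.left_mem, fun hcl => ?_⟩
        have hb' := hI.notMem_closure_sdiff_of_mem hb
        exact hb' (M.closure_subset_closure_of_subset_closure (singleton_subset_iff.2 hcl)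
          (h.2.2.2 ▸ M.mem_closure_self b h.right_mem))
      · rintro ⟨haI, hI, -⟩
        have h0 : M.Indep (I \ {b}) := hI.subset (subset_insert _ _)
        have h1 : M.Indep (insert b (I \ {b})) := by
          rw [h0.insert_indep_iff]
          left
          refine ⟨h.right_mem, fun hcl => ?_⟩
          have h2 := (h0.insert_indep_iff_of_notMem (by simp [haI] : a ∉ I \ {b})).1 hI
          exact h2.2 (M.closure_subset_closure_of_subset_closure (singleton_subset_iff.2 hcl)
            (h.2.2.2 ▸ M.mem_closure_self a h.left_mem))
        simpa [insert_eq_of_mem hb] using h1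
    · simp [hb]
  refine ext_indep hE fun I hI => ?_
  rw [aux h I hI, aux h' I (hE ▸ hI), hd]

/-- Every nonloop has a parallel extension. -/
lemma exists_parallel_extension (N : Matroid β) (ha : N.IsNonloop a) (hb : b ∉ N.E) :
    ∃ M : Matroid β, M.E = insert b N.E ∧ M ＼ {b} = N ∧ IsPar M a b := by
  classical
  have hab : a ≠ b := fun h => hb (h ▸ ha.mem_ground)
  let f : β → β := fun x => if x = b then a else x
  have hfb : f b = a := by simp [f]
  have hf : ∀ x, x ≠ b → f x = x := fun x hx => by simp [f, hx]
  have hE : (N.comap f).E = insert b N.E := by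
    ext x
    by_cases hx : x = b
    · subst hx; simp [hfb, ha.mem_ground]
    · simp [hf x hx, hx]
  have him : ∀ I : Set β, b ∉ I → f '' I = I := fun I hI => by
    rw [image_congr (g := id) (fun x hx => hf x (fun h => hI (h ▸ hx)))]; simp
  refine ⟨N.comap f, hE, ?_, ?_⟩
  · refine ext_indep ?_ fun I hI => ?_
    · rw [delete_ground, hE]; ext x; simp; grind
    · have hbI : b ∉ I := fun h => (hI h).2 rfl
      rw [deleteElem_indep_iff, comap_indep_iff, him I hbI]
      have : InjOn f I := fun x hx y hy h => by
        rwa [hf x (fun h => hbI (h ▸ hx)), hf y (fun h => hbI (h ▸ hy))] at h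
      tauto
  · refine ⟨hab, ?_, ?_, ?_⟩
    · rw [comap_isNonloop_iff, hf a hab]; exact ha
    · rw [comap_isNonloop_iff, hfb]; exact ha
    · rw [comap_closure_eq, comap_closure_eq]; simp [hfb, hf a hab]

lemma exists_series_extension (N : Matroid β) (ha : N✶.IsNonloop a) (hb : b ∉ N.E) :
    ∃ M : Matroid β, M.E = insert b N.E ∧ M ／ {b} = N ∧ IsPar M✶ a b := by
  obtain ⟨M, hE, hd, hp⟩ := exists_parallel_extension N✶ ha hb
  exact ⟨M✶, hE, by rw [← dual_delete, hd, dual_dual], by rwa [dual_dual]⟩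

end SeriesParallel

namespace SeriesParallel

open Set Matroid

variable {β γ : Type*} {M M' N : Matroid β} {G G' : SimpleGraph β} {V W : Set β} {a b c d e x : β}

lemma IsPar.mem_closure_iff (h : IsPar M a b) {X : Set β} : a ∈ M.closure X ↔ b ∈ M.closure X := by
  have aux : ∀ {a b}, IsPar M a b → a ∈ M.closure X → b ∈ M.closure X := fun h ha =>
    M.closure_subset_closure_of_subset_closure (singleton_subset_iff.2 ha)
      (h.2.2.2 ▸ M.mem_closure_self _ h.right_mem)
  exact ⟨aux h, aux h.symm⟩

lemma IsPar.insert_indep_iff (h : IsPar M a b) {I : Set β} (ha : a ∉ I) (hb : b ∉ I) :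
    M.Indep (insert a I) ↔ M.Indep (insert b I) := by
  rw [Matroid.insert_indep_iff, Matroid.insert_indep_iff]
  simp only [ha, hb, not_false_eq_true, forall_const, mem_sdiff, h.mem_closure_iff, h.left_mem,
    h.right_mem]

lemma IsPar.mapEquiv_swap [DecidableEq β] (h : IsPar M a b) : M.mapEquiv (Equiv.swap a b) = M := by
  refine ext_indep ?_ fun I hI => ?_
  · rw [mapEquiv_ground_eq]
    ext x
    have h1 := h.left_mem
    have h2 := h.right_mem
    simp only [mem_image_equiv, Equiv.symm_swap]
    by_cases hxa : x = a
    · subst hxa; simp [h1, h2]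
    by_cases hxb : x = b
    · subst hxb; simp [h1, h2]
    rw [Equiv.swap_apply_of_ne_of_ne hxa hxb]
  · rw [mapEquiv_indep_iff, Equiv.symm_swap]
    have him : ∀ J : Set β, a ∉ J → b ∉ J → Equiv.swap a b '' J = J := by
      intro J ha hb
      have hJ : ∀ x ∈ J, Equiv.swap a b x = id x := fun x hx => Equiv.swap_apply_of_ne_of_ne
        (fun h => ha (h ▸ hx)) (fun h => hb (h ▸ hx))
      rw [image_congr hJ, image_id]
    have h1 : a ∉ I \ {a, b} := by simp
    have h2 : b ∉ I \ {a, b} := by simp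
    by_cases ha : a ∈ I <;> by_cases hb : b ∈ I
    · have : I = insert a (insert b (I \ {a, b})) := by
        ext z; by_cases hza : z = a <;> by_cases hzb : z = b <;> simp [*, h.1]
      rw [this, image_insert_eq, image_insert_eq, him _ h1 h2, Equiv.swap_apply_left,
        Equiv.swap_apply_right, insert_comm]
    · have : I = insert a (I \ {a, b}) := by
        ext z; by_cases hza : z = a <;> by_cases hzb : z = b <;> simp [*]
      rw [this, image_insert_eq, him _ h1 h2, Equiv.swap_apply_left, h.insert_indep_iff h1 h2]
    · have : I = insert b (I \ {a, b}) := by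
        ext z; by_cases hza : z = a <;> by_cases hzb : z = b <;> simp [*, h.1]
      rw [this, image_insert_eq, him _ h1 h2, Equiv.swap_apply_right, h.insert_indep_iff h1 h2]
    · rw [him I ha hb]

lemma mapEquiv_delete (M : Matroid β) (f : β ≃ γ) (b : β) :
    (M ＼ {b}).mapEquiv f = (M.mapEquiv f) ＼ {f b} := by
  refine ext_indep ?_ fun I hI => ?_
  · simp [image_sdiff f.injective]
  · simp only [mapEquiv_indep_iff, deleteElem_indep_iff]
    simp

lemma mapEquiv_dual (M : Matroid β) (f : β ≃ γ) : (M.mapEquiv f)✶ = M✶.mapEquiv f := by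
  simp only [mapEquiv_eq_map, map_dual]

lemma mapEquiv_contract (M : Matroid β) (f : β ≃ γ) (b : β) :
    (M ／ {b}).mapEquiv f = (M.mapEquiv f) ／ {f b} := by
  rw [← dual_inj, mapEquiv_dual, dual_contract, dual_contract, mapEquiv_delete, mapEquiv_dual]

lemma IsPar.mapEquiv (h : IsPar M a b) (f : β ≃ γ) : IsPar (M.mapEquiv f) (f a) (f b) := by
  obtain ⟨hab, ha, hb, hcl⟩ := h
  refine ⟨f.injective.ne hab, ?_, ?_, ?_⟩
  · rw [← indep_singleton, mapEquiv_indep_iff]; simpa using ha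
  · rw [← indep_singleton, mapEquiv_indep_iff]; simpa using hb
  · have hf : ∀ x, f ⁻¹' {f x} = {x} := fun x => by ext; simp
    simp only [mapEquiv_eq_map, map_closure_eq, hf, hcl]

lemma IsPar.dual_of_ground_eq (h : IsPar M a b) (hE : M.E = {a, b}) : IsPar M✶ a b := by
  have ha : M✶.IsNonloop a := by
    rw [← not_isLoop_iff (by simp [hE])]
    exact h.isCircuit.not_isColoop_of_mem (by simp)
  have hb : M✶.IsNonloop b := by
    rw [← not_isLoop_iff (by simp [hE])]
    exact h.isCircuit.not_isColoop_of_mem (by simp)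
  refine ⟨h.1, ha, hb, (ha.closure_eq_closure_iff_eq_or_dep hb).2 (Or.inr ?_)⟩
  rw [← hE]
  intro hi
  have h1 := Coindep.compl_spanning (M := M) (coindep_def.2 hi)
  rw [sdiff_self, spanning_iff_closure_eq] at h1
  have h2 := h.2.1
  rw [isNonloop_iff_mem_compl_loops, ← closure_empty, h1] at h2
  exact h2.2 h2.1

/-- Nonadjacent vertices with the same neighbours in `V`. -/
def FalseTwins (G : SimpleGraph β) (V : Set β) (a b : β) : Prop :=
  ¬ G.Adj a b ∧ ∀ i ∈ V, i ≠ a → i ≠ b → (G.Adj a i ↔ G.Adj b i)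

lemma FalseTwins.symm (h : FalseTwins G V a b) : FalseTwins G V b a :=
  ⟨fun h' => h.1 h'.symm, fun i hi h1 h2 => (h.2 i hi h2 h1).symm⟩

lemma FalseTwins.mono (h : FalseTwins G V a b) (hW : W ⊆ V) : FalseTwins G W a b :=
  ⟨h.1, fun i hi => h.2 i (hW hi)⟩

lemma falseTwins_compl_iff (hab : a ≠ b) : FalseTwins Gᶜ V a b ↔
    G.Adj a b ∧ ∀ i ∈ V, i ≠ a → i ≠ b → (G.Adj a i ↔ G.Adj b i) := by
  simp only [FalseTwins, SimpleGraph.compl_adj, not_and, not_not]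
  constructor
  · rintro ⟨h1, h2⟩
    refine ⟨h1 hab, fun i hi hia hib => ?_⟩
    have := h2 i hi hia hib
    have h3 := hia.symm
    have h4 := hib.symm
    tauto
  · rintro ⟨h1, h2⟩
    refine ⟨fun _ => h1, fun i hi hia hib => ?_⟩
    rw [h2 i hi hia hib]
    have h3 := hia.symm
    have h4 := hib.symm
    tauto

lemma falseTwins_congr (hG : ∀ x ∈ V, ∀ y ∈ V, G.Adj x y ↔ G'.Adj x y) (ha : a ∈ V) (hb : b ∈ V) :
    FalseTwins G V a b ↔ FalseTwins G' V a b := by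
  unfold FalseTwins
  rw [hG a ha b hb]
  refine and_congr Iff.rfl (forall₂_congr fun i hi => ?_)
  rw [hG a ha i hi, hG b hb i hi]

/-- `Represents e G M`: the graph `G`, restricted to the elements of `M` other than `e`, describes
how `M` is obtained from a two-element circuit by parallel extensions (adding false twins)
and series extensions (adding true twins) away from the root `e`. -/
inductive Represents (e : β) (G : SimpleGraph β) : Matroid β → Prop
  | base (M : Matroid β) (a : β) (hE : M.E = {e, a}) (h : IsPar M e a) : Represents e G M
  | parallel (M : Matroid β) (a b : β) (hae : a ≠ e) (hbe : b ≠ e) (h : IsPar M a b)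
      (hG : FalseTwins G (M.E \ {e}) a b) (hM : Represents e G (M ＼ {b})) : Represents e G M
  | series (M : Matroid β) (a b : β) (hae : a ≠ e) (hbe : b ≠ e) (h : IsPar M✶ a b)
      (hG : FalseTwins Gᶜ (M.E \ {e}) a b) (hM : Represents e G (M ／ {b})) : Represents e G M

namespace Represents

lemma dual (h : Represents e G M) : Represents e Gᶜ M✶ := by
  induction h with
  | base M a hE h => exact .base _ a hE (h.dual_of_ground_eq hE)
  | parallel M a b hae hbe h hG hM ih =>
    refine .series _ a b hae hbe (by rwa [dual_dual]) (by rwa [compl_compl]) ?_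
    rwa [← dual_delete]
  | series M a b hae hbe h hG hM ih =>
    refine .parallel _ a b hae hbe h hG ?_
    rwa [← dual_contract]

lemma of_dual (h : Represents e Gᶜ M✶) : Represents e G M := by
  simpa using h.dual

lemma isNonloop (h : Represents e G M) : ∀ x ∈ M.E, M.IsNonloop x := by
  induction h with
  | base M a hE h =>
    intro x hx
    rw [hE] at hx
    rcases hx with rfl | rfl
    · exact h.2.1
    · exact h.2.2.1
  | parallel M a b hae hbe h hG hM ih =>
    intro x hx
    by_cases hxb : x = b
    · subst hxb; exact h.2.2.1
    · exact (ih x ⟨hx, hxb⟩).of_delete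
  | series M a b hae hbe h hG hM ih =>
    intro x hx
    by_cases hxb : x = b
    · subst hxb; exact isNonloop_of_series h.symm
    · exact (ih x ⟨hx, hxb⟩).of_contract

lemma congr (h : Represents e G M)
    (hG : ∀ x ∈ M.E \ {e}, ∀ y ∈ M.E \ {e}, G.Adj x y ↔ G'.Adj x y) : Represents e G' M := by
  induction h with
  | base M a hE h => exact .base _ a hE h
  | parallel M a b hae hbe h hT hM ih =>
    refine .parallel _ a b hae hbe h ((falseTwins_congr hG ?_ ?_).1 hT) (ih fun x hx y hy => ?_)
    · exact ⟨h.left_mem, hae⟩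
    · exact ⟨h.right_mem, hbe⟩
    · exact hG x ⟨hx.1.1, hx.2⟩ y ⟨hy.1.1, hy.2⟩
  | series M a b hae hbe h hT hM ih =>
    refine .series _ a b hae hbe h ((falseTwins_congr ?_ ?_ ?_).1 hT) (ih fun x hx y hy => ?_)
    · intro x hx y hy
      simp only [SimpleGraph.compl_adj, hG x hx y hy]
    · exact ⟨h.left_mem, hae⟩
    · exact ⟨h.right_mem, hbe⟩
    · exact hG x ⟨hx.1.1, hx.2⟩ y ⟨hy.1.1, hy.2⟩

lemma mapEquiv (h : Represents e G M) (f : β ≃ γ) {G' : SimpleGraph γ}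
    (hG : ∀ x ∈ M.E \ {e}, ∀ y ∈ M.E \ {e}, G.Adj x y ↔ G'.Adj (f x) (f y)) :
    Represents (f e) G' (M.mapEquiv f) := by
  induction h with
  | base M a hE h => exact .base _ (f a) (by simp [hE, image_pair]) (h.mapEquiv f)
  | parallel M a b hae hbe h hT hM ih =>
    refine .parallel _ (f a) (f b) (f.injective.ne hae) (f.injective.ne hbe) (h.mapEquiv f) ?_ ?_
    · have ha : a ∈ M.E \ {e} := ⟨h.left_mem, hae⟩
      have hb : b ∈ M.E \ {e} := ⟨h.right_mem, hbe⟩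
      refine ⟨fun h' => hT.1 ((hG a ha b hb).2 h'), ?_⟩
      rintro _ ⟨⟨i, hi, rfl⟩, hie⟩ hia hib
      have hi' : i ∈ M.E \ {e} := ⟨hi, fun h => hie (by simp at h; simp [h])⟩
      erw [← hG a ha i hi', ← hG b hb i hi']
      exact hT.2 i hi' (fun h => hia (h ▸ rfl)) (fun h => hib (h ▸ rfl))
    · rw [← mapEquiv_delete]
      exact ih fun x hx y hy => hG x ⟨hx.1.1, hx.2⟩ y ⟨hy.1.1, hy.2⟩
  | series M a b hae hbe h hT hM ih =>
    refine .series _ (f a) (f b) (f.injective.ne hae) (f.injective.ne hbe)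
      (by rw [mapEquiv_dual]; exact h.mapEquiv f) ?_ ?_
    · have ha : a ∈ M.E \ {e} := ⟨h.left_mem, hae⟩
      have hb : b ∈ M.E \ {e} := ⟨h.right_mem, hbe⟩
      rw [falseTwins_compl_iff h.1] at hT
      rw [falseTwins_compl_iff (f.injective.ne h.1)]
      refine ⟨(hG a ha b hb).1 hT.1, ?_⟩
      rintro _ ⟨⟨i, hi, rfl⟩, hie⟩ hia hib
      have hi' : i ∈ M.E \ {e} := ⟨hi, fun h => hie (by simp at h; simp [h])⟩
      erw [← hG a ha i hi', ← hG b hb i hi']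
      exact hT.2 i hi' (fun h => hia (h ▸ rfl)) (fun h => hib (h ▸ rfl))
    · rw [← mapEquiv_contract]
      exact ih fun x hx y hy => hG x ⟨hx.1.1, hx.2⟩ y ⟨hy.1.1, hy.2⟩

lemma delete_swap (hae : a ≠ e) (hbe : b ≠ e) (h : IsPar M a b)
    (hG : FalseTwins G (M.E \ {e}) a b) (hM : Represents e G (M ＼ {b})) :
    Represents e G (M ＼ {a}) := by
  classical
  have key := hM.mapEquiv (Equiv.swap a b) (G' := G) ?_
  · rwa [mapEquiv_delete, h.mapEquiv_swap, Equiv.swap_apply_right,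
      Equiv.swap_apply_of_ne_of_ne hae.symm hbe.symm] at key
  · have hb : ∀ x ∈ (M ＼ {b}).E \ {e}, x ≠ b := fun x hx => hx.1.2
    have hsw : ∀ x ∈ (M ＼ {b}).E \ {e}, x ≠ a → Equiv.swap a b x = x := fun x hx hxa =>
      Equiv.swap_apply_of_ne_of_ne hxa (hb x hx)
    intro x hx y hy
    by_cases hxa : x = a <;> by_cases hya : y = a
    · subst hxa hya; simp
    · subst hxa
      rw [hsw y hy hya, Equiv.swap_apply_left]
      exact hG.2 y ⟨hy.1.1, hy.2⟩ hya (hb y hy)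
    · subst hya
      rw [hsw x hx hxa, Equiv.swap_apply_left, G.adj_comm x, G.adj_comm x]
      exact hG.2 x ⟨hx.1.1, hx.2⟩ hxa (hb x hx)
    · rw [hsw x hx hxa, hsw y hy hya]

end Represents

end SeriesParallel

namespace SeriesParallel

open Set Matroid

variable {β γ : Type*} {M M' N : Matroid β} {G G' : SimpleGraph β} {V W : Set β} {a b c d e x : β}

lemma falseTwins_comm : FalseTwins G V a b ↔ FalseTwins G V b a :=
  ⟨FalseTwins.symm, FalseTwins.symm⟩

lemma FalseTwins.congr_left (h : FalseTwins G V c d) (hc : c ∈ V) (hd : d ∈ V)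
    (hb : b ∈ V) (hbc : b ≠ c) (hbd : b ≠ d) : FalseTwins G V c b ↔ FalseTwins G V d b := by
  have aux : ∀ {c d}, FalseTwins G V c d → c ∈ V → b ≠ c → b ≠ d →
      FalseTwins G V c b → FalseTwins G V d b := by
    intro c d h hc hbc hbd h'
    refine ⟨fun h1 => h'.1 ((h.2 b hb hbc hbd).2 h1), fun i hi hid hib => ?_⟩
    by_cases hic : i = c
    · subst hic
      have h1 := h.1
      have h2 := h'.1
      rw [G.adj_comm] at h1 h2
      tauto
    · rw [← h.2 i hi hic hid, h'.2 i hi hic hib]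
  exact ⟨aux h hc hbc hbd, aux h.symm hd hbd hbc⟩

lemma falseTwins_diff_iff_of_falseTwins (h : FalseTwins G V c d) (hcd : c ≠ d) (hc : c ∈ V)
    (ha : a ∈ V) (hb : b ∈ V) (had : a ≠ d) (hbd : b ≠ d) :
    FalseTwins G (V \ {d}) a b ↔ FalseTwins G V a b := by
  refine ⟨fun h' => ⟨h'.1, fun i hi hia hib => ?_⟩, fun h' => h'.mono sdiff_subset⟩
  by_cases hid : i = d
  · subst hid
    have h1 := h.1
    have h2 := h'.1
    by_cases hac : a = c
    · subst hac
      by_cases hab : a = b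
      · subst hab; rfl
      have h3 := h.2 b hb (Ne.symm hab) hbd
      rw [G.adj_comm i b] at h3
      tauto
    by_cases hbc : b = c
    · subst hbc
      have h3 := h.2 a ha hac had
      rw [G.adj_comm i a, G.adj_comm b a] at h3
      tauto
    have h3 := h.2 a ha hac had
    have h4 := h.2 b hb hbc hbd
    have h5 := h'.2 c ⟨hc, hcd⟩ (Ne.symm hac) (Ne.symm hbc)
    rw [G.adj_comm c, G.adj_comm i] at h3 h4
    tauto
  · exact h'.2 i ⟨hi, hid⟩ hia hib

lemma falseTwins_diff_iff_of_trueTwins (h : FalseTwins Gᶜ V c d) (hcd : c ≠ d) (hc : c ∈ V)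
    (ha : a ∈ V) (hb : b ∈ V) (had : a ≠ d) (hbd : b ≠ d) (hac : a ≠ c) (hbc : b ≠ c) :
    FalseTwins G (V \ {d}) a b ↔ FalseTwins G V a b := by
  rw [falseTwins_compl_iff hcd] at h
  refine ⟨fun h' => ⟨h'.1, fun i hi hia hib => ?_⟩, fun h' => h'.mono sdiff_subset⟩
  by_cases hid : i = d
  · subst hid
    have h3 := h.2 a ha hac had
    have h4 := h.2 b hb hbc hbd
    have h5 := h'.2 c ⟨hc, hcd⟩ (Ne.symm hac) (Ne.symm hbc)
    rw [G.adj_comm c, G.adj_comm i] at h3 h4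
    tauto
  · exact h'.2 i ⟨hi, hid⟩ hia hib

lemma not_falseTwins_of_trueTwins (h : FalseTwins Gᶜ V c d) (hcd : c ≠ d)
    (hd : d ∈ V) (hb : b ∈ V) (hcb : c ≠ b) : ¬ FalseTwins G V c b := by
  rw [falseTwins_compl_iff hcd] at h
  intro h'
  by_cases hbd : b = d
  · subst hbd; exact h'.1 h.1
  · have h1 := h'.2 d hd hcd.symm (Ne.symm hbd)
    have h2 := h.2 b hb hcb.symm hbd
    rw [G.adj_comm b] at h1
    have := h.1
    have := h'.1
    tauto

/-- A series pair that survives as a nonloop after contraction is not also a parallel pair. -/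
lemma IsPar.ne_of_series (h : IsPar M a b) (h' : IsPar M✶ c d) (hc : (M ／ {d}).IsNonloop c) :
    a ≠ c ∧ a ≠ d ∧ b ≠ c ∧ b ≠ d := by
  have key : ∀ {a b}, IsPar M a b → a ≠ c ∧ a ≠ d := by
    intro a b h
    by_contra hn
    have ha : a ∈ ({c, d} : Set β) := by simp; tauto
    have hb := h.mem_of_series h' ha
    have hab := h.1
    have hcd : M.closure {c} = M.closure {d} := by
      simp only [mem_insert_iff, mem_singleton_iff] at ha hb
      rcases ha with rfl | rfl <;> rcases hb with rfl | rfl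
      · exact absurd rfl hab
      · exact h.2.2.2
      · exact h.2.2.2.symm
      · exact absurd rfl hab
    rw [contract_isNonloop_iff, ← hcd] at hc
    exact hc.2 (M.mem_closure_self c hc.1)
  exact ⟨(key h).1, (key h).2, (key h.symm).1, (key h.symm).2⟩

namespace Represents

lemma isNonloop_contract (hM : Represents e G (M ／ {b})) (h : IsPar M✶ a b) :
    (M ／ {b}).IsNonloop a :=
  hM.isNonloop a ⟨h.left_mem, h.1⟩

lemma isPar_iff (hM : Represents e G M) {a b : β} (ha : a ∈ M.E \ {e}) (hb : b ∈ M.E \ {e})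
    (hab : a ≠ b) : IsPar M a b ↔ FalseTwins G (M.E \ {e}) a b := by
  induction hM generalizing a b with
  | base M x hE h =>
    rw [hE] at ha hb
    simp at ha hb
    exact absurd (ha.1.trans hb.1.symm) hab
  | parallel M c d hce hde h hT hN ih =>
    have hc : c ∈ M.E \ {e} := ⟨h.left_mem, hce⟩
    have hd : d ∈ M.E \ {e} := ⟨h.right_mem, hde⟩
    have h0 : ∀ {a b}, a ∈ M.E \ {e} → b ∈ M.E \ {e} → a ≠ b → a ≠ d → b ≠ d →
        (IsPar M a b ↔ FalseTwins G (M.E \ {e}) a b) := by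
      intro a b ha hb hab had hbd
      have := ih (a := a) (b := b) ⟨⟨ha.1, had⟩, ha.2⟩ ⟨⟨hb.1, hbd⟩, hb.2⟩ hab
      rw [isPar_delete_iff, delete_ground, sdiff_right_comm,
        falseTwins_diff_iff_of_falseTwins hT h.1 hc ha hb had hbd] at this
      tauto
    have h1 : ∀ {b}, b ∈ M.E \ {e} → d ≠ b →
        (IsPar M d b ↔ FalseTwins G (M.E \ {e}) d b) := by
      intro b hb hbd
      by_cases hbc : b = c
      · subst hbc
        exact ⟨fun _ => hT.symm, fun _ => h.symm⟩
      · rw [← hT.congr_left hc hd hb hbc hbd.symm, ← h.congr_left (Ne.symm hbc) hbd]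
        exact h0 hc hb (Ne.symm hbc) h.1 hbd.symm
    by_cases had : a = d
    · subst had; exact h1 hb hab
    by_cases hbd : b = d
    · subst hbd; rw [isPar_comm, falseTwins_comm]; exact h1 ha hab.symm
    exact h0 ha hb hab had hbd
  | series M c d hce hde h hT hN ih =>
    have hc : c ∈ M.E \ {e} := ⟨h.left_mem, hce⟩
    have hd : d ∈ M.E \ {e} := ⟨h.right_mem, hde⟩
    have hno := hN.isNonloop_contract h
    by_cases hac : a = c
    · subst hac
      exact iff_of_false (fun h' => (h'.ne_of_series h hno).1 rfl)
        (not_falseTwins_of_trueTwins hT h.1 hd hb hab)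
    by_cases hbc : b = c
    · subst hbc
      exact iff_of_false (fun h' => (h'.ne_of_series h hno).2.2.1 rfl)
        (falseTwins_comm.not.1 (not_falseTwins_of_trueTwins hT h.1 hd ha hab.symm))
    by_cases had : a = d
    · subst had
      exact iff_of_false (fun h' => (h'.ne_of_series h hno).2.1 rfl)
        (not_falseTwins_of_trueTwins hT.symm h.1.symm hc hb hab)
    by_cases hbd : b = d
    · subst hbd
      exact iff_of_false (fun h' => (h'.ne_of_series h hno).2.2.2 rfl)
        (falseTwins_comm.not.1 (not_falseTwins_of_trueTwins hT.symm h.1.symm hc ha hab.symm))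
    have := ih (a := a) (b := b) ⟨⟨ha.1, had⟩, ha.2⟩ ⟨⟨hb.1, hbd⟩, hb.2⟩ hab
    rwa [isPar_contract_iff h hac hbc had hbd, contract_ground, sdiff_right_comm,
      falseTwins_diff_iff_of_trueTwins hT h.1 hc ha hb had hbd hac hbc] at this

lemma isPar_root_iff (hM : Represents e G M) {a : β} (ha : a ∈ M.E \ {e}) :
    IsPar M e a ↔ ∀ i ∈ M.E \ {e}, ¬ G.Adj a i := by
  induction hM generalizing a with
  | base M x hE h =>
    have hx : ∀ i ∈ M.E \ {e}, i = x := by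
      intro i hi
      rw [hE] at hi
      simp at hi
      exact hi.1
    obtain rfl := hx a ha
    refine iff_of_true h fun i hi => ?_
    obtain rfl := hx i hi
    exact G.irrefl
  | parallel M c d hce hde h hT hN ih =>
    have hc : c ∈ M.E \ {e} := ⟨h.left_mem, hce⟩
    have hd : d ∈ M.E \ {e} := ⟨h.right_mem, hde⟩
    have h0 : ∀ {a}, a ∈ M.E \ {e} → a ≠ d →
        (IsPar M e a ↔ ∀ i ∈ M.E \ {e}, ¬ G.Adj a i) := by
      intro a ha had
      have := ih (a := a) ⟨⟨ha.1, had⟩, ha.2⟩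
      rw [isPar_delete_iff, and_iff_left ⟨hde.symm, had⟩] at this
      rw [this]
      refine ⟨fun h' i hi => ?_, fun h' i hi => h' i ⟨hi.1.1, hi.2⟩⟩
      by_cases hid : i = d
      · subst hid
        by_cases hac : a = c
        · subst hac; exact hT.1
        · rw [G.adj_comm, ← hT.2 a ha hac had, G.adj_comm]
          exact h' c ⟨⟨hc.1, h.1⟩, hc.2⟩
      · exact h' i ⟨⟨hi.1, hid⟩, hi.2⟩
    by_cases had : a = d
    · subst had
      rw [isPar_comm, ← h.congr_left hce hde, isPar_comm, h0 hc h.1]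
      refine forall₂_congr fun i hi => not_congr ?_
      by_cases hic : i = c
      · subst hic
        rw [G.adj_comm a i]
        exact iff_of_false G.irrefl hT.1
      by_cases hia : i = a
      · subst hia
        exact iff_of_false hT.1 G.irrefl
      exact hT.2 i hi hic hia
    · exact h0 ha had
  | series M c d hce hde h hT hN ih =>
    have hc : c ∈ M.E \ {e} := ⟨h.left_mem, hce⟩
    have hd : d ∈ M.E \ {e} := ⟨h.right_mem, hde⟩
    have hno := hN.isNonloop_contract h
    have hT' := (falseTwins_compl_iff h.1).1 hT
    by_cases hac : a = c
    · subst hac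
      exact iff_of_false (fun h' => (h'.ne_of_series h hno).2.2.1 rfl) fun h' => h' d hd hT'.1
    by_cases had : a = d
    · subst had
      exact iff_of_false (fun h' => (h'.ne_of_series h hno).2.2.2 rfl) fun h' => h' c hc hT'.1.symm
    have := ih (a := a) ⟨⟨ha.1, had⟩, ha.2⟩
    rw [isPar_contract_iff h hce.symm hac hde.symm had] at this
    rw [this]
    refine ⟨fun h' i hi => ?_, fun h' i hi => h' i ⟨hi.1.1, hi.2⟩⟩
    by_cases hid : i = d
    · subst hid
      rw [G.adj_comm, ← hT'.2 a ha hac had, G.adj_comm]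
      exact h' c ⟨⟨hc.1, h.1⟩, hc.2⟩
    · exact h' i ⟨⟨hi.1, hid⟩, hi.2⟩

lemma delete_of_isPar (hM : Represents e G M) {a b : β} (hae : a ≠ e) (hbe : b ≠ e)
    (hab : IsPar M a b) : Represents e G (M ＼ {b}) := by
  induction hM generalizing a b with
  | base M x hE h =>
    have ha := hab.left_mem
    have hb := hab.right_mem
    rw [hE] at ha hb
    simp at ha hb
    exact absurd ((ha.resolve_left hae).trans (hb.resolve_left hbe).symm) hab.1
  | parallel M c d hce hde h hT hN ih =>
    by_cases hbd : b = d
    · subst hbd; exact hN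
    by_cases hbc : b = c
    · subst hbc; exact hN.delete_swap hce hde h hT
    have key : ∀ {a}, a ≠ e → a ≠ d → IsPar M a b → Represents e G (M ＼ {b}) := by
      intro a hae had hab
      refine .parallel _ c d hce hde (isPar_delete_iff.2 ⟨h, Ne.symm hbc, Ne.symm hbd⟩) ?_ ?_
      · rw [delete_ground]
        exact hT.mono fun x hx => ⟨hx.1.1, hx.2⟩
      · rw [delete_comm]
        exact ih hae hbe (isPar_delete_iff.2 ⟨hab, had, hbd⟩)
    by_cases had : a = d
    · subst had
      exact key hce h.1 (h.trans hab (Ne.symm hbc))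
    · exact key hae had hab
  | series M c d hce hde h hT hN ih =>
    have hno := hN.isNonloop_contract h
    obtain ⟨hac, had, hbc, hbd⟩ := hab.ne_of_series h hno
    refine .series _ c d hce hde
      ((isPar_dual_delete_iff hab hac.symm had.symm hbc.symm hbd.symm).2 h) ?_ ?_
    · rw [delete_ground]
      exact hT.mono fun x hx => ⟨hx.1.1, hx.2⟩
    · have := ih hae hbe ((isPar_contract_iff h hac hbc had hbd).2 hab)
      rwa [contract_delete_comm _ (by simpa using Ne.symm hbd)] at this

lemma contract_of_isPar_dual (hM : Represents e G M) {a b : β} (hae : a ≠ e) (hbe : b ≠ e)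
    (hab : IsPar M✶ a b) : Represents e G (M ／ {b}) := by
  refine of_dual ?_
  rw [dual_contract]
  exact hM.dual.delete_of_isPar hae hbe hab

lemma isPar_dual_iff (hM : Represents e G M) {a b : β} (ha : a ∈ M.E \ {e}) (hb : b ∈ M.E \ {e})
    (hab : a ≠ b) : IsPar M✶ a b ↔ FalseTwins Gᶜ (M.E \ {e}) a b :=
  hM.dual.isPar_iff ha hb hab

lemma eq_base (h : Represents e G M) (hE : M.E = {e, a}) : IsPar M e a := by
  cases h with
  | base M x hE' h =>
    have hx : x ∈ ({e, a} : Set β) := by rw [← hE, hE']; simp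
    rcases hx with rfl | rfl
    · exact absurd rfl h.1
    · exact h
  | parallel M c d hce hde h hT hN =>
    have h1 := h.left_mem
    have h2 := h.right_mem
    rw [hE] at h1 h2
    simp at h1 h2
    exact absurd ((h1.resolve_left hce).trans (h2.resolve_left hde).symm) h.1
  | series M c d hce hde h hT hN =>
    have h1 : c ∈ M.E := h.left_mem
    have h2 : d ∈ M.E := h.right_mem
    rw [hE] at h1 h2
    simp at h1 h2
    exact absurd ((h1.resolve_left hce).trans (h2.resolve_left hde).symm) h.1

/-- The graph determines the matroid. -/
theorem matroid_unique (h : Represents e G M) (h' : Represents e G M') (hE : M.E = M'.E) :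
    M = M' := by
  induction h generalizing M' with
  | base M a hM h =>
    have hp := h'.eq_base (hE.symm.trans hM)
    refine eq_of_isPar_of_delete_eq hE h hp (ext_indep (by simp [hE]) fun I hI => ?_)
    have hI' : I ⊆ {e} := fun x hx => by
      have := hI hx
      rw [delete_ground, hM] at this
      simp at this ⊢
      tauto
    rcases subset_singleton_iff_eq.1 hI' with rfl | rfl
    · simp
    · simp [h.2.1, hp.2.1]
  | parallel M c d hce hde h hT hN ih =>
    have hc : c ∈ M.E \ {e} := ⟨h.left_mem, hce⟩
    have hd : d ∈ M.E \ {e} := ⟨h.right_mem, hde⟩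
    have h2 : IsPar M' c d := by
      rw [hE] at hc hd hT
      exact (h'.isPar_iff hc hd h.1).2 hT
    exact eq_of_isPar_of_delete_eq hE h h2
      (ih (h'.delete_of_isPar hce hde h2) (by simp [hE]))
  | series M c d hce hde h hT hN ih =>
    have hc : c ∈ M.E \ {e} := ⟨h.left_mem, hce⟩
    have hd : d ∈ M.E \ {e} := ⟨h.right_mem, hde⟩
    have h2 : IsPar M'✶ c d := by
      rw [hE] at hc hd hT
      exact (h'.isPar_dual_iff hc hd h.1).2 hT
    have := ih (h'.contract_of_isPar_dual hce hde h2) (by simp [hE])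
    rw [← dual_inj]
    refine eq_of_isPar_of_delete_eq hE h h2 ?_
    rw [← dual_contract, this, dual_contract]

/-- The matroid determines the graph. -/
theorem graph_unique (h : Represents e G M) (h' : Represents e G' M) :
    ∀ x ∈ M.E \ {e}, ∀ y ∈ M.E \ {e}, G.Adj x y ↔ G'.Adj x y := by
  induction h with
  | base M a hM h =>
    intro x hx y hy
    rw [hM] at hx hy
    simp at hx hy
    obtain rfl := hx.1.trans hy.1.symm
    exact iff_of_false G.irrefl G'.irrefl
  | parallel M c d hce hde h hT hN ih =>
    have hc : c ∈ M.E \ {e} := ⟨h.left_mem, hce⟩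
    have hd : d ∈ M.E \ {e} := ⟨h.right_mem, hde⟩
    have hT' := (h'.isPar_iff hc hd h.1).1 h
    have ih := ih (h'.delete_of_isPar hce hde h)
    have key : ∀ x ∈ M.E \ {e}, x ≠ d → (G.Adj d x ↔ G'.Adj d x) := by
      intro x hx hxd
      by_cases hxc : x = c
      · subst hxc
        rw [G.adj_comm, G'.adj_comm]
        exact iff_of_false hT.1 hT'.1
      · rw [← hT.2 x hx hxc hxd, ← hT'.2 x hx hxc hxd]
        exact ih c ⟨⟨hc.1, h.1⟩, hc.2⟩ x ⟨⟨hx.1, hxd⟩, hx.2⟩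
    intro x hx y hy
    by_cases hxd : x = d
    · by_cases hyd : y = d
      · subst hxd hyd; exact iff_of_false G.irrefl G'.irrefl
      · subst hxd; exact key y hy hyd
    · by_cases hyd : y = d
      · subst hyd; rw [G.adj_comm, G'.adj_comm]; exact key x hx hxd
      · exact ih x ⟨⟨hx.1, hxd⟩, hx.2⟩ y ⟨⟨hy.1, hyd⟩, hy.2⟩
  | series M c d hce hde h hT hN ih =>
    have hc : c ∈ M.E \ {e} := ⟨h.left_mem, hce⟩
    have hd : d ∈ M.E \ {e} := ⟨h.right_mem, hde⟩
    have hT' := (h'.isPar_dual_iff hc hd h.1).1 h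
    rw [falseTwins_compl_iff h.1] at hT hT'
    have ih := ih (h'.contract_of_isPar_dual hce hde h)
    have key : ∀ x ∈ M.E \ {e}, x ≠ d → (G.Adj d x ↔ G'.Adj d x) := by
      intro x hx hxd
      by_cases hxc : x = c
      · subst hxc
        rw [G.adj_comm, G'.adj_comm]
        exact iff_of_true hT.1 hT'.1
      · rw [← hT.2 x hx hxc hxd, ← hT'.2 x hx hxc hxd]
        exact ih c ⟨⟨hc.1, h.1⟩, hc.2⟩ x ⟨⟨hx.1, hxd⟩, hx.2⟩
    intro x hx y hy
    by_cases hxd : x = d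
    · by_cases hyd : y = d
      · subst hxd hyd; exact iff_of_false G.irrefl G'.irrefl
      · subst hxd; exact key y hy hyd
    · by_cases hyd : y = d
      · subst hyd; rw [G.adj_comm, G'.adj_comm]; exact key x hx hxd
      · exact ih x ⟨⟨hx.1, hxd⟩, hx.2⟩ y ⟨⟨hy.1, hyd⟩, hy.2⟩

/-- Adding an element parallel to the root adds an isolated vertex. -/
lemma parallel_root (hN : Represents e G (M ＼ {b})) (h : IsPar M e b)
    (hb : ∀ i ∈ M.E, ¬ G.Adj b i) : Represents e G M := by
  obtain ⟨N, hNM⟩ : ∃ N, N = M ＼ {b} := ⟨_, rfl⟩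
  rw [← hNM] at hN
  have hbe : b ≠ e := h.1.symm
  induction hN generalizing M with
  | base N x hE h' =>
    have hx : IsPar M e x ∧ e ≠ b ∧ x ≠ b := isPar_delete_iff.1 (hNM ▸ h')
    refine .parallel _ x b h'.1.symm hbe (hx.1.symm.trans h hx.2.2) ?_ ?_
    · refine ⟨fun h => hb x hx.1.right_mem h.symm, fun i hi hix hib => ?_⟩
      have : i ∈ N.E := by rw [hNM]; exact ⟨hi.1, hib⟩
      rw [hE] at this
      rcases this with rfl | rfl
      · exact absurd rfl hi.2
      · exact absurd rfl hix
    · rw [← hNM]; exact .base N x hE h'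
  | parallel N c d hce hde h' hT hN ih =>
    subst hNM
    obtain ⟨hp, hcb, hdb⟩ := isPar_delete_iff.1 h'
    refine .parallel _ c d hce hde hp ?_ ?_
    · refine ⟨hT.1, fun i hi hic hid => ?_⟩
      by_cases hib : i = b
      · subst hib
        rw [G.adj_comm, G.adj_comm d]
        exact iff_of_false (hb c hp.left_mem) (hb d hp.right_mem)
      · exact hT.2 i ⟨⟨hi.1, hib⟩, hi.2⟩ hic hid
    · exact ih (isPar_delete_iff.2 ⟨h, hde.symm, hdb.symm⟩) (fun i hi => hb i hi.1)
        (delete_comm _ _ _)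
  | series N c d hce hde h' hT hN ih =>
    subst hNM
    have hcb : c ≠ b := h'.left_mem.2
    have hdb : d ≠ b := h'.right_mem.2
    have hp : IsPar M✶ c d := (isPar_dual_delete_iff h hce hde hcb hdb).1 h'
    refine .series _ c d hce hde hp ?_ ?_
    · rw [falseTwins_compl_iff h'.1] at hT ⊢
      refine ⟨hT.1, fun i hi hic hid => ?_⟩
      by_cases hib : i = b
      · subst hib
        rw [G.adj_comm, G.adj_comm d]
        exact iff_of_false (hb c hp.left_mem) (hb d hp.right_mem)
      · exact hT.2 i ⟨⟨hi.1, hib⟩, hi.2⟩ hic hid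
    · refine ih ((isPar_contract_iff hp hce.symm hcb.symm hde.symm hdb.symm).2 h)
        (fun i hi => hb i hi.1) ?_
      rw [contract_delete_comm _ (by simpa using hdb)]

end Represents

end SeriesParallel

namespace SeriesParallel

open Set Matroid

lemma IsPar.eRank_delete {β : Type*} {M : Matroid β} {a b : β} (h : IsPar M a b) :
    (M ＼ {b}).eRank = M.eRank := by
  rw [delete_eq_restrict]
  refine Spanning.eRank_restrict ?_
  rw [spanning_iff_closure_eq]
  refine subset_antisymm (M.closure_subset_ground _) fun x hx => ?_
  by_cases hxb : x = b
  · subst hxb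
    exact h.mem_closure_iff.1 (M.mem_closure_of_mem ⟨h.left_mem, h.1⟩)
  · exact M.mem_closure_of_mem ⟨hx, hxb⟩

lemma eRank_contract_add_one {β : Type*} {M : Matroid β} {b : β} (h : M.IsNonloop b) :
    (M ／ {b}).eRank + 1 = M.eRank := by
  obtain ⟨B, hB⟩ := (M ／ {b}).exists_isBase
  have h1 := ((indep_singleton.2 h).contract_isBase_iff).1 hB
  rw [← hB.encard_eq_eRank, ← h1.1.encard_eq_eRank, encard_union_eq h1.2, encard_singleton]

lemma IsPar.eRank_contract {β : Type*} {M : Matroid β} {a b : β} (h : IsPar M✶ a b) :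
    (M ／ {b}).eRank + 1 = M.eRank :=
  eRank_contract_add_one (isNonloop_of_series h.symm)

lemma IsPar.eRank_eq_one {β : Type*} {M : Matroid β} {a b : β} (h : IsPar M a b)
    (hE : M.E = {a, b}) : M.eRank = 1 := by
  rw [← h.2.1.eRk_eq]
  refine (Spanning.eRk_eq ?_).symm
  rw [spanning_iff_closure_eq (by simp [hE])]
  refine subset_antisymm (M.closure_subset_ground _) fun x hx => ?_
  rw [hE] at hx
  rcases hx with rfl | rfl
  · exact M.mem_closure_self _ h.left_mem
  · rw [h.2.2.2]; exact M.mem_closure_self _ h.right_mem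

variable {β : Type*} [DecidableEq β] {M M' N : Matroid β} {G G' : SimpleGraph β}
  {V W : Finset β} {k l m : ℕ} {a b c d e x : β}

/-- `IsCograph G V k`: the graph induced by `G` on `V` is a cograph, and the corresponding rooted
series-parallel matroid has rank `k`. -/
inductive IsCograph (G : SimpleGraph β) : Finset β → ℕ → Prop
  | single (v : β) : IsCograph G {v} 1
  | union (V W : Finset β) (k l m : ℕ) (hVW : Disjoint V W) (h : ∀ x ∈ V, ∀ y ∈ W, ¬ G.Adj x y)
      (hV : IsCograph G V k) (hW : IsCograph G W l) (hm : k + l = m + 1) : IsCograph G (V ∪ W) m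
  | join (V W : Finset β) (k l : ℕ) (hVW : Disjoint V W) (h : ∀ x ∈ V, ∀ y ∈ W, G.Adj x y)
      (hV : IsCograph G V k) (hW : IsCograph G W l) : IsCograph G (V ∪ W) (k + l)

namespace IsCograph

lemma nonempty (h : IsCograph G V k) : V.Nonempty := by
  induction h with
  | single v => simp
  | union V W k l m hVW h hV hW hm ihV ihW => exact ihV.mono Finset.subset_union_left
  | join V W k l hVW h hV hW ihV ihW => exact ihV.mono Finset.subset_union_left

lemma rank_pos (h : IsCograph G V k) : 1 ≤ k := by
  induction h with
  | single v => simp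
  | union V W k l m hVW h hV hW hm ihV ihW => omega
  | join V W k l hVW h hV hW ihV ihW => omega

lemma congr (h : IsCograph G V k) (hG : ∀ x ∈ V, ∀ y ∈ V, G.Adj x y ↔ G'.Adj x y) :
    IsCograph G' V k := by
  induction h with
  | single v => exact .single v
  | union V W k l m hVW h hV hW hm ihV ihW =>
    refine .union V W k l m hVW (fun x hx y hy => ?_) (ihV fun x hx y hy => ?_)
      (ihW fun x hx y hy => ?_) hm
    · rw [← hG x (by simp [hx]) y (by simp [hy])]; exact h x hx y hy
    · exact hG x (by simp [hx]) y (by simp [hy])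
    · exact hG x (by simp [hx]) y (by simp [hy])
  | join V W k l hVW h hV hW ihV ihW =>
    refine .join V W k l hVW (fun x hx y hy => ?_) (ihV fun x hx y hy => ?_)
      (ihW fun x hx y hy => ?_)
    · rw [← hG x (by simp [hx]) y (by simp [hy])]; exact h x hx y hy
    · exact hG x (by simp [hx]) y (by simp [hy])
    · exact hG x (by simp [hx]) y (by simp [hy])

lemma mono (h : IsCograph G V k) (hW : W ⊆ V) (hne : W.Nonempty) : ∃ l, IsCograph G W l := by
  induction h generalizing W with
  | single v => exact ⟨1, by rw [(Finset.subset_singleton_iff.1 hW).resolve_left hne.ne_empty];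
                              exact .single v⟩
  | union V V' k l m hVW h hV hV' hm ihV ihV' =>
    have hu : W = (W ∩ V) ∪ (W ∩ V') := by
      rw [← Finset.inter_union_distrib_left]; exact (Finset.inter_eq_left.2 hW).symm
    rcases (W ∩ V).eq_empty_or_nonempty with h1 | h1
    · rw [h1, Finset.empty_union] at hu
      exact ihV' (Finset.inter_eq_left.1 hu.symm) hne
    rcases (W ∩ V').eq_empty_or_nonempty with h2 | h2
    · rw [h2, Finset.union_empty] at hu
      exact ihV (Finset.inter_eq_left.1 hu.symm) hne
    obtain ⟨k1, hk1⟩ := ihV Finset.inter_subset_right h1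
    obtain ⟨k2, hk2⟩ := ihV' Finset.inter_subset_right h2
    rw [hu]
    have := hk1.rank_pos
    refine ⟨k1 + k2 - 1, .union _ _ k1 k2 _ (hVW.mono Finset.inter_subset_right
      Finset.inter_subset_right) (fun x hx y hy => h x (Finset.mem_inter.1 hx).2 y
      (Finset.mem_inter.1 hy).2) hk1 hk2 (by omega)⟩
  | join V V' k l hVW h hV hV' ihV ihV' =>
    have hu : W = (W ∩ V) ∪ (W ∩ V') := by
      rw [← Finset.inter_union_distrib_left]; exact (Finset.inter_eq_left.2 hW).symm
    rcases (W ∩ V).eq_empty_or_nonempty with h1 | h1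
    · rw [h1, Finset.empty_union] at hu
      exact ihV' (Finset.inter_eq_left.1 hu.symm) hne
    rcases (W ∩ V').eq_empty_or_nonempty with h2 | h2
    · rw [h2, Finset.union_empty] at hu
      exact ihV (Finset.inter_eq_left.1 hu.symm) hne
    obtain ⟨k1, hk1⟩ := ihV Finset.inter_subset_right h1
    obtain ⟨k2, hk2⟩ := ihV' Finset.inter_subset_right h2
    rw [hu]
    refine ⟨k1 + k2, .join _ _ k1 k2 (hVW.mono Finset.inter_subset_right
      Finset.inter_subset_right) (fun x hx y hy => h x (Finset.mem_inter.1 hx).2 y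
      (Finset.mem_inter.1 hy).2) hk1 hk2⟩

lemma union' (hV : IsCograph G V k) (hW : IsCograph G W l) (hVW : Disjoint V W)
    (h : ∀ x ∈ V, ∀ y ∈ W, ¬ G.Adj x y) {U : Finset β} (hU : V ∪ W = U) (hm : k + l = m + 1) :
    IsCograph G U m := hU ▸ .union V W k l m hVW h hV hW hm

lemma join' (hV : IsCograph G V k) (hW : IsCograph G W l) (hVW : Disjoint V W)
    (h : ∀ x ∈ V, ∀ y ∈ W, G.Adj x y) {U : Finset β} (hU : V ∪ W = U) (hm : k + l = m) :
    IsCograph G U m := hm ▸ hU ▸ .join V W k l hVW h hV hW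

lemma insert_falseTwin (h : IsCograph G V k) (hc : c ∈ V) (hd : d ∉ V)
    (hT : FalseTwins G (insert d V : Finset β) c d) : IsCograph G (insert d V) k := by
  induction h with
  | single v =>
    obtain rfl := Finset.mem_singleton.1 hc
    refine union' (.single d) (.single c) (by simpa using hd) ?_ rfl rfl
    simp only [Finset.mem_singleton]
    rintro _ rfl _ rfl h
    exact hT.1 h.symm
  | union V W k l m hVW h hV hW hm ihV ihW =>
    simp only [Finset.mem_union, not_or] at hc hd
    rcases hc with hc | hc
    · refine union' (ihV hc hd.1 (hT.mono ?_)) hW (by simp [hd.2, hVW]) ?_ ?_ hm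
      · intro x; simp; tauto
      · intro x hx y hy
        rcases Finset.mem_insert.1 hx with rfl | hx
        · rw [← hT.2 y (by simp [hy])]
          · exact h c hc y hy
          · rintro rfl; exact Finset.disjoint_left.1 hVW hc hy
          · rintro rfl; exact hd.2 hy
        · exact h x hx y hy
      · rw [Finset.insert_union]
    · refine union' hV (ihW hc hd.2 (hT.mono ?_)) (by simp [hd.1, hVW]) ?_ ?_ hm
      · intro x; simp; tauto
      · intro y hy x hx
        rcases Finset.mem_insert.1 hx with rfl | hx
        · rw [G.adj_comm, ← hT.2 y (by simp [hy]), G.adj_comm]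
          · exact h y hy c hc
          · rintro rfl; exact Finset.disjoint_left.1 hVW hy hc
          · rintro rfl; exact hd.1 hy
        · exact h y hy x hx
      · rw [Finset.union_insert]
  | join V W k l hVW h hV hW ihV ihW =>
    simp only [Finset.mem_union, not_or] at hc hd
    rcases hc with hc | hc
    · refine join' (ihV hc hd.1 (hT.mono ?_)) hW (by simp [hd.2, hVW]) ?_ ?_ rfl
      · intro x; simp; tauto
      · intro x hx y hy
        rcases Finset.mem_insert.1 hx with rfl | hx
        · rw [← hT.2 y (by simp [hy])]
          · exact h c hc y hy
          · rintro rfl; exact Finset.disjoint_left.1 hVW hc hy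
          · rintro rfl; exact hd.2 hy
        · exact h x hx y hy
      · rw [Finset.insert_union]
    · refine join' hV (ihW hc hd.2 (hT.mono ?_)) (by simp [hd.1, hVW]) ?_ ?_ rfl
      · intro x; simp; tauto
      · intro y hy x hx
        rcases Finset.mem_insert.1 hx with rfl | hx
        · rw [G.adj_comm, ← hT.2 y (by simp [hy]), G.adj_comm]
          · exact h y hy c hc
          · rintro rfl; exact Finset.disjoint_left.1 hVW hy hc
          · rintro rfl; exact hd.1 hy
        · exact h y hy x hx
      · rw [Finset.union_insert]

lemma insert_trueTwin (h : IsCograph G V k) (hc : c ∈ V) (hd : d ∉ V)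
    (hT : FalseTwins Gᶜ (insert d V : Finset β) c d) : IsCograph G (insert d V) (k + 1) := by
  induction h with
  | single v =>
    obtain rfl := Finset.mem_singleton.1 hc
    rw [falseTwins_compl_iff (by simpa [eq_comm] using hd)] at hT
    refine join' (.single d) (.single c) (by simpa using hd) ?_ rfl rfl
    simp only [Finset.mem_singleton]
    rintro _ rfl _ rfl
    exact hT.1.symm
  | union V W k l m hVW h hV hW hm ihV ihW =>
    have hcd : c ≠ d := by rintro rfl; exact hd hc
    simp only [Finset.mem_union, not_or] at hc hd
    have hT' := (falseTwins_compl_iff hcd).1 hT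
    rcases hc with hc | hc
    · refine union' (ihV hc hd.1 (hT.mono ?_)) hW (by simp [hd.2, hVW]) ?_ ?_ (by omega)
      · intro x; simp; tauto
      · intro x hx y hy
        rcases Finset.mem_insert.1 hx with rfl | hx
        · rw [← hT'.2 y (by simp [hy])]
          · exact h c hc y hy
          · rintro rfl; exact Finset.disjoint_left.1 hVW hc hy
          · rintro rfl; exact hd.2 hy
        · exact h x hx y hy
      · rw [Finset.insert_union]
    · refine union' hV (ihW hc hd.2 (hT.mono ?_)) (by simp [hd.1, hVW]) ?_ ?_ (by omega)
      · intro x; simp; tauto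
      · intro y hy x hx
        rcases Finset.mem_insert.1 hx with rfl | hx
        · rw [G.adj_comm, ← hT'.2 y (by simp [hy]), G.adj_comm]
          · exact h y hy c hc
          · rintro rfl; exact Finset.disjoint_left.1 hVW hy hc
          · rintro rfl; exact hd.1 hy
        · exact h y hy x hx
      · rw [Finset.union_insert]
  | join V W k l hVW h hV hW ihV ihW =>
    have hcd : c ≠ d := by rintro rfl; exact hd hc
    simp only [Finset.mem_union, not_or] at hc hd
    have hT' := (falseTwins_compl_iff hcd).1 hT
    rcases hc with hc | hc
    · refine join' (ihV hc hd.1 (hT.mono ?_)) hW (by simp [hd.2, hVW]) ?_ ?_ (by omega)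
      · intro x; simp; tauto
      · intro x hx y hy
        rcases Finset.mem_insert.1 hx with rfl | hx
        · rw [← hT'.2 y (by simp [hy])]
          · exact h c hc y hy
          · rintro rfl; exact Finset.disjoint_left.1 hVW hc hy
          · rintro rfl; exact hd.2 hy
        · exact h x hx y hy
      · rw [Finset.insert_union]
    · refine join' hV (ihW hc hd.2 (hT.mono ?_)) (by simp [hd.1, hVW]) ?_ ?_ (by omega)
      · intro x; simp; tauto
      · intro y hy x hx
        rcases Finset.mem_insert.1 hx with rfl | hx
        · rw [G.adj_comm, ← hT'.2 y (by simp [hy]), G.adj_comm]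
          · exact h y hy c hc
          · rintro rfl; exact Finset.disjoint_left.1 hVW hy hc
          · rintro rfl; exact hd.1 hy
        · exact h y hy x hx
      · rw [Finset.union_insert]

lemma rank_eq_one (h : IsCograph G V k) (hV : V.card = 1) : k = 1 := by
  cases h with
  | single v => rfl
  | union V W k l m hVW h hV' hW hm =>
    rw [Finset.card_union_of_disjoint hVW] at hV
    have := hV'.nonempty.card_pos
    have := hW.nonempty.card_pos
    omega
  | join V W k l hVW h hV' hW =>
    rw [Finset.card_union_of_disjoint hVW] at hV
    have := hV'.nonempty.card_pos
    have := hW.nonempty.card_pos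
    omega

/-- `G` has a pair of twins in `V`, one of which can be removed. -/
def HasTwins (G : SimpleGraph β) (V : Finset β) (k : ℕ) : Prop :=
  ∃ c ∈ V, ∃ d ∈ V, c ≠ d ∧ ((FalseTwins G V c d ∧ IsCograph G (V.erase d) k) ∨
    (FalseTwins Gᶜ V c d ∧ ∃ j, k = j + 1 ∧ IsCograph G (V.erase d) j))

lemma HasTwins.union (h : HasTwins G V k) (hW : IsCograph G W l) (hVW : Disjoint V W)
    (hG : ∀ x ∈ V, ∀ y ∈ W, ¬ G.Adj x y) (hm : k + l = m + 1) : HasTwins G (V ∪ W) m := by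
  obtain ⟨c, hc, d, hd, hcd, h⟩ := h
  have hdW : d ∉ W := Finset.disjoint_left.1 hVW hd
  have hU : V.erase d ∪ W = (V ∪ W).erase d := by
    rw [Finset.erase_union_distrib, Finset.erase_eq_of_notMem hdW]
  have hdis : Disjoint (V.erase d) W := hVW.mono_left (Finset.erase_subset _ _)
  have hG' : ∀ x ∈ V.erase d, ∀ y ∈ W, ¬ G.Adj x y := fun x hx => hG x (Finset.mem_of_mem_erase hx)
  refine ⟨c, by simp [hc], d, by simp [hd], hcd, ?_⟩
  rcases h with ⟨hT, h⟩ | ⟨hT, j, rfl, h⟩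
  · refine Or.inl ⟨⟨hT.1, fun i hi hic hid => ?_⟩, union' h hW hdis hG' hU hm⟩
    simp only [Finset.coe_union, Set.mem_union, Finset.mem_coe] at hi
    rcases hi with hi | hi
    · exact hT.2 i hi hic hid
    · exact iff_of_false (hG c hc i hi) (hG d hd i hi)
  · have := hW.rank_pos
    have := h.rank_pos
    rw [falseTwins_compl_iff hcd] at hT ⊢
    refine Or.inr ⟨⟨hT.1, fun i hi hic hid => ?_⟩, m - 1, by omega,
      union' h hW hdis hG' hU (by omega)⟩
    simp only [Finset.coe_union, Set.mem_union, Finset.mem_coe] at hi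
    rcases hi with hi | hi
    · exact hT.2 i hi hic hid
    · exact iff_of_false (hG c hc i hi) (hG d hd i hi)

lemma HasTwins.join (h : HasTwins G V k) (hW : IsCograph G W l) (hVW : Disjoint V W)
    (hG : ∀ x ∈ V, ∀ y ∈ W, G.Adj x y) : HasTwins G (V ∪ W) (k + l) := by
  obtain ⟨c, hc, d, hd, hcd, h⟩ := h
  have hdW : d ∉ W := Finset.disjoint_left.1 hVW hd
  have hU : V.erase d ∪ W = (V ∪ W).erase d := by
    rw [Finset.erase_union_distrib, Finset.erase_eq_of_notMem hdW]
  have hdis : Disjoint (V.erase d) W := hVW.mono_left (Finset.erase_subset _ _)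
  have hG' : ∀ x ∈ V.erase d, ∀ y ∈ W, G.Adj x y := fun x hx => hG x (Finset.mem_of_mem_erase hx)
  refine ⟨c, by simp [hc], d, by simp [hd], hcd, ?_⟩
  rcases h with ⟨hT, h⟩ | ⟨hT, j, rfl, h⟩
  · refine Or.inl ⟨⟨hT.1, fun i hi hic hid => ?_⟩, join' h hW hdis hG' hU rfl⟩
    simp only [Finset.coe_union, Set.mem_union, Finset.mem_coe] at hi
    rcases hi with hi | hi
    · exact hT.2 i hi hic hid
    · exact iff_of_true (hG c hc i hi) (hG d hd i hi)
  · rw [falseTwins_compl_iff hcd] at hT ⊢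
    refine Or.inr ⟨⟨hT.1, fun i hi hic hid => ?_⟩, j + l, by omega,
      join' h hW hdis hG' hU rfl⟩
    simp only [Finset.coe_union, Set.mem_union, Finset.mem_coe] at hi
    rcases hi with hi | hi
    · exact hT.2 i hi hic hid
    · exact iff_of_true (hG c hc i hi) (hG d hd i hi)

lemma hasTwins (h : IsCograph G V k) (hV : 2 ≤ V.card) : HasTwins G V k := by
  induction h with
  | single v => simp at hV
  | union V W k l m hVW h hV' hW hm ihV ihW =>
    by_cases h1 : 2 ≤ V.card
    · exact (ihV h1).union hW hVW h hm
    by_cases h2 : 2 ≤ W.card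
    · rw [Finset.union_comm]
      exact (ihW h2).union hV' hVW.symm (fun x hx y hy h' => h y hy x hx h'.symm) (by omega)
    have h3 := hV'.nonempty.card_pos
    have h4 := hW.nonempty.card_pos
    have h5 := hV'.rank_eq_one (by omega)
    have h6 := hW.rank_eq_one (by omega)
    obtain ⟨v, rfl⟩ := Finset.card_eq_one.1 (show V.card = 1 by omega)
    obtain ⟨w, rfl⟩ := Finset.card_eq_one.1 (show W.card = 1 by omega)
    have hvw : v ≠ w := by simpa using hVW
    refine ⟨v, by simp, w, by simp, hvw, Or.inl ⟨⟨h v (by simp) w (by simp), ?_⟩, ?_⟩⟩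
    · simp
    · obtain rfl : m = 1 := by omega
      have : ({v} ∪ {w} : Finset β).erase w = {v} := by ext; simp; grind
      rw [this]; exact .single v
  | join V W k l hVW h hV' hW ihV ihW =>
    by_cases h1 : 2 ≤ V.card
    · exact (ihV h1).join hW hVW h
    by_cases h2 : 2 ≤ W.card
    · rw [Finset.union_comm, add_comm]
      exact (ihW h2).join hV' hVW.symm (fun x hx y hy => (h y hy x hx).symm)
    have h3 := hV'.nonempty.card_pos
    have h4 := hW.nonempty.card_pos
    have h5 := hV'.rank_eq_one (by omega)
    have h6 := hW.rank_eq_one (by omega)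
    obtain ⟨v, rfl⟩ := Finset.card_eq_one.1 (show V.card = 1 by omega)
    obtain ⟨w, rfl⟩ := Finset.card_eq_one.1 (show W.card = 1 by omega)
    have hvw : v ≠ w := by simpa using hVW
    refine ⟨v, by simp, w, by simp, hvw, Or.inr ⟨?_, 1, by omega, ?_⟩⟩
    · rw [falseTwins_compl_iff hvw]
      refine ⟨h v (by simp) w (by simp), ?_⟩
      simp
    · have : ({v} ∪ {w} : Finset β).erase w = {v} := by ext; simp; grind
      rw [this]; exact .single v

lemma exists_represents (h : IsCograph G V k) (he : e ∉ V) :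
    ∃ M : Matroid β, M.E = insert e (V : Set β) ∧ Represents e G M ∧ M.eRank = k := by
  induction hn : V.card using Nat.strong_induction_on generalizing V k with
  | _ n ih =>
  subst hn
  by_cases h2 : 2 ≤ V.card
  · obtain ⟨c, hc, d, hd, hcd, h3⟩ := h.hasTwins h2
    have hce : c ≠ e := by rintro rfl; exact he hc
    have hde : d ≠ e := by rintro rfl; exact he hd
    have hlt : (V.erase d).card < V.card := Finset.card_erase_lt_of_mem hd
    have he' : e ∉ V.erase d := fun h => he (Finset.mem_of_mem_erase h)
    have hE : insert d (insert e ((V.erase d : Finset β) : Set β)) = insert e (V : Set β) := by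
      ext x; simp; grind
    have hE' : insert e (V : Set β) \ {e} = V := by
      ext x; simp; rintro hx rfl; exact he hx
    have hdN : d ∉ insert e ((V.erase d : Finset β) : Set β) := by simp [hde]
    rcases h3 with ⟨hT, h3⟩ | ⟨hT, j, rfl, h3⟩
    · obtain ⟨N, hNE, hN, hNr⟩ := ih _ hlt h3 he' rfl
      obtain ⟨M, hME, hMd, hp⟩ := exists_parallel_extension N
        (hN.isNonloop c (by rw [hNE]; simp [hc, hcd])) (hNE ▸ hdN)
      rw [hNE, hE] at hME
      refine ⟨M, hME, ?_, ?_⟩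
      · refine .parallel M c d hce hde hp ?_ (hMd ▸ hN)
        rwa [hME, hE']
      · rw [← hp.eRank_delete, hMd, hNr]
    · obtain ⟨N, hNE, hN, hNr⟩ := ih _ hlt h3 he' rfl
      obtain ⟨M, hME, hMd, hp⟩ := exists_series_extension N
        (hN.dual.isNonloop c (by rw [dual_ground, hNE]; simp [hc, hcd])) (hNE ▸ hdN)
      rw [hNE, hE] at hME
      refine ⟨M, hME, ?_, ?_⟩
      · refine .series M c d hce hde hp ?_ (hMd ▸ hN)
        rwa [hME, hE']
      · rw [← hp.eRank_contract, hMd, hNr]; push_cast; rfl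
  · have h3 := h.nonempty.card_pos
    obtain rfl := h.rank_eq_one (by omega)
    obtain ⟨v, rfl⟩ := Finset.card_eq_one.1 (show V.card = 1 by omega)
    have hev : e ≠ v := by simpa using he
    obtain ⟨M, hME, hMd, hp⟩ := exists_parallel_extension (a := e) (b := v) (freeOn {e})
      (by simp) (by simpa using hev.symm)
    have hE : M.E = {e, v} := by rw [hME]; simp [pair_comm]
    exact ⟨M, by simpa using hE, .base M v hE hp, by simpa using hp.eRank_eq_one hE⟩

end IsCograph

namespace Represents

lemma isCograph (h : Represents e G M) (he : e ∉ V) (hV : M.E = insert e (V : Set β)) :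
    ∃ k : ℕ, IsCograph G V k ∧ M.eRank = k := by
  induction h generalizing V with
  | base M a hE h =>
    have hV' : V = {a} := by
      ext x
      have hx : x ∈ insert e (V : Set β) ↔ x ∈ ({e, a} : Set β) := by rw [← hV, hE]
      have := h.1
      simp at hx ⊢
      grind
    subst hV'
    exact ⟨1, .single a, by simpa using h.eRank_eq_one hE⟩
  | parallel M c d hce hde h hT hN ih =>
    have hc : c ∈ V := by have := h.left_mem; rw [hV] at this; simpa [hce] using this
    have hd : d ∈ V := by have := h.right_mem; rw [hV] at this; simpa [hde] using this
    have hE : (M ＼ {d}).E = insert e ((V.erase d : Finset β) : Set β) := by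
      rw [delete_ground, hV]; ext x; simp; grind
    have hE' : M.E \ {e} = V := by
      rw [hV]; ext x; simp; rintro hx rfl; exact he hx
    obtain ⟨k, hk, hr⟩ := ih (fun h => he (Finset.mem_of_mem_erase h)) hE
    refine ⟨k, ?_, by rw [← h.eRank_delete, hr]⟩
    rw [← Finset.insert_erase hd]
    refine hk.insert_falseTwin (c := c) (by simp [hc, h.1]) (by simp) ?_
    rwa [Finset.insert_erase hd, ← hE']
  | series M c d hce hde h hT hN ih =>
    have hc : c ∈ V := by
      have : c ∈ M.E := h.left_mem
      rw [hV] at this; simpa [hce] using this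
    have hd : d ∈ V := by
      have : d ∈ M.E := h.right_mem
      rw [hV] at this; simpa [hde] using this
    have hE : (M ／ {d}).E = insert e ((V.erase d : Finset β) : Set β) := by
      rw [contract_ground, hV]; ext x; simp; grind
    have hE' : M.E \ {e} = V := by
      rw [hV]; ext x; simp; rintro hx rfl; exact he hx
    obtain ⟨k, hk, hr⟩ := ih (fun h => he (Finset.mem_of_mem_erase h)) hE
    refine ⟨k + 1, ?_, by rw [← h.eRank_contract, hr]; push_cast; rfl⟩
    rw [← Finset.insert_erase hd]
    refine hk.insert_trueTwin (c := c) (by simp [hc, h.1]) (by simp) ?_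
    rwa [Finset.insert_erase hd, ← hE']

end Represents

namespace IsCograph

lemma rank_unique (h : IsCograph G V k) (h' : IsCograph G V l) (he : e ∉ V) : k = l := by
  obtain ⟨M, hME, hM, hr⟩ := h.exists_represents he
  obtain ⟨M', hME', hM', hr'⟩ := h'.exists_represents he
  rw [hM.matroid_unique hM' (hME.trans hME'.symm), hr'] at hr
  exact_mod_cast hr.symm

lemma of_union (h : IsCograph G (V ∪ W) m) (he : e ∉ V ∪ W) (hV : V.Nonempty) (hW : W.Nonempty)
    (hVW : Disjoint V W) (hG : ∀ x ∈ V, ∀ y ∈ W, ¬ G.Adj x y) :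
    ∃ k l, IsCograph G V k ∧ IsCograph G W l ∧ k + l = m + 1 := by
  obtain ⟨k, hk⟩ := h.mono Finset.subset_union_left hV
  obtain ⟨l, hl⟩ := h.mono Finset.subset_union_right hW
  have := hk.rank_pos
  have hkl : k + l = (k + l - 1) + 1 := by omega
  have := rank_unique h (.union V W k l _ hVW hG hk hl hkl) he
  exact ⟨k, l, hk, hl, by omega⟩

lemma of_join (h : IsCograph G (V ∪ W) m) (he : e ∉ V ∪ W) (hV : V.Nonempty) (hW : W.Nonempty)
    (hVW : Disjoint V W) (hG : ∀ x ∈ V, ∀ y ∈ W, G.Adj x y) :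
    ∃ k l, IsCograph G V k ∧ IsCograph G W l ∧ k + l = m := by
  obtain ⟨k, hk⟩ := h.mono Finset.subset_union_left hV
  obtain ⟨l, hl⟩ := h.mono Finset.subset_union_right hW
  exact ⟨k, l, hk, hl, (rank_unique h (.join V W k l hVW hG hk hl) he).symm⟩

end IsCograph

end SeriesParallel

namespace SeriesParallel

open Set Matroid

/-- Matroids obtained from a two-element circuit by parallel and series extensions. -/
inductive IsBuilt {β : Type*} : Matroid β → Prop
  | base (M : Matroid β) (a b : β) (hE : M.E = {a, b}) (h : IsPar M a b) : IsBuilt M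
  | parallel (M : Matroid β) (a b : β) (h : IsPar M a b) (hM : IsBuilt (M ＼ {b})) : IsBuilt M
  | series (M : Matroid β) (a b : β) (h : IsPar M✶ a b) (hM : IsBuilt (M ／ {b})) : IsBuilt M

lemma Represents.isBuilt {β : Type*} {e : β} {G : SimpleGraph β} {M : Matroid β}
    (h : Represents e G M) : IsBuilt M := by
  induction h with
  | base M a hE h => exact .base M e a hE h
  | parallel M a b hae hbe h hG hM ih => exact .parallel M a b h ih
  | series M a b hae hbe h hG hM ih => exact .series M a b h ih

/-- `M` is represented by a graph with respect to every root. -/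
def Representable {β : Type*} (M : Matroid β) : Prop := ∀ e ∈ M.E, ∃ G, Represents e G M

variable {β : Type*} {M : Matroid β} {a b e : β}

lemma Representable.dual (h : Representable M) : Representable M✶ := fun e he => by
  obtain ⟨G, hG⟩ := h e he
  exact ⟨Gᶜ, hG.dual⟩

lemma exists_represents_parallel_root (h : IsPar M e b)
    (hM : ∃ G, Represents e G (M ＼ {b})) : ∃ G, Represents e G M := by
  obtain ⟨G, hG⟩ := hM
  let G' : SimpleGraph β :=
    { Adj := fun x y => G.Adj x y ∧ x ≠ b ∧ y ≠ b
      symm := ⟨fun x y h => ⟨h.1.symm, h.2.2, h.2.1⟩⟩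
      loopless := ⟨fun x h => G.irrefl h.1⟩ }
  refine ⟨G', (hG.congr fun x hx y hy => ?_).parallel_root h fun i _ h' => h'.2.1 rfl⟩
  have h1 : x ≠ b := hx.1.2
  have h2 : y ≠ b := hy.1.2
  simp [G', h1, h2]

lemma Representable.parallel (h : IsPar M a b) (hM : Representable (M ＼ {b})) :
    Representable M := by
  classical
  intro e he
  by_cases heb : e = b
  · subst heb
    obtain ⟨G, hG⟩ := hM a ⟨h.left_mem, h.1⟩
    have hG' := hG.mapEquiv (Equiv.swap a e) (G' := G.comap (Equiv.swap a e))
      (fun x _ y _ => by simp)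
    rw [mapEquiv_delete, h.mapEquiv_swap, Equiv.swap_apply_left, Equiv.swap_apply_right] at hG'
    exact exists_represents_parallel_root h.symm ⟨_, hG'⟩
  obtain ⟨G, hG⟩ := hM e ⟨he, heb⟩
  by_cases hea : e = a
  · subst hea
    exact exists_represents_parallel_root h ⟨G, hG⟩
  refine ⟨G.replaceVertex a b, .parallel M a b (Ne.symm hea) (Ne.symm heb) h ?_ ?_⟩
  · refine ⟨G.not_adj_replaceVertex_same _ _, fun i _ _ hib => ?_⟩
    rw [G.adj_replaceVertex_iff_of_ne_left _ hib, G.adj_replaceVertex_iff_of_ne_right _ hib]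
  · exact hG.congr fun x hx y hy => (G.adj_replaceVertex_iff_of_ne _ hx.1.2 hy.1.2).symm

lemma IsBuilt.representable (h : IsBuilt M) : Representable M := by
  induction h with
  | base M a b hE h =>
    intro e he
    rw [hE] at he
    rcases he with rfl | rfl
    · exact ⟨⊥, .base M b hE h⟩
    · exact ⟨⊥, .base M a (by rw [hE, pair_comm]) h.symm⟩
  | parallel M a b h hM ih => exact ih.parallel h
  | series M a b h hM ih =>
    have := Representable.parallel h (by rw [← dual_contract]; exact ih.dual)
    simpa using this.dual

lemma IsBuilt.isNonloop (h : IsBuilt M) (he : e ∈ M.E) : M.IsNonloop e := by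
  obtain ⟨G, hG⟩ := h.representable e he
  exact hG.isNonloop e he

lemma IsBuilt.dual (h : IsBuilt M) : IsBuilt M✶ := by
  induction h with
  | base M a b hE h => exact .base _ a b hE (h.dual_of_ground_eq hE)
  | parallel M a b h hM ih => exact .series _ a b (by rwa [dual_dual]) (by rwa [← dual_delete])
  | series M a b h hM ih => exact .parallel _ a b h (by rwa [← dual_contract])

lemma IsPar.indep_iff {N : Matroid β} (h : IsPar M a b) (hN : M ＼ {b} = N) (I : Set β) :
    M.Indep I ↔ (b ∉ I ∧ N.Indep I) ∨ (b ∈ I ∧ a ∉ I ∧ N.Indep (insert a (I \ {b}))) := by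
  subst hN
  by_cases hb : b ∈ I
  · have hb' : b ∉ I \ {b} := by simp
    by_cases ha : a ∈ I
    · refine iff_of_false (fun hI => ?_) (by tauto)
      exact h.isCircuit.not_indep (hI.subset (by rintro z (rfl | rfl) <;> assumption))
    · have h1 : (M ＼ {b}).Indep (insert a (I \ {b})) ↔ M.Indep I := by
        rw [deleteElem_indep_iff, h.insert_indep_iff (by simp [ha]) hb', insert_sdiff_singleton,
          insert_eq_of_mem hb]
        simp [h.1.symm]
      rw [h1]
      simp [hb, ha]
  · simp [hb]

lemma IsPar.dual_indep_iff {N : Matroid β} (h : IsPar M✶ a b) (hN : M ／ {b} = N) {I : Set β} :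
    M.Indep I ↔ (a ∈ I ∧ b ∈ I ∧ N.Indep (I \ {b})) ∨
      (¬ (a ∈ I ∧ b ∈ I) ∧ N.Indep (I \ {a, b})) := by
  subst hN
  have hbn := isNonloop_of_series h.symm
  have hexch : ∀ J : Set β, a ∉ J → b ∉ J → (M.Indep (insert b J) ↔ M.Indep J) := by
    intro J ha hb
    rw [Matroid.insert_indep_iff]
    have := notMem_closure_of_series h.symm hb ha
    have := hbn.mem_ground
    simp_all
  have hexch' : ∀ J : Set β, a ∉ J → b ∉ J → (M.Indep (insert a J) ↔ M.Indep J) := by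
    intro J ha hb
    rw [Matroid.insert_indep_iff]
    have := notMem_closure_of_series h ha hb
    have := (isNonloop_of_series h).mem_ground
    simp_all
  have ha' : a ∉ I \ {a, b} := by simp
  have hb' : b ∉ I \ {a, b} := by simp
  rw [hbn.contractElem_indep_iff, hbn.contractElem_indep_iff, hexch _ ha' hb']
  by_cases ha : a ∈ I <;> by_cases hb : b ∈ I
  · simp [ha, hb]
  · have : I = insert a (I \ {a, b}) := by
      ext z; by_cases hza : z = a <;> by_cases hzb : z = b <;> simp [*]
    have h2 := hexch' _ ha' hb'
    rw [← this] at h2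
    simp [ha, hb, h2]
  · have : I = insert b (I \ {a, b}) := by
      ext z; by_cases hza : z = a <;> by_cases hzb : z = b <;> simp [*, h.1]
    have h2 := hexch _ ha' hb'
    rw [← this] at h2
    simp [ha, hb, h2]
  · have : I = I \ {a, b} := by
      ext z; by_cases hza : z = a <;> by_cases hzb : z = b <;> simp [*]
    rw [← this]
    simp [ha, hb]

/-! ### Cycle matroids of series and parallel extensions -/

variable {α : Type*} {G H : Graph α β} {I S : Set β} {f g : β} {x y z w : α}

/-- `x` and `y` are joined by a walk with all edges in `S`. -/
def Joined (G : Graph α β) (S : Set β) : α → α → Prop :=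
  Relation.ReflTransGen fun a b => ∃ f ∈ S, G.IsLink f a b

lemma Joined.of_isLink (hf : f ∈ S) (h : G.IsLink f x y) : Joined G S x y :=
  .single ⟨f, hf, h⟩

lemma Joined.trans (h : Joined G S x y) (h' : Joined G S y z) : Joined G S x z :=
  Relation.ReflTransGen.trans h h'

lemma Joined.symm (h : Joined G S x y) : Joined G S y x := by
  induction h with
  | refl => exact .refl
  | tail _ h2 ih =>
    obtain ⟨f, hf, h2⟩ := h2
    exact (Joined.of_isLink hf h2.symm).trans ih

/-- Walks are transported along a map on vertices that sends edges to walks. -/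
lemma Joined.lift {α' β' : Type*} {G' : Graph α' β'} {S' : Set β'} (φ : α → α')
    (hφ : ∀ f ∈ S, ∀ a b, G.IsLink f a b → Joined G' S' (φ a) (φ b)) (h : Joined G S x y) :
    Joined G' S' (φ x) (φ y) := by
  induction h with
  | refl => exact .refl
  | tail _ h2 ih =>
    obtain ⟨f, hf, h2⟩ := h2
    exact ih.trans (hφ f hf _ _ h2)

lemma isAcyclicSet_iff : IsAcyclicSet G I ↔
    ∀ e ∈ I, ∀ x y, G.IsLink e x y → ¬ Joined G (I \ {e}) x y := Iff.rfl

lemma forall_isLink_not_joined_iff (h : G.IsLink e x y) :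
    (∀ a b, G.IsLink e a b → ¬ Joined G S a b) ↔ ¬ Joined G S x y := by
  refine ⟨fun h' => h' x y h, fun h' a b hab hj => h' ?_⟩
  rcases h.eq_and_eq_or_eq_and_eq hab with ⟨rfl, rfl⟩ | ⟨rfl, rfl⟩
  · exact hj
  · exact hj.symm

lemma isAcyclicSet_congr (φ : β → β) (hφ : Set.InjOn φ I)
    (h : ∀ g ∈ I, ∀ a b, H.IsLink (φ g) a b ↔ G.IsLink g a b) :
    IsAcyclicSet H (φ '' I) ↔ IsAcyclicSet G I := by
  simp only [isAcyclicSet_iff, forall_mem_image]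
  refine forall₂_congr fun g hg => forall₂_congr fun a b => ?_
  rw [h g hg]
  refine imp_congr Iff.rfl (not_congr ⟨fun hj => ?_, fun hj => ?_⟩)
  · refine hj.lift id fun f hf a b hl => ?_
    obtain ⟨⟨f, hfI, rfl⟩, hfg⟩ := hf
    exact .of_isLink ⟨hfI, fun h => hfg (by rw [mem_singleton_iff.1 h]; rfl)⟩ ((h f hfI a b).1 hl)
  · refine hj.lift id fun f hf a b hl => ?_
    exact .of_isLink ⟨⟨f, hf.1, rfl⟩, fun h => hf.2 (hφ hf.1 hg h)⟩ ((h f hf.1 a b).2 hl)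

lemma isAcyclicSet_congr_id (h : ∀ g ∈ I, ∀ a b, H.IsLink g a b ↔ G.IsLink g a b) :
    IsAcyclicSet H I ↔ IsAcyclicSet G I := by
  simpa using isAcyclicSet_congr id (injOn_id I) h

lemma isAcyclicSet_parallel_iff (he : G.IsLink e x y) (hf : f ∉ E(G))
    (hH : ∀ g a b, H.IsLink g a b ↔ G.IsLink g a b ∨ (g = f ∧ s(a, b) = s(x, y))) :
    IsAcyclicSet H I ↔ (f ∉ I ∧ IsAcyclicSet G I) ∨
      (f ∈ I ∧ e ∉ I ∧ IsAcyclicSet G (insert e (I \ {f}))) := by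
  classical
  have hfe : f ≠ e := by rintro rfl; exact hf he.edge_mem
  have hne : ∀ g, g ≠ f → ∀ a b, H.IsLink g a b ↔ G.IsLink g a b := by
    intro g hg a b; simp [hH, hg]
  have hfl : ∀ a b, H.IsLink f a b ↔ G.IsLink e a b := by
    intro a b
    rw [hH, he.isLink_iff_sym2_eq, eq_comm (a := s(x, y))]
    have := Graph.not_isLink_of_notMem_edgeSet (x := a) (y := b) hf
    tauto
  by_cases hfI : f ∈ I
  · by_cases heI : e ∈ I
    · refine iff_of_false (fun h => ?_) (by tauto)
      exact h f hfI x y ((hfl x y).2 he)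
        (Joined.of_isLink (G := H) (f := e) ⟨heI, hfe.symm⟩ ((hne e hfe.symm x y).2 he))
    · have := isAcyclicSet_congr (G := G) (H := H) (I := insert e (I \ {f}))
        (fun g => if g = e then f else g) ?_ ?_
      · have him : (fun g => if g = e then f else g) '' insert e (I \ {f}) = I := by
          ext g
          simp only [mem_image, mem_insert_iff, mem_sdiff, mem_singleton_iff]
          constructor
          · rintro ⟨z, rfl | hz, rfl⟩
            · simpa using hfI
            · rw [if_neg (by rintro rfl; exact heI hz.1)]; exact hz.1
          · intro hg
            by_cases hgf : g = f
            · exact ⟨e, Or.inl rfl, by simp [hgf]⟩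
            · exact ⟨g, Or.inr ⟨hg, hgf⟩, if_neg (by rintro rfl; exact heI hg)⟩
        rw [him] at this
        rw [this]; simp [hfI, heI]
      · intro a ha b hb h
        simp only [mem_insert_iff, mem_sdiff, mem_singleton_iff] at ha hb
        simp only at h
        grind
      · intro g hg a b
        by_cases hge : g = e
        · subst hge; simp [hfl]
        · simp only [hge, if_false]
          exact hne g (by rcases hg with h | h; exacts [absurd h hge, h.2]) a b
  · simp only [hfI, not_false_eq_true, true_and, false_and, or_false]
    exact isAcyclicSet_congr_id fun g hg => hne g (fun h => hfI (h ▸ hg))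

lemma isAcyclicSet_pendant_iff {p : β} (hp : p ∈ I → H.IsLink p z w) (hzw : z ≠ w)
    (hw : ∀ g ∈ I, g ≠ p → ∀ a b, H.IsLink g a b → a ≠ w ∧ b ≠ w) :
    IsAcyclicSet H I ↔ IsAcyclicSet H (I \ {p}) := by
  classical
  constructor
  · intro h g hg a b hl hj
    exact h g hg.1 a b hl (Joined.lift (G := H) (G' := H) id
      (fun f hf a b hl => .of_isLink ⟨hf.1.1, hf.2⟩ hl) hj)
  · intro h g hg a b hl hj
    by_cases hgp : g = p
    · subst hgp
      have key : ∀ {a b}, Joined H (I \ {g}) a b → (a = w ↔ b = w) := by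
        intro a b hj
        induction hj with
        | refl => rfl
        | tail _ h2 ih =>
          obtain ⟨f, hf, h2⟩ := h2
          have := hw f hf.1 hf.2 _ _ h2
          rw [ih]; tauto
      rcases (hp hg).eq_and_eq_or_eq_and_eq hl with ⟨rfl, rfl⟩ | ⟨rfl, rfl⟩
      · exact hzw ((key hj).2 rfl)
      · exact hzw ((key hj).1 rfl)
    · refine h g ⟨hg, hgp⟩ a b hl ?_
      change Joined H ((I \ {p}) \ {g}) a b
      have hab := hw g hg hgp a b hl
      have := Joined.lift (G := H) (G' := H) (S' := (I \ {p}) \ {g})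
        (fun v => if v = w then z else v) ?_ hj
      · simpa [hab.1, hab.2] using this
      · intro f hf a b hl
        by_cases hfp : f = p
        · subst hfp
          rcases (hp hf.1).eq_and_eq_or_eq_and_eq hl with ⟨rfl, rfl⟩ | ⟨rfl, rfl⟩
          · simp [hzw]; exact .refl
          · simp [hzw]; exact .refl
        · have := hw f hf.1 hfp a b hl
          simp only [this.1, this.2, if_false]
          exact .of_isLink ⟨⟨hf.1, hfp⟩, hf.2⟩ hl

lemma isAcyclicSet_series_iff (he : G.IsLink e x y) (hf : f ∉ E(G)) (hw : w ∉ V(G))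
    (hH : ∀ g a b, H.IsLink g a b ↔
      (g ≠ e ∧ G.IsLink g a b) ∨ (g = e ∧ s(a, b) = s(x, w)) ∨ (g = f ∧ s(a, b) = s(w, y))) :
    IsAcyclicSet H I ↔ (e ∈ I ∧ f ∈ I ∧ IsAcyclicSet G (I \ {f})) ∨
      (¬ (e ∈ I ∧ f ∈ I) ∧ IsAcyclicSet G (I \ {e, f})) := by
  classical
  have hfe : f ≠ e := by rintro rfl; exact hf he.edge_mem
  have hxw : x ≠ w := by rintro rfl; exact hw he.left_mem
  have hyw : y ≠ w := by rintro rfl; exact hw he.right_mem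
  have hne : ∀ g, g ≠ e → g ≠ f → ∀ a b, H.IsLink g a b ↔ G.IsLink g a b := by
    intro g hg hg' a b; simp [hH, hg, hg']
  have hno : ∀ a b, ¬ G.IsLink f a b := fun a b => Graph.not_isLink_of_notMem_edgeSet hf
  have hew : H.IsLink e x w := by rw [hH]; simp
  have hfw : H.IsLink f w y := by rw [hH]; simp
  have hGw : ∀ g a b, G.IsLink g a b → a ≠ w ∧ b ≠ w := fun g a b h =>
    ⟨fun h' => hw (h' ▸ h.left_mem), fun h' => hw (h' ▸ h.right_mem)⟩
  have hrest : IsAcyclicSet H (I \ {e, f}) ↔ IsAcyclicSet G (I \ {e, f}) := by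
    refine isAcyclicSet_congr_id fun g hg => ?_
    have := hg.2
    simp only [mem_insert_iff, mem_singleton_iff, not_or] at this
    exact hne g this.1 this.2
  by_cases heI : e ∈ I
  · by_cases hfI : f ∈ I
    · simp only [heI, hfI, true_and, and_self, not_true, false_and, or_false]
      have hup : ∀ (g : β) {a b}, Joined G ((I \ {f}) \ {g}) a b → g ≠ e → g ≠ f →
          Joined H (I \ {g}) a b := by
        intro g a b hj hge hgf
        refine hj.lift id fun p hp a b hl => ?_
        by_cases hpe : p = e
        · subst hpe
          have h1 : Joined H (I \ {g}) x y :=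
            (Joined.of_isLink (S := I \ {g}) ⟨heI, hge.symm⟩ hew).trans
              (Joined.of_isLink (S := I \ {g}) ⟨hfI, hgf.symm⟩ hfw)
          rcases he.eq_and_eq_or_eq_and_eq hl with ⟨rfl, rfl⟩ | ⟨rfl, rfl⟩
          · exact h1
          · exact h1.symm
        · exact .of_isLink ⟨hp.1.1, hp.2⟩ ((hne p hpe hp.1.2 a b).2 hl)
      have hup' : ∀ (g : β) {a b}, (g = e ∨ g = f) → Joined G ((I \ {f}) \ {e}) a b →
          Joined H (I \ {g}) a b := by
        intro g a b hg hj
        refine hj.lift id fun p hp a b hl => ?_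
        exact .of_isLink ⟨hp.1.1, by rcases hg with rfl | rfl; exacts [hp.2, hp.1.2]⟩
          ((hne p hp.2 hp.1.2 a b).2 hl)
      have hdown : ∀ (g : β) {a b}, Joined H (I \ {g}) a b → g ≠ e → g ≠ f →
          Joined G ((I \ {f}) \ {g}) (if a = w then x else a) (if b = w then x else b) := by
        intro g a b hj hge hgf
        refine hj.lift (fun v => if v = w then x else v) fun p hp a b hl => ?_
        by_cases hpe : p = e
        · subst hpe
          rcases hew.eq_and_eq_or_eq_and_eq hl with ⟨rfl, rfl⟩ | ⟨rfl, rfl⟩ <;>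
          · simp [hxw]; exact .refl
        by_cases hpf : p = f
        · subst hpf
          have h1 : Joined G ((I \ {p}) \ {g}) x y := .of_isLink ⟨⟨heI, hfe.symm⟩, hge.symm⟩ he
          rcases hfw.eq_and_eq_or_eq_and_eq hl with ⟨rfl, rfl⟩ | ⟨rfl, rfl⟩
          · simpa [hyw] using h1
          · simpa [hyw] using h1.symm
        have hl' := (hne p hpe hpf a b).1 hl
        have := hGw _ _ _ hl'
        simp only [this.1, this.2, if_false]
        exact .of_isLink ⟨⟨hp.1, hpf⟩, hp.2⟩ hl'
      constructor
      · intro h g hg a b hl hj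
        by_cases hge : g = e
        · subst hge
          have h1 := (forall_isLink_not_joined_iff hew).1 (h g heI)
          have h2 : ¬ Joined G ((I \ {f}) \ {g}) x y := fun hj => h1
            ((hup' g (Or.inl rfl) hj).trans (Joined.of_isLink (S := I \ {g}) ⟨hfI, hfe⟩ hfw).symm)
          exact (forall_isLink_not_joined_iff he).2 h2 a b hl hj
        · exact h g hg.1 a b ((hne g hge hg.2 a b).2 hl) (hup g hj hge hg.2)
      · intro h
        have h0 : ¬ Joined G ((I \ {f}) \ {e}) x y :=
          (forall_isLink_not_joined_iff he).1 (h e ⟨heI, hfe.symm⟩)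
        intro g hg a b hl hj
        by_cases hge : g = e
        · subst hge
          refine (forall_isLink_not_joined_iff hew).2 (fun hj => h0 ?_) a b hl hj
          have := Joined.lift (G := H) (G' := G) (S' := (I \ {f}) \ {g})
            (fun v => if v = w then y else v) ?_ hj
          · simpa [hxw] using this
          · intro p hp a b hl
            by_cases hpf : p = f
            · subst hpf
              rcases hfw.eq_and_eq_or_eq_and_eq hl with ⟨rfl, rfl⟩ | ⟨rfl, rfl⟩ <;>
              · simp [hyw]; exact .refl
            have hl' := (hne p hp.2 hpf a b).1 hl
            have := hGw _ _ _ hl'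
            simp only [this.1, this.2, if_false]
            exact .of_isLink ⟨⟨hp.1, hpf⟩, hp.2⟩ hl'
        by_cases hgf : g = f
        · subst hgf
          refine (forall_isLink_not_joined_iff hfw).2 (fun hj => h0 ?_) a b hl hj
          have := Joined.lift (G := H) (G' := G) (S' := (I \ {g}) \ {e})
            (fun v => if v = w then x else v) ?_ hj
          · simpa [hyw] using this
          · intro p hp a b hl
            by_cases hpe : p = e
            · subst hpe
              rcases hew.eq_and_eq_or_eq_and_eq hl with ⟨rfl, rfl⟩ | ⟨rfl, rfl⟩ <;>
              · simp [hxw]; exact .refl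
            have hl' := (hne p hpe hp.2 a b).1 hl
            have := hGw _ _ _ hl'
            simp only [this.1, this.2, if_false]
            exact .of_isLink ⟨hp, hpe⟩ hl'
        have hl' := (hne g hge hgf a b).1 hl
        have hab := hGw _ _ _ hl'
        have := hdown g hj hge hgf
        simp only [hab.1, hab.2, if_false] at this
        exact h g ⟨hg, hgf⟩ a b hl' this
    · simp only [heI, hfI, and_false, false_and, not_false_eq_true, true_and, false_or]
      rw [isAcyclicSet_pendant_iff (fun _ => hew) hxw, ← hrest]
      · have : I \ {e, f} = I \ {e} := by
          ext g; simp only [mem_sdiff, mem_insert_iff, mem_singleton_iff]; grind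
        rw [this]
      · intro g hg hge a b hl
        exact hGw g a b ((hne g hge (fun h => hfI (h ▸ hg)) a b).1 hl)
  · simp only [heI, false_and, not_false_eq_true, true_and, false_or]
    rw [isAcyclicSet_pendant_iff (fun _ => hfw.symm) hyw, ← hrest]
    · have : I \ {e, f} = I \ {f} := by
        ext g; simp only [mem_sdiff, mem_insert_iff, mem_singleton_iff]; grind
      rw [this]
    · intro g hg hgf a b hl
      exact hGw g a b ((hne g (fun h => heI (h ▸ hg)) hgf a b).1 hl)

end SeriesParallel

namespace SeriesParallel

open Set Matroid

variable {α β : Type*} {M N : Matroid β} {G H : Graph α β} {I : Set β} {a b e f : β} {x y u v w : α}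

lemma IsCycleMatroidOf.eq (h : IsCycleMatroidOf M G) (h' : IsCycleMatroidOf N G) : M = N :=
  ext_indep (h.1.trans h'.1.symm) fun I _ => (h.2 I).trans (h'.2 I).symm

lemma IsCycleMatroidOf.parallel (hN : IsCycleMatroidOf N G) (he : G.IsLink e x y)
    (hf : f ∉ E(G))
    (hH : ∀ g a b, H.IsLink g a b ↔ G.IsLink g a b ∨ (g = f ∧ s(a, b) = s(x, y)))
    (h : IsPar M e f) (hM : M ＼ {f} = N) : IsCycleMatroidOf M H := by
  have hE : E(H) = insert f E(G) := by
    ext g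
    simp only [Graph.edge_mem_iff_exists_isLink, mem_insert_iff, hH]
    constructor
    · rintro ⟨a, b, h | h⟩
      · exact Or.inr ⟨a, b, h⟩
      · exact Or.inl h.1
    · rintro (rfl | ⟨a, b, h⟩)
      · exact ⟨x, y, Or.inr ⟨rfl, rfl⟩⟩
      · exact ⟨a, b, Or.inl h⟩
  have hME : M.E = E(H) := by
    rw [hE, ← hN.1, ← hM, delete_ground, insert_sdiff_singleton, insert_eq_of_mem h.right_mem]
  refine ⟨hME, fun I => ?_⟩
  rw [h.indep_iff hM, isAcyclicSet_parallel_iff he hf hH, hN.2, hN.2, hE]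
  have heG := he.edge_mem
  by_cases hfI : f ∈ I
  · have : insert e (I \ {f}) ⊆ E(G) ↔ I ⊆ insert f E(G) := by
      rw [insert_subset_iff, sdiff_singleton_subset_iff, and_iff_right heG]
    simp only [hfI, this]
    tauto
  · have : I ⊆ insert f E(G) ↔ I ⊆ E(G) := subset_insert_iff_of_notMem hfI
    simp only [hfI, this]
    tauto

lemma IsCycleMatroidOf.series (hN : IsCycleMatroidOf N G) (he : G.IsLink e x y)
    (hf : f ∉ E(G)) (hw : w ∉ V(G))
    (hH : ∀ g a b, H.IsLink g a b ↔
      (g ≠ e ∧ G.IsLink g a b) ∨ (g = e ∧ s(a, b) = s(x, w)) ∨ (g = f ∧ s(a, b) = s(w, y)))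
    (h : IsPar M✶ e f) (hM : M ／ {f} = N) : IsCycleMatroidOf M H := by
  have hE : E(H) = insert f E(G) := by
    ext g
    simp only [Graph.edge_mem_iff_exists_isLink, mem_insert_iff, hH]
    constructor
    · rintro ⟨a, b, h | h | h⟩
      · exact Or.inr ⟨a, b, h.2⟩
      · exact Or.inr ⟨x, y, h.1 ▸ he⟩
      · exact Or.inl h.1
    · rintro (rfl | ⟨a, b, h⟩)
      · exact ⟨w, y, by simp⟩
      · by_cases hge : g = e
        · exact ⟨x, w, by simp [hge]⟩
        · exact ⟨a, b, Or.inl ⟨hge, h⟩⟩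
  have hME : M.E = E(H) := by
    have : f ∈ M.E := h.right_mem
    rw [hE, ← hN.1, ← hM, contract_ground, insert_sdiff_singleton, insert_eq_of_mem this]
  refine ⟨hME, fun I => ?_⟩
  rw [h.dual_indep_iff hM, isAcyclicSet_series_iff he hf hw hH, hN.2, hN.2, hE]
  have heG := he.edge_mem
  have h1 : I \ {f} ⊆ E(G) ↔ I ⊆ insert f E(G) := sdiff_singleton_subset_iff
  have h2 : I \ {e, f} ⊆ E(G) ↔ I ⊆ insert f E(G) := by
    rw [← h1]
    refine ⟨fun h g hg => ?_, fun h g hg => h ⟨hg.1, fun h => hg.2 (by simp_all)⟩⟩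
    by_cases hge : g = e
    · exact hge ▸ heG
    · exact h ⟨hg.1, by simp [hge]; exact hg.2⟩
  rw [h1, h2]
  tauto

lemma isCycleMatroidOf_freeOn_singleton (huv : u ≠ v) (e : β) :
    IsCycleMatroidOf (freeOn {e}) (Graph.banana u v {e}) := by
  refine ⟨by simp, fun I => ?_⟩
  simp only [freeOn_indep_iff, Graph.edgeSet_banana]
  refine ⟨fun hI => ⟨hI, fun g hg a b hl hj => ?_⟩, fun h => h.1⟩
  have : I \ {g} = ∅ := by
    have := hI hg
    rw [mem_singleton_iff] at this
    rw [this, sdiff_eq_empty]; exact hI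
  rw [this] at hj
  have hab : a = b := by
    cases hj with
    | refl => rfl
    | tail _ h => simp at h
  subst hab
  simp at hl
  grind

lemma exists_isCycleMatroidOf_twoCycle (huv : u ≠ v) (hab : a ≠ b) :
    ∃ M : Matroid β, M.E = {a, b} ∧ IsPar M a b ∧
      IsCycleMatroidOf M (Graph.banana u v {a, b}) := by
  obtain ⟨M, hE, hd, hp⟩ := exists_parallel_extension (a := a) (b := b) (freeOn {a})
    (by simp) (by simpa using hab.symm)
  refine ⟨M, by rw [hE]; simp [pair_comm], hp, ?_⟩
  refine (isCycleMatroidOf_freeOn_singleton huv a).parallel (e := a) (x := u) (y := v) ?_ ?_ ?_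
    hp hd
  · simp
  · simpa using hab.symm
  · intro g c d
    simp
    tauto

lemma IsBuiltFromTwoCycle.exists_isCycleMatroidOf (h : IsBuiltFromTwoCycle G) :
    ∃ M : Matroid β, IsBuilt M ∧ IsCycleMatroidOf M G := by
  induction h with
  | twoCycle u v e f huv hef =>
    obtain ⟨M, hE, hp, hM⟩ := exists_isCycleMatroidOf_twoCycle huv hef
    exact ⟨M, .base M e f hE hp, hM⟩
  | series G H hG hGH ih =>
    obtain ⟨N, hN, hNG⟩ := ih
    obtain ⟨e, f, x, y, w, he, hf, hw, -, hH⟩ := hGH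
    obtain ⟨M, hE, hd, hp⟩ := exists_series_extension (a := e) (b := f) N
      (hN.dual.isNonloop (by rw [dual_ground, hNG.1]; exact he.edge_mem)) (by rwa [hNG.1])
    exact ⟨M, .series M e f hp (hd ▸ hN), hNG.series he hf hw hH hp hd⟩
  | parallel G H hG hGH ih =>
    obtain ⟨N, hN, hNG⟩ := ih
    obtain ⟨e, f, x, y, he, hf, -, hH⟩ := hGH
    obtain ⟨M, hE, hd, hp⟩ := exists_parallel_extension (a := e) (b := f) N
      (hN.isNonloop (by rw [hNG.1]; exact he.edge_mem)) (by rwa [hNG.1])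
    exact ⟨M, .parallel M e f hp (hd ▸ hN), hNG.parallel he hf hH hp hd⟩

lemma IsBuiltFromTwoCycle.finite (h : IsBuiltFromTwoCycle G) : V(G).Finite := by
  induction h with
  | twoCycle u v e f huv hef => simp
  | series G H hG hGH ih =>
    obtain ⟨e, f, x, y, w, he, hf, hw, hV, hH⟩ := hGH
    rw [hV]; exact ih.insert w
  | parallel G H hG hGH ih =>
    obtain ⟨e, f, x, y, he, hf, hV, hH⟩ := hGH
    rwa [hV]

lemma exists_isParallelExtension (he : G.IsLink e x y) (hf : f ∉ E(G)) :
    ∃ H : Graph α β, V(H) = V(G) ∧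
      ∀ g a b, H.IsLink g a b ↔ G.IsLink g a b ∨ (g = f ∧ s(a, b) = s(x, y)) := by
  have hno : ∀ a b, ¬ G.IsLink f a b := fun a b => Graph.not_isLink_of_notMem_edgeSet hf
  refine ⟨{ vertexSet := V(G)
            IsLink := fun g a b => G.IsLink g a b ∨ (g = f ∧ s(a, b) = s(x, y))
            isLink_symm := ?_
            eq_or_eq_of_isLink_of_isLink := ?_
            left_mem_of_isLink := ?_ }, rfl, fun _ _ _ => Iff.rfl⟩
  · intro g _
    refine ⟨fun a b h => ?_⟩
    rw [Sym2.eq_swap, G.isLink_comm]; exact h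
  · rintro g a b c d (h1 | ⟨rfl, h1⟩) (h2 | ⟨h3, h2⟩)
    · exact h1.left_eq_or_eq h2
    · exact absurd (h3 ▸ h1) (hno _ _)
    · exact absurd h2 (hno _ _)
    · rw [← h2] at h1; simp at h1; tauto
  · rintro g a b (h | ⟨-, h⟩)
    · exact h.left_mem
    · have := he.left_mem
      have := he.right_mem
      simp at h; grind

lemma exists_isSeriesExtension (w : α) (he : G.IsLink e x y) (hf : f ∉ E(G)) :
    ∃ H : Graph α β, V(H) = insert w V(G) ∧ ∀ g a b, H.IsLink g a b ↔
      (g ≠ e ∧ G.IsLink g a b) ∨ (g = e ∧ s(a, b) = s(x, w)) ∨ (g = f ∧ s(a, b) = s(w, y)) := by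
  have hno : ∀ a b, ¬ G.IsLink f a b := fun a b => Graph.not_isLink_of_notMem_edgeSet hf
  have hfe : f ≠ e := by rintro rfl; exact hf he.edge_mem
  refine ⟨{ vertexSet := insert w V(G)
            IsLink := fun g a b => (g ≠ e ∧ G.IsLink g a b) ∨ (g = e ∧ s(a, b) = s(x, w)) ∨
              (g = f ∧ s(a, b) = s(w, y))
            isLink_symm := ?_
            eq_or_eq_of_isLink_of_isLink := ?_
            left_mem_of_isLink := ?_ }, rfl, fun _ _ _ => Iff.rfl⟩
  · intro g _
    refine ⟨fun a b h => ?_⟩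
    rw [Sym2.eq_swap, G.isLink_comm]; exact h
  · rintro g a b c d (⟨h0, h1⟩ | ⟨h0, h1⟩ | ⟨h0, h1⟩) (⟨h3, h2⟩ | ⟨h3, h2⟩ | ⟨h3, h2⟩)
    · exact h1.left_eq_or_eq h2
    · exact absurd h3 h0
    · exact absurd (h3 ▸ h1) (hno _ _)
    · exact absurd h0 h3
    · rw [← h2] at h1; simp at h1; tauto
    · exact absurd (h3.symm.trans h0) hfe
    · exact absurd (h0 ▸ h2) (hno _ _)
    · exact absurd (h0.symm.trans h3) hfe
    · rw [← h2] at h1; simp at h1; tauto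
  · have := he.left_mem
    have := he.right_mem
    rintro g a b (⟨-, h⟩ | ⟨-, h⟩ | ⟨-, h⟩)
    · exact Or.inr h.left_mem
    · simp at h; grind
    · simp at h; grind

lemma IsBuilt.exists_graph (h : IsBuilt M) :
    ∃ G : Graph ℕ β, IsBuiltFromTwoCycle G ∧ IsCycleMatroidOf M G := by
  induction h with
  | base M a b hE h =>
    obtain ⟨N, hNE, hp, hN⟩ := exists_isCycleMatroidOf_twoCycle (u := 0) (v := 1) zero_ne_one h.1
    refine ⟨_, .twoCycle 0 1 a b zero_ne_one h.1, ?_⟩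
    have : M = N := eq_of_isPar_of_delete_eq (hE.trans hNE.symm) h hp <|
      ext_indep (by simp [hE, hNE]) fun I hI => by
        have hI' : I ⊆ {a} := fun x hx => by
          have := hI hx
          rw [delete_ground, hE] at this
          simp at this ⊢
          tauto
        rcases subset_singleton_iff_eq.1 hI' with rfl | rfl
        · simp
        · simp [h.2.1, hp.2.1]
    rwa [this]
  | parallel M a b h hM ih =>
    obtain ⟨G, hG, hN⟩ := ih
    have ha : a ∈ E(G) := by rw [← hN.1]; exact ⟨h.left_mem, h.1⟩
    obtain ⟨x, y, hl⟩ := Graph.exists_isLink_of_mem_edgeSet ha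
    have hb : b ∉ E(G) := by rw [← hN.1]; simp
    obtain ⟨H, hV, hH⟩ := exists_isParallelExtension hl hb
    exact ⟨H, .parallel G H hG ⟨a, b, x, y, hl, hb, hV, hH⟩, hN.parallel hl hb hH h rfl⟩
  | series M a b h hM ih =>
    obtain ⟨G, hG, hN⟩ := ih
    have ha : a ∈ E(G) := by rw [← hN.1]; exact ⟨h.left_mem, h.1⟩
    obtain ⟨x, y, hl⟩ := Graph.exists_isLink_of_mem_edgeSet ha
    have hb : b ∉ E(G) := by rw [← hN.1]; simp
    obtain ⟨w, hw⟩ := hG.finite.exists_notMem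
    obtain ⟨H, hV, hH⟩ := exists_isSeriesExtension w hl hb
    exact ⟨H, .series G H hG ⟨a, b, x, y, w, hl, hb, hw, hV, hH⟩,
      hN.series hl hb hw hH h rfl⟩

/-- With at least two elements, the series-parallel matroids are those built from a two-element
circuit by parallel and series extensions of matroids. -/
theorem isSeriesParallelMatroid_iff (hM : M.E.Nontrivial) :
    IsSeriesParallelMatroid M ↔ IsBuilt M := by
  constructor
  · rintro ⟨G, hG | ⟨u, v, e, huv, rfl⟩ | ⟨u, e, rfl⟩, hMG⟩
    · obtain ⟨N, hN, hNG⟩ := hG.exists_isCycleMatroidOf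
      rwa [hMG.eq hNG]
    · have := hMG.1; simp at this; simp [this] at hM
    · have := hMG.1; simp at this; simp [this] at hM
  · intro h
    obtain ⟨G, hG, hMG⟩ := h.exists_graph
    exact ⟨G, Or.inl hG, hMG⟩

/-- The free matroid on a single element is series-parallel. -/
theorem isSeriesParallelMatroid_freeOn_singleton (e : β) :
    IsSeriesParallelMatroid (freeOn {e}) :=
  ⟨Graph.banana 0 1 {e}, Or.inr (Or.inl ⟨0, 1, e, zero_ne_one, rfl⟩),
    isCycleMatroidOf_freeOn_singleton zero_ne_one e⟩

end SeriesParallel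

namespace SeriesParallel

open Set Matroid

variable {β : Type*} {M : Matroid β} {G G' : SimpleGraph β} {V W : Finset β} {k l : ℕ} {e v : β}

/-- All edges of `G` have both ends in `V`. -/
def Supported (G : SimpleGraph β) (V : Finset β) : Prop := ∀ x y, G.Adj x y → x ∈ V ∧ y ∈ V

/-- The subgraph of `G` consisting of the edges with both ends in `V`. -/
def restrictTo (G : SimpleGraph β) (V : Finset β) : SimpleGraph β where
  Adj x y := G.Adj x y ∧ x ∈ V ∧ y ∈ V
  symm := ⟨fun _ _ h => ⟨h.1.symm, h.2.2, h.2.1⟩⟩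
  loopless := ⟨fun _ h => G.irrefl h.1⟩

lemma restrictTo_supported (G : SimpleGraph β) (V : Finset β) : Supported (restrictTo G V) V :=
  fun _ _ h => h.2

lemma restrictTo_adj {x y : β} (hx : x ∈ V) (hy : y ∈ V) :
    (restrictTo G V).Adj x y ↔ G.Adj x y := by
  simp [restrictTo, hx, hy]

lemma Supported.ext (h : Supported G V) (h' : Supported G' V)
    (hG : ∀ x ∈ V, ∀ y ∈ V, G.Adj x y ↔ G'.Adj x y) : G = G' := by
  ext x y
  exact ⟨fun hxy => (hG x (h x y hxy).1 y (h x y hxy).2).1 hxy,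
    fun hxy => (hG x (h' x y hxy).1 y (h' x y hxy).2).2 hxy⟩

/-- No two vertices of `V` are false twins. -/
def TwinFree (G : SimpleGraph β) (V : Finset β) : Prop :=
  ∀ a ∈ V, ∀ b ∈ V, a ≠ b → ¬ FalseTwins G V a b

/-- No vertex of `V` is isolated in `V`. -/
def NoIsolated (G : SimpleGraph β) (V : Finset β) : Prop :=
  ∀ a ∈ V, ∃ i ∈ V, G.Adj a i

lemma TwinFree.congr (h : TwinFree G V) (hG : ∀ x ∈ V, ∀ y ∈ V, G.Adj x y ↔ G'.Adj x y) :
    TwinFree G' V := fun a ha b hb hab h' => h a ha b hb hab ((falseTwins_congr hG ha hb).2 h')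

lemma NoIsolated.congr (h : NoIsolated G V) (hG : ∀ x ∈ V, ∀ y ∈ V, G.Adj x y ↔ G'.Adj x y) :
    NoIsolated G' V := fun a ha => by
  obtain ⟨i, hi, hai⟩ := h a ha
  exact ⟨i, hi, (hG a ha i hi).1 hai⟩

lemma isSimpleMatroid_iff_not_isPar (hM : ∀ x ∈ M.E, M.IsNonloop x) :
    IsSimpleMatroid M ↔ ∀ a b, ¬ IsPar M a b := by
  constructor
  · intro h a b hab
    exact hab.isCircuit.not_indep (h a hab.left_mem b hab.right_mem)
  · intro h a ha b hb
    by_cases hab : a = b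
    · subst hab; simpa using hM a ha
    by_contra hn
    refine h a b ⟨hab, hM a ha, hM b hb, ?_⟩
    refine ((hM a ha).closure_eq_closure_iff_eq_or_dep (hM b hb)).2 (Or.inr ?_)
    exact hn

lemma Represents.isSimpleMatroid_iff (h : Represents e G M) (hV : M.E \ {e} = V) :
    IsSimpleMatroid M ↔ TwinFree G V ∧ NoIsolated G V := by
  have hmem : ∀ {a}, a ∈ V ↔ a ∈ M.E \ {e} := fun {a} => by rw [hV]; rfl
  rw [isSimpleMatroid_iff_not_isPar h.isNonloop]
  constructor
  · intro h'
    refine ⟨fun a ha b hb hab hT => h' a b ?_, fun a ha => ?_⟩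
    · rw [h.isPar_iff (hmem.1 ha) (hmem.1 hb) hab, hV]; exact hT
    · have := h' e a
      rw [h.isPar_root_iff (hmem.1 ha), hV] at this
      push Not at this
      exact this
  · rintro ⟨hT, hI⟩ a b hab
    have hroot : ∀ {a}, ¬ IsPar M e a := by
      intro a hab
      have ha : a ∈ M.E \ {e} := ⟨hab.right_mem, hab.1.symm⟩
      obtain ⟨i, hi, hai⟩ := hI a (hmem.2 ha)
      exact (h.isPar_root_iff ha).1 hab i (hmem.1 hi) hai
    by_cases hae : a = e
    · subst hae; exact hroot hab
    by_cases hbe : b = e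
    · subst hbe; exact hroot hab.symm
    have ha : a ∈ M.E \ {e} := ⟨hab.left_mem, hae⟩
    have hb : b ∈ M.E \ {e} := ⟨hab.right_mem, hbe⟩
    exact hT a (hmem.2 ha) b (hmem.2 hb) hab.1 (hV ▸ (h.isPar_iff ha hb hab.1).1 hab)

/-- Simple series-parallel matroids on `n` elements correspond to cographs on `n - 1` vertices
without false twins and without isolated vertices. -/
theorem numSimpleSeriesParallel_eq_ncard {n : ℕ} (hn : 2 ≤ n) (e : Fin n) (k : ℕ) :
    numSimpleSeriesParallel n k = Set.ncard {G : SimpleGraph (Fin n) |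
      Supported G (Finset.univ.erase e) ∧ IsCograph G (Finset.univ.erase e) k ∧
        TwinFree G (Finset.univ.erase e) ∧ NoIsolated G (Finset.univ.erase e)} := by
  obtain ⟨V, hVdef⟩ : ∃ V : Finset (Fin n), V = Finset.univ.erase e := ⟨_, rfl⟩
  rw [← hVdef]
  have heV : e ∉ V := by simp [hVdef]
  have hins : insert e (V : Set (Fin n)) = univ := by ext x; simp [hVdef]
  have hnt : (univ : Set (Fin n)).Nontrivial := by
    have : Nontrivial (Fin n) := Fin.nontrivial_iff_two_le.2 hn
    exact nontrivial_univ
  have hdiff : (univ : Set (Fin n)) \ {e} = V := by ext x; simp [hVdef]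
  have hex : ∀ G : SimpleGraph (Fin n), IsCograph G V k →
      ∃ M : Matroid (Fin n), M.E = univ ∧ Represents e G M ∧ M.eRank = k := by
    intro G hG
    obtain ⟨M, hE, hM⟩ := hG.exists_represents heV
    exact ⟨M, hE.trans hins, hM⟩
  symm
  refine Set.ncard_congr (fun G hG => (hex G hG.2.1).choose) ?_ ?_ ?_
  · intro G hG
    obtain ⟨hE, hM, hr⟩ := (hex G hG.2.1).choose_spec
    refine ⟨hE, hr, ?_, ?_⟩
    · rw [hM.isSimpleMatroid_iff (V := V) (by rw [hE, hdiff])]; exact hG.2.2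
    · rw [isSeriesParallelMatroid_iff (by rwa [hE])]; exact hM.isBuilt
  · intro G G' hG hG' h
    obtain ⟨hE, hM, hr⟩ := (hex G hG.2.1).choose_spec
    obtain ⟨hE', hM', hr'⟩ := (hex G' hG'.2.1).choose_spec
    rw [← h] at hM'
    have := hM.graph_unique hM'
    rw [hE, hdiff] at this
    exact hG.1.ext hG'.1 this
  · rintro M ⟨hE, hr, hS, hSP⟩
    rw [isSeriesParallelMatroid_iff (by rwa [hE])] at hSP
    obtain ⟨G, hG⟩ := hSP.representable e (by simp [hE])
    have hMV : M.E \ {e} = V := by rw [hE, hdiff]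
    have hGr : Represents e (restrictTo G V) M := hG.congr fun x hx y hy => by
      rw [hMV] at hx hy
      exact (restrictTo_adj hx hy).symm
    have hc : IsCograph (restrictTo G V) V k := by
      obtain ⟨j, hj, hjr⟩ := hGr.isCograph heV (hE.trans hins.symm)
      rw [hr] at hjr
      have : k = j := by exact_mod_cast hjr
      rwa [this]
    refine ⟨restrictTo G V, ⟨restrictTo_supported G V, hc, (hGr.isSimpleMatroid_iff hMV).1 hS⟩, ?_⟩
    obtain ⟨hE', hM', hr'⟩ := (hex _ hc).choose_spec
    exact hM'.matroid_unique hGr (hE'.trans hE.symm)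

end SeriesParallel

namespace SeriesParallel

open Finset

section Components

variable {β : Type*} {G G' : SimpleGraph β} {V W A B : Finset β} {v : β}

/-- There are no edges of `G` between `A` and `B`. -/
def NoEdges (G : SimpleGraph β) (A B : Finset β) : Prop := ∀ x ∈ A, ∀ y ∈ B, ¬ G.Adj x y

lemma NoEdges.symm (h : NoEdges G A B) : NoEdges G B A := fun x hx y hy hxy => h y hy x hx hxy.symm

lemma NoEdges.mono {A' B' : Finset β} (h : NoEdges G A B) (hA : A' ⊆ A) (hB : B' ⊆ B) :
    NoEdges G A' B' := fun x hx y hy => h x (hA hx) y (hB hy)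

lemma NoEdges.congr (h : NoEdges G A B) (hA : A ⊆ V) (hB : B ⊆ V)
    (hG : ∀ x ∈ V, ∀ y ∈ V, G.Adj x y ↔ G'.Adj x y) : NoEdges G' A B :=
  fun x hx y hy hxy => h x hx y hy ((hG x (hA hx) y (hB hy)).2 hxy)

/-- The weight `F G V` depends on the graph induced by `G` on `V` only. -/
def IsLocal (F : SimpleGraph β → Finset β → ℚ) : Prop :=
  ∀ ⦃G G' V⦄, (∀ x ∈ V, ∀ y ∈ V, G.Adj x y ↔ G'.Adj x y) → F G V = F G' V

lemma IsLocal.restrictTo {F : SimpleGraph β → Finset β → ℚ} (hF : IsLocal F) (G : SimpleGraph β)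
    (V : Finset β) : F (restrictTo G V) V = F G V :=
  hF fun _ hx _ hy => restrictTo_adj hx hy

lemma IsLocal.compl {F : SimpleGraph β → Finset β → ℚ} (hF : IsLocal F) :
    IsLocal fun G V => F Gᶜ V := fun G G' V h => hF fun x hx y hy => by
  simp only [SimpleGraph.compl_adj, h x hx y hy]

lemma finite_supported (V : Finset β) : {G : SimpleGraph β | Supported G V}.Finite := by
  classical
  refine Set.Finite.of_finite_image (f := fun G => (V ×ˢ V).filter fun p => G.Adj p.1 p.2)
    ((V ×ˢ V).powerset.finite_toSet.subset ?_) ?_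
  · rintro _ ⟨G, _, rfl⟩
    exact mem_powerset.2 (filter_subset _ _)
  · intro G hG G' hG' h
    refine Supported.ext hG hG' fun x hx y hy => ?_
    have := Finset.ext_iff.1 h (x, y)
    simpa [hx, hy] using this

/-- The finset of all graphs with edges in `V`. -/
noncomputable def graphsOn (V : Finset β) : Finset (SimpleGraph β) := (finite_supported V).toFinset

lemma mem_graphsOn : G ∈ graphsOn V ↔ Supported G V := by simp [graphsOn]

/-- The sum of the weights of all graphs on `V`. -/
noncomputable def graphSum (F : SimpleGraph β → Finset β → ℚ) (V : Finset β) : ℚ :=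
  ∑ G ∈ graphsOn V, F G V

lemma graphSum_compl {F : SimpleGraph β → Finset β → ℚ} (hF : IsLocal F) (V : Finset β) :
    graphSum (fun G V => F Gᶜ V) V = graphSum F V := by
  refine sum_nbij' (fun G => SeriesParallel.restrictTo Gᶜ V)
    (fun G => SeriesParallel.restrictTo Gᶜ V) ?_ ?_ ?_ ?_ ?_
  · exact fun G _ => mem_graphsOn.2 (restrictTo_supported _ _)
  · exact fun G _ => mem_graphsOn.2 (restrictTo_supported _ _)
  · intro G hG
    refine (restrictTo_supported _ _).ext (mem_graphsOn.1 hG) fun x hx y hy => ?_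
    rw [restrictTo_adj hx hy, SimpleGraph.compl_adj, restrictTo_adj hx hy, SimpleGraph.compl_adj]
    have := G.ne_of_adj (a := x) (b := y)
    tauto
  · intro G hG
    refine (restrictTo_supported _ _).ext (mem_graphsOn.1 hG) fun x hx y hy => ?_
    rw [restrictTo_adj hx hy, SimpleGraph.compl_adj, restrictTo_adj hx hy, SimpleGraph.compl_adj]
    have := G.ne_of_adj (a := x) (b := y)
    tauto
  · exact fun G _ => (hF.restrictTo _ _).symm

variable [DecidableEq β]

/-- The graph induced by `G` on `V` is connected (or empty): it has an edge across each cut. -/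
def Conn (G : SimpleGraph β) (V : Finset β) : Prop :=
  ∀ A ⊆ V, A.Nonempty → (V \ A).Nonempty → ¬ NoEdges G A (V \ A)

lemma Conn.congr (h : Conn G V) (hG : ∀ x ∈ V, ∀ y ∈ V, G.Adj x y ↔ G'.Adj x y) : Conn G' V :=
  fun A hA h1 h2 h3 => h A hA h1 h2 (h3.congr hA sdiff_subset fun x hx y hy => (hG x hx y hy).symm)

/-- Connectedness and disconnectedness are exchanged by complements. -/
lemma conn_or_conn_compl (G : SimpleGraph β) (V : Finset β) : Conn G V ∨ Conn Gᶜ V := by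
  by_contra! h
  obtain ⟨h1, h2⟩ := h
  simp only [Conn] at h1 h2
  push Not at h1 h2
  obtain ⟨A, hA, ⟨a, ha⟩, ⟨a', ha'⟩, hAG⟩ := h1
  obtain ⟨B, hB, ⟨b, hb⟩, ⟨b', hb'⟩, hBG⟩ := h2
  have key : ∀ x ∈ B, ∀ y ∈ V \ B, G.Adj x y := by
    intro x hx y hy
    have := hBG x hx y hy
    rw [SimpleGraph.compl_adj] at this
    by_contra hn
    exact this ⟨by rintro rfl; exact (mem_sdiff.1 hy).2 hx, hn⟩
  have same : ∀ x ∈ V, ∀ y ∈ V, G.Adj x y → (x ∈ A ↔ y ∈ A) := by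
    intro x hx y hy hxy
    constructor
    · intro hxA
      by_contra hyA
      exact hAG x hxA y (mem_sdiff.2 ⟨hy, hyA⟩) hxy
    · intro hyA
      by_contra hxA
      exact hAG y hyA x (mem_sdiff.2 ⟨hx, hxA⟩) hxy.symm
  have hall : ∀ x ∈ V, (x ∈ A ↔ b ∈ A) := by
    intro x hx
    by_cases hxB : x ∈ B
    · rw [same x hx b' (sdiff_subset hb') (key x hxB b' hb'),
        same b (hB hb) b' (sdiff_subset hb') (key b hb b' hb')]
    · exact (same b (hB hb) x hx (key b hb x (mem_sdiff.2 ⟨hx, hxB⟩))).symm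
  exact (mem_sdiff.1 ha').2 ((hall a' (sdiff_subset ha')).2 ((hall a (hA ha)).1 ha))

lemma IsCograph.not_conn {k : ℕ} (h : IsCograph G V k) (hV : 2 ≤ V.card) :
    ¬ Conn G V ∨ ¬ Conn Gᶜ V := by
  cases h with
  | single v => simp at hV
  | union V W k l m hVW h hV' hW hm =>
    refine Or.inl fun hc => hc V subset_union_left hV'.nonempty ?_ ?_
    · rw [union_sdiff_cancel_left hVW]; exact hW.nonempty
    · rw [union_sdiff_cancel_left hVW]; exact h
  | join V W k l hVW h hV' hW =>
    refine Or.inr fun hc => hc V subset_union_left hV'.nonempty ?_ ?_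
    · rw [union_sdiff_cancel_left hVW]; exact hW.nonempty
    · rw [union_sdiff_cancel_left hVW]
      exact fun x hx y hy hxy => (SimpleGraph.compl_adj ..).1 hxy |>.2 (h x hx y hy)

/-- Each vertex lies in a unique connected component. -/
lemma existsUnique_component (G : SimpleGraph β) (hv : v ∉ V) :
    ∃! A, A ∈ V.powerset ∧ NoEdges G (insert v A) (V \ A) ∧ Conn G (insert v A) := by
  classical
  have hex : (V.powerset.filter fun A => NoEdges G (insert v A) (V \ A)).Nonempty :=
    ⟨V, by simp only [mem_filter, mem_powerset, Subset.refl, sdiff_self, true_and]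
           exact fun x _ y hy => absurd hy (notMem_empty y)⟩
  obtain ⟨A, hA, hmin⟩ := exists_min_image _ Finset.card hex
  simp only [mem_filter, mem_powerset] at hA hmin
  have hvA : v ∉ A := fun h => hv (hA.1 h)
  have hconn : Conn G (insert v A) := by
    have key : ∀ B ⊆ insert v A, v ∈ B → (insert v A \ B).Nonempty →
        ¬ NoEdges G B (insert v A \ B) := by
      rintro B hB hvB ⟨z, hz⟩ hn
      have hsub : B.erase v ⊆ A := by
        rw [← erase_insert hvA]; exact erase_subset_erase v hB
      have := hmin (B.erase v) ⟨hsub.trans hA.1, by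
        rw [insert_erase hvB]
        intro x hx y hy
        rw [mem_sdiff, mem_erase] at hy
        have hyv : y ≠ v := by rintro rfl; exact hv hy.1
        by_cases hyA : y ∈ A
        · refine hn x hx y (mem_sdiff.2 ⟨mem_insert_of_mem hyA, fun h => hy.2 ⟨hyv, h⟩⟩)
        · exact hA.2 x (hB hx) y (mem_sdiff.2 ⟨hy.1, hyA⟩)⟩
      have heq := eq_of_subset_of_card_le hsub this
      rw [mem_sdiff, mem_insert] at hz
      rcases hz.1 with rfl | hzA
      · exact hz.2 hvB
      · rw [← heq] at hzA
        exact hz.2 (mem_of_mem_erase hzA)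
    intro B hB hBn hBc hn
    by_cases hvB : v ∈ B
    · exact key B hB hvB hBc hn
    · refine key (insert v A \ B) sdiff_subset (mem_sdiff.2 ⟨mem_insert_self _ _, hvB⟩) ?_ ?_
      · rw [Finset.sdiff_sdiff_eq_self hB]; exact hBn
      · rw [Finset.sdiff_sdiff_eq_self hB]; exact hn.symm
  refine ⟨A, ⟨mem_powerset.2 hA.1, hA.2, hconn⟩, ?_⟩
  have key : ∀ A B, A ⊆ V → B ⊆ V → NoEdges G (insert v B) (V \ B) → Conn G (insert v A) →
      A ⊆ B := by
    intro A B hA hB hn hc x hx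
    by_contra hxB'
    have hxv : x ≠ v := fun h => hv (h ▸ hA hx)
    refine hc (insert v A ∩ insert v B) inter_subset_left ⟨v, by simp⟩ ⟨x, by simp [hx, hxB', hxv]⟩
      (hn.mono inter_subset_right ?_)
    intro y hy
    simp only [mem_sdiff, mem_inter, mem_insert, not_and, not_or] at hy ⊢
    obtain ⟨hy1, hy2⟩ := hy
    have hyv := (hy2 hy1).1
    exact ⟨hA (hy1.resolve_left hyv), (hy2 hy1).2⟩
  rintro B ⟨hB, hBn, hBc⟩
  have hBV := mem_powerset.1 hB
  refine subset_antisymm (key B A hBV hA.1 hA.2 hBc) (key A B hA.1 hBV hBn hconn)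

/-- Graphs on a disjoint union without edges between the two parts are pairs of graphs. -/
lemma sum_noEdges {F H : SimpleGraph β → Finset β → ℚ} (hF : IsLocal F) (hH : IsLocal H)
    (hAB : Disjoint A B) [DecidablePred fun G : SimpleGraph β => NoEdges G A B] :
    ∑ G ∈ (graphsOn (A ∪ B)).filter (fun G => NoEdges G A B), F G A * H G B =
      graphSum F A * graphSum H B := by
  rw [graphSum, graphSum, sum_mul_sum, ← sum_product']
  refine sum_nbij' (fun G => (SeriesParallel.restrictTo G A, SeriesParallel.restrictTo G B))
    (fun p => p.1 ⊔ p.2) ?_ ?_ ?_ ?_ ?_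
  · exact fun G _ => mem_product.2 ⟨mem_graphsOn.2 (restrictTo_supported _ _),
      mem_graphsOn.2 (restrictTo_supported _ _)⟩
  · rintro ⟨G₁, G₂⟩ h
    simp only [mem_product, mem_graphsOn] at h
    rw [mem_filter, mem_graphsOn]
    refine ⟨?_, ?_⟩
    · rintro x y (hxy | hxy)
      · exact ⟨mem_union_left _ (h.1 x y hxy).1, mem_union_left _ (h.1 x y hxy).2⟩
      · exact ⟨mem_union_right _ (h.2 x y hxy).1, mem_union_right _ (h.2 x y hxy).2⟩
    · rintro x hx y hy (hxy | hxy)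
      · exact disjoint_left.1 hAB (h.1 x y hxy).2 hy
      · exact disjoint_left.1 hAB hx (h.2 x y hxy).1
  · intro G hG
    rw [mem_filter, mem_graphsOn] at hG
    ext x y
    simp only [SimpleGraph.sup_adj, SeriesParallel.restrictTo]
    constructor
    · rintro (h | h) <;> exact h.1
    · intro hxy
      have h1 := hG.2 x
      have h2 := hG.2.symm x
      have := hG.1 x y hxy
      simp only [mem_union] at this
      by_cases hxA : x ∈ A
      · exact Or.inl ⟨hxy, hxA, this.2.resolve_right fun hy => h1 hxA y hy hxy⟩
      · have hxB := this.1.resolve_left hxA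
        exact Or.inr ⟨hxy, hxB, this.2.resolve_left fun hy => h2 hxB y hy hxy⟩
  · rintro ⟨G₁, G₂⟩ h
    simp only [mem_product, mem_graphsOn] at h
    refine Prod.ext ?_ ?_
    · refine (restrictTo_supported _ _).ext h.1 fun x hx y hy => ?_
      rw [restrictTo_adj hx hy, SimpleGraph.sup_adj, or_iff_left]
      exact fun hxy => disjoint_left.1 hAB hx (h.2 x y hxy).1
    · refine (restrictTo_supported _ _).ext h.2 fun x hx y hy => ?_
      rw [restrictTo_adj hx hy, SimpleGraph.sup_adj, or_iff_right]
      exact fun hxy => disjoint_left.1 hAB (h.1 x y hxy).1 hx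
  · intro G _
    rw [hF.restrictTo, hH.restrictTo]

/-- A weight which is multiplicative over the component of `v` and the rest. -/
lemma graphSum_insert {F Y H : SimpleGraph β → Finset β → ℚ} (hY : IsLocal Y) (hH : IsLocal H)
    (hv : v ∉ V) (hYc : ∀ G A, ¬ Conn G A → Y G A = 0)
    (hF : ∀ G, ∀ A ⊆ V, NoEdges G (insert v A) (V \ A) → Conn G (insert v A) →
      F G (insert v V) = Y G (insert v A) * H G (V \ A)) :
    graphSum F (insert v V) =
      ∑ A ∈ V.powerset, graphSum Y (insert v A) * graphSum H (V \ A) := by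
  classical
  have h1 : ∀ G, F G (insert v V) = ∑ A ∈ V.powerset,
      if NoEdges G (insert v A) (V \ A) then Y G (insert v A) * H G (V \ A) else 0 := by
    intro G
    obtain ⟨A, ⟨hA, hn, hc⟩, huniq⟩ := existsUnique_component G hv
    rw [sum_eq_single_of_mem A hA, if_pos hn, hF G A (mem_powerset.1 hA) hn hc]
    intro B hB hBA
    split_ifs with hBn
    · rw [hYc G _ fun hBc => hBA (huniq B ⟨hB, hBn, hBc⟩), zero_mul]
    · rfl
  rw [graphSum, sum_congr rfl fun G _ => h1 G, sum_comm]
  refine sum_congr rfl fun A hA => ?_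
  rw [← sum_filter]
  have hAV := mem_powerset.1 hA
  have hd : Disjoint (insert v A) (V \ A) := by
    rw [disjoint_insert_left]
    exact ⟨fun h => hv (mem_sdiff.1 h).1, disjoint_sdiff⟩
  have hu : insert v V = insert v A ∪ (V \ A) := by
    rw [insert_union, union_sdiff_of_subset hAV]
  rw [hu, sum_noEdges hY hH hd]

end Components
end SeriesParallel

namespace SeriesParallel

open Finset

section Weights

lemma graphSum_empty {β : Type*} {F : SimpleGraph β → Finset β → ℚ} (hF : ∀ G, F G ∅ = 1) :
    graphSum F ∅ = 1 := by
  have : graphsOn (∅ : Finset β) = {⊥} := by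
    ext G
    rw [mem_graphsOn, mem_singleton]
    constructor
    · intro h
      ext x y
      simpa using fun hxy => absurd (h x y hxy).1 (notMem_empty x)
    · rintro rfl x y hxy
      exact absurd hxy (by simp)
  rw [graphSum, this, sum_singleton, hF]

variable {β : Type*} [DecidableEq β] {G G' : SimpleGraph β} {V W A B : Finset β} {v e : β} {t : ℚ}
  {k l : ℕ}

lemma NoIsolated.union (hA : NoIsolated G A) (hB : NoIsolated G B) : NoIsolated G (A ∪ B) := by
  intro a ha
  rcases mem_union.1 ha with h | h
  · obtain ⟨i, hi, hai⟩ := hA a h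
    exact ⟨i, mem_union_left _ hi, hai⟩
  · obtain ⟨i, hi, hai⟩ := hB a h
    exact ⟨i, mem_union_right _ hi, hai⟩

lemma NoIsolated.left (h : NoIsolated G (A ∪ B)) (hAB : NoEdges G A B) : NoIsolated G A := by
  intro a ha
  obtain ⟨i, hi, hai⟩ := h a (mem_union_left _ ha)
  exact ⟨i, (mem_union.1 hi).resolve_right fun hi => hAB a ha i hi hai, hai⟩

lemma NoIsolated.right (h : NoIsolated G (A ∪ B)) (hAB : NoEdges G A B) : NoIsolated G B := by
  rw [union_comm] at h
  exact h.left hAB.symm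

lemma Conn.noIsolated (h : Conn G V) (hV : 2 ≤ V.card) : NoIsolated G V := by
  intro a ha
  have := h {a} (by simpa using ha) (by simp) (by
    rw [← card_pos, card_sdiff_of_subset (by simpa using ha)]; simp; omega)
  simp only [NoEdges] at this
  push Not at this
  obtain ⟨x, hx, y, hy, hxy⟩ := this
  rw [mem_singleton] at hx
  subst hx
  exact ⟨y, sdiff_subset hy, hxy⟩

lemma twinFree_union (hAB : NoEdges G A B) (hI : NoIsolated G B) :
    TwinFree G (A ∪ B) ↔ TwinFree G A ∧ TwinFree G B := by
  have key : ∀ A B, NoEdges G A B → TwinFree G (A ∪ B) → TwinFree G A := by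
    intro A B hAB h a ha b hb hab hT
    refine h a (mem_union_left _ ha) b (mem_union_left _ hb) hab ⟨hT.1, fun i hi hia hib => ?_⟩
    rcases mem_union.1 (mem_coe.1 hi) with hi | hi
    · exact hT.2 i hi hia hib
    · exact iff_of_false (hAB a ha i hi) (hAB b hb i hi)
  have cross : ∀ a ∈ A, ∀ b ∈ B, ¬ FalseTwins G (A ∪ B : Finset β) a b := by
    intro a ha b hb hT
    obtain ⟨i, hi, hbi⟩ := hI b hb
    refine hAB a ha i hi ((hT.2 i (mem_coe.2 (mem_union_right _ hi)) ?_ hbi.ne').2 hbi)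
    rintro rfl
    exact hAB i ha b hb hbi.symm
  refine ⟨fun h => ⟨key A B hAB h, key B A hAB.symm (by rwa [union_comm])⟩, ?_⟩
  rintro ⟨hA, hB⟩ a ha b hb hab hT
  rcases mem_union.1 ha with ha | ha <;> rcases mem_union.1 hb with hb | hb
  · exact hA a ha b hb hab (hT.mono (by simp))
  · exact cross a ha b hb hT
  · exact cross b hb a ha hT.symm
  · exact hB a ha b hb hab (hT.mono (by simp))

lemma twinFree_join (hAB : ∀ x ∈ A, ∀ y ∈ B, G.Adj x y) :
    TwinFree G (A ∪ B) ↔ TwinFree G A ∧ TwinFree G B := by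
  have key : ∀ A B, (∀ x ∈ A, ∀ y ∈ B, G.Adj x y) → TwinFree G (A ∪ B) → TwinFree G A := by
    intro A B hAB h a ha b hb hab hT
    refine h a (mem_union_left _ ha) b (mem_union_left _ hb) hab ⟨hT.1, fun i hi hia hib => ?_⟩
    rcases mem_union.1 (mem_coe.1 hi) with hi | hi
    · exact hT.2 i hi hia hib
    · exact iff_of_true (hAB a ha i hi) (hAB b hb i hi)
  refine ⟨fun h => ⟨key A B hAB h, key B A (fun x hx y hy => (hAB y hy x hx).symm)
    (by rwa [union_comm])⟩, ?_⟩
  rintro ⟨hA, hB⟩ a ha b hb hab hT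
  rcases mem_union.1 ha with ha | ha <;> rcases mem_union.1 hb with hb | hb
  · exact hA a ha b hb hab (hT.mono (by simp))
  · exact hT.1 (hAB a ha b hb)
  · exact hT.1 (hAB b hb a ha).symm
  · exact hB a ha b hb hab (hT.mono (by simp))

open Classical in
/-- The weight `t ^ k` of a cograph of rank `k` without false twins. -/
noncomputable def cographWeight (t : ℚ) (G : SimpleGraph β) (V : Finset β) : ℚ :=
  if h : (∃ k, IsCograph G V k) ∧ TwinFree G V then t ^ h.1.choose else 0

lemma cographWeight_eq (h : IsCograph G V k) (hT : TwinFree G V) (he : e ∉ V) :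
    cographWeight t G V = t ^ k := by
  have h' : (∃ k, IsCograph G V k) ∧ TwinFree G V := ⟨⟨k, h⟩, hT⟩
  rw [cographWeight, dif_pos h', h'.1.choose_spec.rank_unique h he]

lemma cographWeight_of_not (h : ¬ ((∃ k, IsCograph G V k) ∧ TwinFree G V)) :
    cographWeight t G V = 0 := dif_neg h

lemma cographWeight_isLocal : IsLocal (cographWeight (β := β) t) := by
  intro G G' V h
  have h1 : IsCograph G V = IsCograph G' V := funext fun k => propext
    ⟨fun hk => hk.congr h, fun hk => hk.congr fun x hx y hy => (h x hx y hy).symm⟩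
  have h2 : TwinFree G V ↔ TwinFree G' V :=
    ⟨fun hk => hk.congr h, fun hk => hk.congr fun x hx y hy => (h x hx y hy).symm⟩
  have h3 : ∀ (p q : ℕ → Prop) (hp : ∃ k, p k) (hq : ∃ k, q k), p = q → hp.choose = hq.choose := by
    rintro p _ hp hq rfl; rfl
  by_cases hV : (∃ k, IsCograph G V k) ∧ TwinFree G V
  · have hV' : (∃ k, IsCograph G' V k) ∧ TwinFree G' V := by rwa [← h1, ← h2]
    rw [cographWeight, cographWeight, dif_pos hV, dif_pos hV', h3 _ _ hV.1 hV'.1 h1]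
  · rw [cographWeight_of_not hV, cographWeight_of_not (by rwa [← h1, ← h2])]

lemma cographWeight_singleton (hev : e ≠ v) : cographWeight t G {v} = t := by
  rw [cographWeight_eq (.single v) _ (e := e) (by simpa using hev), pow_one]
  intro a ha b hb hab
  simp_all

lemma cographWeight_union (ht : t ≠ 0) (hd : Disjoint A B) (hA : A.Nonempty) (hB : B.Nonempty)
    (hAB : NoEdges G A B) (hI : NoIsolated G B) (he : e ∉ A ∪ B) :
    cographWeight t G (A ∪ B) = cographWeight t G A * cographWeight t G B / t := by
  have heA : e ∉ A := fun h => he (mem_union_left _ h)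
  have heB : e ∉ B := fun h => he (mem_union_right _ h)
  by_cases h : (∃ k, IsCograph G (A ∪ B) k) ∧ TwinFree G (A ∪ B)
  · obtain ⟨⟨m, hm⟩, hT⟩ := h
    obtain ⟨k, l, hk, hl, hkl⟩ := hm.of_union he hA hB hd hAB
    have hT' := (twinFree_union hAB hI).1 hT
    rw [cographWeight_eq hm hT he, cographWeight_eq hk hT'.1 heA, cographWeight_eq hl hT'.2 heB,
      ← pow_add, hkl, pow_succ, mul_div_cancel_right₀ _ ht]
  · rw [cographWeight_of_not h]
    by_cases hA' : (∃ k, IsCograph G A k) ∧ TwinFree G A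
    · rw [cographWeight_of_not (V := B), mul_zero, zero_div]
      rintro ⟨⟨l, hl⟩, hT⟩
      obtain ⟨⟨k, hk⟩, hT'⟩ := hA'
      have := hk.rank_pos
      exact h ⟨⟨k + l - 1, hk.union' hl hd hAB rfl (by omega)⟩, (twinFree_union hAB hI).2 ⟨hT', hT⟩⟩
    · rw [cographWeight_of_not hA', zero_mul, zero_div]

lemma cographWeight_join (hd : Disjoint A B) (hA : A.Nonempty) (hB : B.Nonempty)
    (hAB : ∀ x ∈ A, ∀ y ∈ B, G.Adj x y) (he : e ∉ A ∪ B) :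
    cographWeight t G (A ∪ B) = cographWeight t G A * cographWeight t G B := by
  have heA : e ∉ A := fun h => he (mem_union_left _ h)
  have heB : e ∉ B := fun h => he (mem_union_right _ h)
  by_cases h : (∃ k, IsCograph G (A ∪ B) k) ∧ TwinFree G (A ∪ B)
  · obtain ⟨⟨m, hm⟩, hT⟩ := h
    obtain ⟨k, l, hk, hl, hkl⟩ := hm.of_join he hA hB hd hAB
    have hT' := (twinFree_join hAB).1 hT
    rw [cographWeight_eq hm hT he, cographWeight_eq hk hT'.1 heA, cographWeight_eq hl hT'.2 heB,
      ← pow_add, hkl]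
  · rw [cographWeight_of_not h]
    by_cases hA' : (∃ k, IsCograph G A k) ∧ TwinFree G A
    · rw [cographWeight_of_not (V := B), mul_zero]
      rintro ⟨⟨l, hl⟩, hT⟩
      obtain ⟨⟨k, hk⟩, hT'⟩ := hA'
      exact h ⟨⟨k + l, .join _ _ _ _ hd hAB hk hl⟩, (twinFree_join hAB).2 ⟨hT', hT⟩⟩
    · rw [cographWeight_of_not hA', zero_mul]

open Classical in
/-- The weight of connected cographs without false twins on at least two vertices. -/
noncomputable def connWeight (t : ℚ) (G : SimpleGraph β) (V : Finset β) : ℚ :=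
  if Conn G V ∧ 2 ≤ V.card then cographWeight t G V / t else 0

open Classical in
/-- The weight of cographs without false twins whose complement is connected. -/
noncomputable def coconnWeight (t : ℚ) (G : SimpleGraph β) (V : Finset β) : ℚ :=
  if Conn Gᶜ V then cographWeight t G V else 0

open Classical in
/-- The weight of (possibly empty) cographs without false twins and isolated vertices. -/
noncomputable def noIsolatedWeight (t : ℚ) (G : SimpleGraph β) (V : Finset β) : ℚ :=
  if V = ∅ then 1 else if NoIsolated G V then cographWeight t G V / t else 0

/-- The weight of (possibly empty) cographs without false twins. -/
noncomputable def allWeight (t : ℚ) (G : SimpleGraph β) (V : Finset β) : ℚ :=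
  if V = ∅ then 1 else cographWeight t G V

lemma conn_congr (h : ∀ x ∈ V, ∀ y ∈ V, G.Adj x y ↔ G'.Adj x y) : Conn G V ↔ Conn G' V :=
  ⟨fun hk => hk.congr h, fun hk => hk.congr fun x hx y hy => (h x hx y hy).symm⟩

lemma connWeight_isLocal : IsLocal (connWeight (β := β) t) := fun G G' V h => by
  rw [connWeight, connWeight, cographWeight_isLocal h]
  classical exact if_congr (and_congr (conn_congr h) Iff.rfl) rfl rfl

lemma coconnWeight_isLocal : IsLocal (coconnWeight (β := β) t) := fun G G' V h => by
  have h' : ∀ x ∈ V, ∀ y ∈ V, Gᶜ.Adj x y ↔ G'ᶜ.Adj x y := fun x hx y hy => by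
    simp only [SimpleGraph.compl_adj, h x hx y hy]
  rw [coconnWeight, coconnWeight, cographWeight_isLocal h]
  classical exact if_congr (conn_congr h') rfl rfl

lemma noIsolatedWeight_isLocal : IsLocal (noIsolatedWeight (β := β) t) := fun G G' V h => by
  have h' : NoIsolated G V ↔ NoIsolated G' V :=
    ⟨fun hk => hk.congr h, fun hk => hk.congr fun x hx y hy => (h x hx y hy).symm⟩
  rw [noIsolatedWeight, noIsolatedWeight, cographWeight_isLocal h]
  classical exact if_congr Iff.rfl rfl (if_congr h' rfl rfl)

lemma allWeight_isLocal : IsLocal (allWeight (β := β) t) := fun G G' V h => by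
  simp only [allWeight, cographWeight_isLocal h]

lemma allWeight_eq (ht : t ≠ 0) (hV : V.Nonempty) :
    allWeight t G V = t * connWeight t G V + coconnWeight t G V := by
  rw [allWeight, if_neg hV.ne_empty, connWeight, coconnWeight]
  by_cases hk : (∃ k, IsCograph G V k) ∧ TwinFree G V
  swap
  · simp [cographWeight_of_not hk]
  obtain ⟨⟨k, hk⟩, -⟩ := hk
  by_cases hc : 2 ≤ V.card
  · have h1 := hk.not_conn hc
    have h2 := conn_or_conn_compl G V
    by_cases h3 : Conn G V
    · rw [if_pos ⟨h3, hc⟩, if_neg (h1.resolve_left (not_not.2 h3)), mul_div_cancel₀ _ ht, add_zero]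
    · rw [if_neg (fun h => h3 h.1), if_pos (h2.resolve_left h3), mul_zero, zero_add]
  · rw [if_neg (fun h => hc h.2), if_pos, mul_zero, zero_add]
    intro A hA h1 h2
    have := card_sdiff_add_card_eq_card hA
    have := h1.card_pos
    have := h2.card_pos
    omega

lemma allWeight_insert (he : e ∉ insert v V) (hv : v ∉ V) (hA : A ⊆ V)
    (hn : NoEdges Gᶜ (insert v A) (V \ A)) (hc : Conn Gᶜ (insert v A)) :
    allWeight t G (insert v V) = coconnWeight t G (insert v A) * allWeight t G (V \ A) := by
  have hd : Disjoint (insert v A) (V \ A) := by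
    rw [disjoint_insert_left]
    exact ⟨fun h => hv (mem_sdiff.1 h).1, disjoint_sdiff⟩
  have hu : insert v V = insert v A ∪ (V \ A) := by
    rw [insert_union, union_sdiff_of_subset hA]
  rw [coconnWeight, if_pos hc, allWeight, if_neg (insert_ne_empty _ _), allWeight]
  split_ifs with h
  · rw [mul_one, hu, h, union_empty]
  · rw [hu] at he ⊢
    refine cographWeight_join hd (insert_nonempty _ _) (nonempty_of_ne_empty h) ?_ he
    intro x hx y hy
    have h1 := hn x hx y hy
    rw [SimpleGraph.compl_adj] at h1
    by_contra h2
    exact h1 ⟨fun hxy => disjoint_left.1 hd hx (hxy ▸ hy), h2⟩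

lemma noIsolatedWeight_insert (ht : t ≠ 0) (he : e ∉ insert v V) (hv : v ∉ V) (hA : A ⊆ V)
    (hn : NoEdges G (insert v A) (V \ A)) (hc : Conn G (insert v A)) :
    noIsolatedWeight t G (insert v V) =
      connWeight t G (insert v A) * noIsolatedWeight t G (V \ A) := by
  have hd : Disjoint (insert v A) (V \ A) := by
    rw [disjoint_insert_left]
    exact ⟨fun h => hv (mem_sdiff.1 h).1, disjoint_sdiff⟩
  have hu : insert v V = insert v A ∪ (V \ A) := by
    rw [insert_union, union_sdiff_of_subset hA]
  rw [noIsolatedWeight, if_neg (insert_ne_empty _ _)]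
  rw [hu] at he ⊢
  by_cases hI : NoIsolated G (insert v A ∪ (V \ A))
  · have hIA := hI.left hn
    have hIB := hI.right hn
    have hcard : 2 ≤ (insert v A).card := by
      obtain ⟨i, hi, hvi⟩ := hIA v (mem_insert_self _ _)
      exact one_lt_card.2 ⟨v, mem_insert_self _ _, i, hi, hvi.ne⟩
    rw [if_pos hI, connWeight, if_pos ⟨hc, hcard⟩, noIsolatedWeight]
    split_ifs with h
    · rw [h, union_empty, mul_one]
    · rw [cographWeight_union ht hd (insert_nonempty _ _) (nonempty_of_ne_empty h) hn hIB he]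
      field_simp
  · rw [if_neg hI, connWeight, noIsolatedWeight]
    split_ifs with h1 h2 h3
    · rw [h2, union_empty] at hI
      exact absurd (h1.1.noIsolated h1.2) hI
    · exact absurd ((h1.1.noIsolated h1.2).union h3) hI
    all_goals simp

open Classical in
lemma allWeight_eq_noIsolatedWeight (ht : t ≠ 0) (he : e ∉ V) (hV : V.Nonempty) :
    allWeight t G V = t * (noIsolatedWeight t G V +
      ∑ v ∈ V, if NoEdges G {v} V then noIsolatedWeight t G (V.erase v) else 0) := by
  rw [allWeight, if_neg hV.ne_empty, noIsolatedWeight, if_neg hV.ne_empty]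
  by_cases hI : NoIsolated G V
  · rw [if_pos hI, sum_eq_zero, add_zero, mul_div_cancel₀ _ ht]
    intro v hv
    obtain ⟨i, hi, hvi⟩ := hI v hv
    exact if_neg fun h => h v (mem_singleton_self v) i hi hvi
  rw [if_neg hI, zero_add]
  simp only [NoIsolated] at hI
  push Not at hI
  obtain ⟨v, hv, hvV⟩ := hI
  by_cases hu : ∃ w ∈ V, w ≠ v ∧ ∀ i ∈ V, ¬ G.Adj w i
  · obtain ⟨w, hw, hwv, hwV⟩ := hu
    rw [cographWeight_of_not, sum_eq_zero, mul_zero]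
    · intro z hz
      have : ∃ z' ∈ V, z' ≠ z ∧ ∀ i ∈ V, ¬ G.Adj z' i := by
        by_cases hzv : z = v
        · exact ⟨w, hw, hzv ▸ hwv, hwV⟩
        · exact ⟨v, hv, fun h => hzv h.symm, hvV⟩
      obtain ⟨z', hz', hzz, hzV⟩ := this
      have hz'' : z' ∈ V.erase z := mem_erase.2 ⟨hzz, hz'⟩
      rw [noIsolatedWeight, if_neg (ne_empty_of_mem hz'')]
      classical refine (if_congr Iff.rfl (if_neg fun h => ?_) rfl).trans (ite_self _)
      obtain ⟨i, hi, h⟩ := h z' hz''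
      exact hzV i (mem_of_mem_erase hi) h
    · rintro ⟨-, hT⟩
      exact hT w hw v hv hwv ⟨hwV v hv, fun i hi _ _ => iff_of_false (hwV i hi) (hvV i hi)⟩
  · push Not at hu
    rw [sum_eq_single_of_mem v hv, if_pos (by simpa [NoEdges] using hvV), noIsolatedWeight]
    · split_ifs with h1 h2
      · rw [show V = {v} from ((erase_eq_empty_iff _ _).1 h1).resolve_left hV.ne_empty,
          cographWeight_singleton (e := e), mul_one]
        rintro rfl; exact he hv
      · have hV' : {v} ∪ V.erase v = V := by rw [← insert_eq, insert_erase hv]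
        have := cographWeight_union (A := {v}) (B := V.erase v) (G := G) (e := e) ht (by simp)
          (by simp) (nonempty_of_ne_empty h1) (by
            intro x hx y hy
            rw [mem_singleton.1 hx]
            exact hvV y (mem_of_mem_erase hy)) h2 (by rwa [hV'])
        rw [hV', cographWeight_singleton (e := e) (by rintro rfl; exact he hv)] at this
        rw [this]
        field_simp
      · refine absurd (fun a ha => ?_) h2
        obtain ⟨i, hi, hai⟩ := hu a (mem_of_mem_erase ha) (ne_of_mem_erase ha)
        refine ⟨i, mem_erase.2 ⟨?_, hi⟩, hai⟩
        rintro rfl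
        exact hvV a (mem_of_mem_erase ha) hai.symm
    · intro w hw hwv
      obtain ⟨i, hi, hwi⟩ := hu w hw hwv
      exact if_neg fun h => h w (mem_singleton_self w) i hi hwi

/-- The recursive equations for the weighted numbers of cographs without false twins, where
`a`, `d`, `y`, `b` refer to cographs without isolated vertices, connected cographs, cographs with
connected complement and all cographs. -/
structure IsSolution (t : ℚ) (a d y b : Finset β → ℚ) : Prop where
  a_empty : a ∅ = 1
  b_empty : b ∅ = 1
  b_eq_add : ∀ V, (∃ e, e ∉ V) → V.Nonempty → b V = t * d V + y V
  b_eq_sum : ∀ V, (∃ e, e ∉ V) → V.Nonempty → b V = t * (a V + ∑ v ∈ V, a (V.erase v))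
  b_insert : ∀ V v, v ∉ V → (∃ e, e ∉ insert v V) →
    b (insert v V) = ∑ A ∈ V.powerset, y (insert v A) * b (V \ A)
  a_insert : ∀ V v, v ∉ V → (∃ e, e ∉ insert v V) →
    a (insert v V) = ∑ A ∈ V.powerset, d (insert v A) * a (V \ A)

theorem isSolution_graphSum (ht : t ≠ 0) : IsSolution (β := β) t
    (graphSum (noIsolatedWeight t)) (graphSum (connWeight t)) (graphSum (coconnWeight t))
    (graphSum (allWeight t)) where
  a_empty := graphSum_empty fun G => if_pos rfl
  b_empty := graphSum_empty fun G => if_pos rfl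
  b_eq_add V _ hV := by
    simp only [graphSum]
    rw [mul_sum, ← sum_add_distrib]
    exact sum_congr rfl fun G _ => allWeight_eq ht hV
  b_eq_sum V he hV := by
    classical
    obtain ⟨e, he⟩ := he
    rw [graphSum, sum_congr rfl fun G _ => allWeight_eq_noIsolatedWeight ht he hV, ← mul_sum,
      sum_add_distrib, sum_comm]
    congr 2
    refine sum_congr rfl fun v hv => ?_
    rw [← sum_filter, graphSum]
    refine sum_congr ?_ fun _ _ => rfl
    ext G
    rw [mem_filter, mem_graphsOn, mem_graphsOn]
    constructor
    · rintro ⟨hG, hv⟩ x y hxy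
      have hx := (hG x y hxy).1
      have hy := (hG x y hxy).2
      have hv' := hv v (mem_singleton_self v)
      refine ⟨mem_erase.2 ⟨?_, hx⟩, mem_erase.2 ⟨?_, hy⟩⟩
      · rintro rfl; exact hv' y hy hxy
      · rintro rfl; exact hv' x hx hxy.symm
    · intro hG
      refine ⟨fun x y hxy => ⟨mem_of_mem_erase (hG x y hxy).1, mem_of_mem_erase (hG x y hxy).2⟩, ?_⟩
      intro x hx y _ hxy
      rw [mem_singleton.1 hx] at hxy
      exact notMem_erase v V (hG v y hxy).1
  b_insert V v hv he := by
    obtain ⟨e, he⟩ := he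
    rw [← graphSum_compl allWeight_isLocal, graphSum_insert (coconnWeight_isLocal (t := t)).compl
      (allWeight_isLocal (t := t)).compl hv]
    · refine sum_congr rfl fun A _ => ?_
      rw [graphSum_compl coconnWeight_isLocal, graphSum_compl allWeight_isLocal]
    · intro G A h
      rw [coconnWeight, compl_compl, if_neg h]
    · intro G A hA hn hc
      exact allWeight_insert he hv hA (by rwa [compl_compl]) (by rwa [compl_compl])
  a_insert V v hv he := by
    obtain ⟨e, he⟩ := he
    refine graphSum_insert connWeight_isLocal noIsolatedWeight_isLocal hv ?_ ?_
    · intro G A h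
      rw [connWeight, if_neg fun h' => h h'.1]
    · intro G A hA hn hc
      exact noIsolatedWeight_insert ht he hv hA hn hc

end Weights
end SeriesParallel

namespace SeriesParallel

open Finset

section Sequences

variable {t : ℚ}

lemma sum_powerset_eq {β : Type*} [DecidableEq β] {V : Finset β} {m : ℕ} (hV : V.card = m)
    {g : Finset β → ℚ} {f : ℕ → ℚ} (hg : ∀ A ⊆ V, A ≠ V → g A = f A.card) :
    ∑ A ∈ V.powerset, g A = g V + ∑ j ∈ range m, (m.choose j : ℚ) * f j := by
  have h1 : ∀ A ∈ V.powerset, g A = (if A = V then g V else 0) +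
      (fun j => if j = m then 0 else f j) A.card := by
    intro A hA
    have hA := mem_powerset.1 hA
    by_cases h : A = V
    · simp [h, hV]
    · have : A.card ≠ m := fun hc => h (eq_of_subset_of_card_le hA (by rw [hV, hc]))
      simp [h, hg A hA h, this]
  rw [sum_congr rfl h1, sum_add_distrib, sum_ite_eq', if_pos (mem_powerset.2 (Subset.refl V)),
    sum_powerset_apply_card (fun j => if j = m then 0 else f j), hV, sum_range_succ, if_pos rfl, smul_zero, add_zero]
  refine congrArg _ (sum_congr rfl fun j hj => ?_)
  rw [if_neg (mem_range.1 hj).ne, nsmul_eq_mul]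

/-- The recursive equations determine the numbers, which depend on the number of vertices only. -/
lemma exists_sequences (ht : t ≠ 0) : ∃ a d y b : ℕ → ℚ,
    ∀ (β : Type) [DecidableEq β] (a' d' y' b' : Finset β → ℚ), IsSolution t a' d' y' b' →
      ∀ V, (∃ e, e ∉ V) → a' V = a V.card ∧ b' V = b V.card ∧
        (V.Nonempty → d' V = d V.card ∧ y' V = y V.card) := by
  have key : ∀ m, ∃ a d y b : ℚ,
      ∀ (β : Type) [DecidableEq β] (a' d' y' b' : Finset β → ℚ), IsSolution t a' d' y' b' →
        ∀ V, (∃ e, e ∉ V) → V.card = m →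
          a' V = a ∧ b' V = b ∧ (V.Nonempty → d' V = d ∧ y' V = y) := by
    intro m
    induction m using Nat.strong_induction_on with
    | _ m ih =>
    obtain _ | m := m
    · refine ⟨1, 0, 0, 1, fun β _ a' d' y' b' h V _ hV => ?_⟩
      rw [card_eq_zero] at hV
      subst hV
      exact ⟨h.a_empty, h.b_empty, fun h => absurd h (by simp)⟩
    have ih' : ∀ j, ∃ a d y b : ℚ, j < m + 1 →
      ∀ (β : Type) [DecidableEq β] (a' d' y' b' : Finset β → ℚ), IsSolution t a' d' y' b' →
        ∀ V, (∃ e, e ∉ V) → V.card = j →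
          a' V = a ∧ b' V = b ∧ (V.Nonempty → d' V = d ∧ y' V = y) := by
      intro j
      by_cases hj : j < m + 1
      · obtain ⟨a, d, y, b, h⟩ := ih j hj
        exact ⟨a, d, y, b, fun _ => h⟩
      · exact ⟨0, 0, 0, 0, fun h => absurd h hj⟩
    choose a d y b h using ih'
    obtain ⟨R, hR⟩ : ∃ R, R = ∑ j ∈ range m, (m.choose j : ℚ) * (y (j + 1) * b (m - j)) := ⟨_, rfl⟩
    obtain ⟨S, hS⟩ : ∃ S, S = ∑ j ∈ range m, (m.choose j : ℚ) * (d (j + 1) * a (m - j)) := ⟨_, rfl⟩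
    refine ⟨R / t + S, R / t, t * (R / t + S + (m + 1) * a m) - R,
      t * (R / t + S + (m + 1) * a m), fun β _ a' d' y' b' hs V he hV => ?_⟩
    have hne : V.Nonempty := card_pos.1 (by omega)
    obtain ⟨v, hv⟩ := hne
    obtain ⟨W, hvW, rfl⟩ : ∃ W, v ∉ W ∧ V = insert v W :=
      ⟨V.erase v, notMem_erase v V, (insert_erase hv).symm⟩
    have hW : W.card = m := by rw [card_insert_of_notMem hvW] at hV; omega
    obtain ⟨e, he⟩ := he
    have hcard : ∀ A ⊆ W, A ≠ W → A.card < m := fun A hA hAW =>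
      hW ▸ card_lt_card (hA.ssubset_of_ne hAW)
    have hsub : ∀ A ⊆ W, ∃ e, e ∉ insert v A := fun A hA =>
      ⟨e, fun h => he (insert_subset_insert v hA h)⟩
    have hsub' : ∀ A, ∃ e, e ∉ W \ A := fun A =>
      ⟨e, fun h => he (mem_insert_of_mem (mem_sdiff.1 h).1)⟩
    have hins : ∀ A ⊆ W, (insert v A).card = A.card + 1 := fun A hA =>
      card_insert_of_notMem fun h => hvW (hA h)
    have hdc : ∀ A ⊆ W, (W \ A).card = m - A.card := fun A hA => by
      rw [card_sdiff_of_subset hA, hW]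
    have hb : b' (insert v W) = y' (insert v W) + R := by
      rw [hs.b_insert W v hvW ⟨e, he⟩, sum_powerset_eq hW (f := fun j => y (j + 1) * b (m - j)),
        sdiff_self, bot_eq_empty, hs.b_empty, mul_one, hR]
      intro A hA hAW
      have := hcard A hA hAW
      rw [((h (A.card + 1) (by omega) β a' d' y' b' hs _ (hsub A hA) (hins A hA)).2.2
        (insert_nonempty _ _)).2, (h (m - A.card) (by omega) β a' d' y' b' hs _ (hsub' A)
        (hdc A hA)).2.1]
    have ha : a' (insert v W) = d' (insert v W) + S := by
      rw [hs.a_insert W v hvW ⟨e, he⟩, sum_powerset_eq hW (f := fun j => d (j + 1) * a (m - j)),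
        sdiff_self, bot_eq_empty, hs.a_empty, mul_one, hS]
      intro A hA hAW
      have := hcard A hA hAW
      rw [((h (A.card + 1) (by omega) β a' d' y' b' hs _ (hsub A hA) (hins A hA)).2.2
        (insert_nonempty _ _)).1, (h (m - A.card) (by omega) β a' d' y' b' hs _ (hsub' A)
        (hdc A hA)).1]
    have hb2 := hs.b_eq_add (insert v W) ⟨e, he⟩ (insert_nonempty _ _)
    have hb3 := hs.b_eq_sum (insert v W) ⟨e, he⟩ (insert_nonempty _ _)
    rw [sum_congr rfl fun w hw => (h m (by omega) β a' d' y' b' hs ((insert v W).erase w)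
      ⟨e, fun h => he (mem_of_mem_erase h)⟩ (by rw [card_erase_of_mem hw, hV]; rfl)).1, sum_const,
      hV, nsmul_eq_mul] at hb3
    have hd : d' (insert v W) = R / t := by
      rw [eq_div_iff ht]; linarith
    rw [hd] at ha
    rw [ha] at hb3
    push_cast at hb3
    exact ⟨ha, hb3, fun _ => ⟨hd, by linarith⟩⟩
  choose a d y b h using key
  exact ⟨a, d, y, b, fun β _ a' d' y' b' hs V he => h V.card β a' d' y' b' hs V he rfl⟩

lemma IsCograph.rank_le_card {β : Type*} [DecidableEq β] {G : SimpleGraph β} {V : Finset β} {k : ℕ}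
    (h : IsCograph G V k) : k ≤ V.card := by
  induction h with
  | single v => simp
  | union V W k l m hVW h hV hW hm ihV ihW =>
    rw [card_union_of_disjoint hVW]; omega
  | join V W k l hVW h hV hW ihV ihW =>
    rw [card_union_of_disjoint hVW]; omega

/-- The numbers of simple series-parallel matroids of all ranks, as a weighted sum over graphs. -/
lemma graphSum_noIsolatedWeight (ht : t ≠ 0) {m : ℕ} (hm : 1 ≤ m) (e : Fin (m + 1)) :
    graphSum (noIsolatedWeight t) (univ.erase e) =
      ∑ k ∈ range m, (numSimpleSeriesParallel (m + 1) (k + 1) : ℚ) * t ^ k := by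
  classical
  obtain ⟨V, hV⟩ : ∃ V : Finset (Fin (m + 1)), V = univ.erase e := ⟨_, rfl⟩
  have heV : e ∉ V := by simp [hV]
  have hcard : V.card = m := by simp [hV]
  have hne : V ≠ ∅ := by rw [← card_pos.trans nonempty_iff_ne_empty]; omega
  have h1 : ∀ k, (numSimpleSeriesParallel (m + 1) (k + 1) : ℚ) * t ^ k = ∑ G ∈ graphsOn V,
      if IsCograph G V (k + 1) ∧ TwinFree G V ∧ NoIsolated G V then t ^ k else 0 := by
    intro k
    rw [numSimpleSeriesParallel_eq_ncard (by omega) e, ← hV, ← sum_filter, sum_const, nsmul_eq_mul,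
      ← Set.ncard_coe_finset]
    congr 4
    ext G
    simp [mem_graphsOn]
  rw [sum_congr rfl fun k _ => h1 k, sum_comm, ← hV]
  refine sum_congr rfl fun G _ => ?_
  rw [noIsolatedWeight, if_neg hne]
  by_cases h : (∃ k, IsCograph G V k) ∧ TwinFree G V ∧ NoIsolated G V
  · obtain ⟨⟨k, hk⟩, hT, hI⟩ := h
    have hkp := hk.rank_pos
    have hkc := hk.rank_le_card
    obtain ⟨k, rfl⟩ : ∃ j, k = j + 1 := ⟨k - 1, by omega⟩
    rw [if_pos hI, cographWeight_eq hk hT heV, sum_eq_single_of_mem k (mem_range.2 (by omega)),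
      if_pos ⟨hk, hT, hI⟩, pow_succ, mul_div_cancel_right₀ _ ht]
    intro j _ hj
    exact if_neg fun h => hj (by have := h.1.rank_unique hk heV; omega)
  · rw [sum_eq_zero fun k _ => if_neg fun h' => h ⟨⟨_, h'.1⟩, h'.2⟩]
    split_ifs with hI
    · rw [cographWeight_of_not fun h' => h ⟨h'.1, h'.2, hI⟩, zero_div]
    · rfl

/-- Recursive equations for the numbers of simple series-parallel matroids. -/
theorem exists_recursion (ht : t ≠ 0) : ∃ a d y b : ℕ → ℚ, a 0 = 1 ∧ b 0 = 1 ∧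
    (∀ m, b (m + 1) = t * d (m + 1) + y (m + 1)) ∧
    (∀ m, b (m + 1) = t * (a (m + 1) + (m + 1) * a m)) ∧
    (∀ m, b (m + 1) = ∑ j ∈ range (m + 1), (m.choose j : ℚ) * (y (j + 1) * b (m - j))) ∧
    (∀ m, a (m + 1) = ∑ j ∈ range (m + 1), (m.choose j : ℚ) * (d (j + 1) * a (m - j))) ∧
    ∀ m, 1 ≤ m → a m = ∑ k ∈ range m, (numSimpleSeriesParallel (m + 1) (k + 1) : ℚ) * t ^ k := by
  obtain ⟨a, d, y, b, h⟩ := exists_sequences ht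
  have hs := isSolution_graphSum (β := ℕ) ht
  have hex : ∀ V : Finset ℕ, ∃ e, e ∉ V := fun V => Infinite.exists_notMem_finset V
  have h' := fun V => h ℕ _ _ _ _ hs V (hex V)
  have hr : ∀ m, insert m (range m) = range (m + 1) := fun m => range_add_one.symm
  have hnr : ∀ m, (range (m + 1)).Nonempty := fun m => nonempty_range_iff.2 (by omega)
  have hA : ∀ m, graphSum (noIsolatedWeight t) (range m) = a m := fun m => by
    simpa using (h' (range m)).1
  have hB : ∀ m, graphSum (allWeight t) (range m) = b m := fun m => by
    simpa using (h' (range m)).2.1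
  have hdc : ∀ m, ∀ A ⊆ range m, (range m \ A).card = m - A.card := fun m A hA => by
    rw [card_sdiff_of_subset hA, card_range]
  have hins : ∀ m, ∀ A ⊆ range m, (insert m A).card = A.card + 1 := fun m A hA =>
    card_insert_of_notMem fun h => notMem_range_self (hA h)
  refine ⟨a, d, y, b, ?_, ?_, fun m => ?_, fun m => ?_, fun m => ?_, fun m => ?_, fun m hm => ?_⟩
  · rw [← hA, range_zero, hs.a_empty]
  · rw [← hB, range_zero, hs.b_empty]
  · have := (h' (range (m + 1))).2.2 (hnr m)
    rw [card_range] at this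
    rw [← hB, hs.b_eq_add _ (hex _) (hnr m), this.1, this.2]
  · rw [← hB, hs.b_eq_sum _ (hex _) (hnr m), hA, sum_congr rfl fun v hv => (h' _).1,
      sum_congr rfl fun v hv => by rw [card_erase_of_mem hv], sum_const, card_range, nsmul_eq_mul]
    push_cast
    rfl
  · rw [← hB, ← hr, hs.b_insert _ _ notMem_range_self (hex _)]
    have h1 : ∀ A ∈ (range m).powerset, graphSum (coconnWeight t) (insert m A) *
        graphSum (allWeight t) (range m \ A) = (fun j => y (j + 1) * b (m - j)) A.card := by
      intro A hA
      have hA := mem_powerset.1 hA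
      rw [((h' _).2.2 (insert_nonempty _ _)).2, (h' _).2.1, hins m A hA, hdc m A hA]
    rw [sum_congr rfl h1, sum_powerset_apply_card (fun j => y (j + 1) * b (m - j)), card_range, hr]
    simp only [nsmul_eq_mul]
  · rw [← hA, ← hr, hs.a_insert _ _ notMem_range_self (hex _)]
    have h1 : ∀ A ∈ (range m).powerset, graphSum (connWeight t) (insert m A) *
        graphSum (noIsolatedWeight t) (range m \ A) = (fun j => d (j + 1) * a (m - j)) A.card := by
      intro A hA
      have hA := mem_powerset.1 hA
      rw [((h' _).2.2 (insert_nonempty _ _)).1, (h' _).1, hins m A hA, hdc m A hA]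
    rw [sum_congr rfl h1, sum_powerset_apply_card (fun j => d (j + 1) * a (m - j)), card_range, hr]
    simp only [nsmul_eq_mul]
  · rw [← graphSum_noIsolatedWeight ht hm 0, (h (Fin (m + 1)) _ _ _ _ (isSolution_graphSum ht) _
      ⟨0, by simp⟩).1]
    simp

end Sequences
end SeriesParallel

namespace SeriesParallel

open Equiv Equiv.Perm

section Stirling

/-- The number of nontrivial cycles of a permutation. -/
def numCycles {α : Type*} [Fintype α] [DecidableEq α] (σ : Perm α) : ℕ := Multiset.card σ.cycleType

lemma numCycles_swap_mul {α : Type*} [Fintype α] [DecidableEq α] {σ : Perm α} {x : α}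
    (hx : σ x ≠ x) :
    numCycles (swap x (σ x) * σ) + (if σ (σ x) = x then 1 else 0) = numCycles σ := by
  have hc : σ.cycleOf x ∈ σ.cycleFactorsFinset :=
    cycleOf_mem_cycleFactorsFinset_iff.2 (mem_support.2 hx)
  have hd := disjoint_mul_inv_of_mem_cycleFactorsFinset hc
  obtain ⟨c, hcdef⟩ : ∃ c, c = σ.cycleOf x := ⟨_, rfl⟩
  obtain ⟨g, hg⟩ : ∃ g, g = σ * c⁻¹ := ⟨_, rfl⟩
  rw [← hcdef, ← hg] at hd
  have hσ : σ = c * g := by rw [hd.symm.commute.eq, hg, inv_mul_cancel_right]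
  have hcx : c x = σ x := by rw [hcdef, cycleOf_apply_self]
  have hccx : c (c x) = σ (σ x) := by
    rw [hcx, hcdef]
    exact SameCycle.cycleOf_apply ⟨1, by simp⟩
  have hcyc : c.IsCycle := hcdef ▸ isCycle_cycleOf _ hx
  have h1 : numCycles σ = 1 + numCycles g := by
    rw [numCycles, hσ, hd.symm.cycleType_mul, Multiset.card_add, card_cycleType_eq_one.2 hcyc]
    rfl
  have h2 : swap x (σ x) * σ = (swap x (c x) * c) * g := by
    rw [hcx, mul_assoc, ← hσ]
  rw [h2, h1]
  split_ifs with h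
  · rw [hcyc.eq_swap_of_apply_apply_eq_self (hcx ▸ hx) (hccx.trans h), swap_apply_left, swap_mul_self,
      one_mul, add_comm]
  · have h3 : (swap x (c x) * c).IsCycle := hcyc.swap_mul (hcx ▸ hx) (by rwa [hccx])
    have h4 : Disjoint (swap x (c x) * c) g := by
      rw [disjoint_iff_disjoint_support]
      refine (disjoint_iff_disjoint_support.1 hd.symm).mono_left ?_
      intro y hy
      by_contra hyc
      rw [mem_support, not_not] at hyc
      rw [mem_support, Perm.mul_apply, hyc] at hy
      refine hy (swap_apply_of_ne_of_ne ?_ ?_)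
      · rintro rfl; exact hx (hcx ▸ hyc)
      · rintro rfl; exact hx (hcx ▸ c.injective hyc)
    rw [numCycles, h4.cycleType_mul, Multiset.card_add, card_cycleType_eq_one.2 h3]
    rfl

lemma numCycles_optionCongr {α : Type*} [Fintype α] [DecidableEq α] (τ : Perm α) :
    numCycles (optionCongr τ : Perm (Option α)) = numCycles τ := by
  have : (optionCongr τ : Perm (Option α)) = τ.extendDomain (optionIsSomeEquiv α).symm := by
    ext1 x
    cases x with
    | none => rw [extendDomain_apply_not_subtype _ _ (by simp)]; rfl
    | some x =>
      have := extendDomain_apply_image τ (optionIsSomeEquiv α).symm x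
      exact this.symm
  rw [numCycles, this, cycleType_extendDomain]
  rfl

lemma numCycles_permCongr {α β : Type*} [Fintype α] [DecidableEq α] [Fintype β] [DecidableEq β]
    (e : α ≃ β) (τ : Perm α) : numCycles (e.permCongr τ) = numCycles τ := by
  let f : α ≃ {x : β // True} := e.trans (Equiv.subtypeUnivEquiv fun _ => trivial).symm
  have : e.permCongr τ = τ.extendDomain f := by
    ext1 x
    rw [extendDomain_apply_subtype _ _ trivial]
    rfl
  rw [numCycles, this, cycleType_extendDomain]
  rfl

/-- The number of derangements with a given number of cycles. -/
def derangementCount (α : Type*) [Fintype α] [DecidableEq α] (q : ℕ) : ℕ :=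
  Fintype.card {σ : Perm α // (∀ i, σ i ≠ i) ∧ numCycles σ = q}

lemma derangementCount_congr {α β : Type*} [Fintype α] [DecidableEq α] [Fintype β] [DecidableEq β]
    (e : α ≃ β) (q : ℕ) : derangementCount α q = derangementCount β q := by
  refine Fintype.card_congr (e.permCongr.subtypeEquiv fun τ => and_congr ?_ ?_)
  · rw [e.forall_congr_left]
    refine forall_congr' fun i => not_congr ?_
    rw [permCongr_apply, ← e.eq_symm_apply]
  · rw [numCycles_permCongr]

lemma card_fixedPoint_eq {α : Type*} [Fintype α] [DecidableEq α] (a : α) (q : ℕ) :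
    Fintype.card {τ : Perm α // (∀ i, τ i = i ↔ i = a) ∧ numCycles τ = q} =
      derangementCount {x // x ≠ a} q := by
  symm
  have happ : ∀ (τ : Perm {x // x ≠ a}) (i : α) (hi : i ≠ a),
      (Perm.subtypeEquivSubtypePerm (fun x => x ≠ a) τ).1 i = τ ⟨i, hi⟩ := fun τ i hi =>
    Perm.subtypeEquivSubtypePerm_apply_of_mem (p := fun x => x ≠ a) τ hi
  refine Fintype.card_congr (((Perm.subtypeEquivSubtypePerm fun x => x ≠ a).subtypeEquiv
    (q := fun τ => (∀ i, τ.1 i ≠ i ∨ i = a) ∧ numCycles τ.1 = q) fun τ => and_congr ?_ ?_).trans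
      ((Equiv.subtypeSubtypeEquivSubtypeInter (fun τ : Perm α => ∀ i, ¬ i ≠ a → τ i = i)
      fun τ => (∀ i, τ i ≠ i ∨ i = a) ∧ numCycles τ = q).trans (Equiv.subtypeEquivRight fun τ => ?_)))
  · constructor
    · intro h i
      by_cases hi : i = a
      · exact Or.inr hi
      · refine Or.inl fun h' => h ⟨i, hi⟩ (Subtype.ext ?_)
        rwa [happ _ _ hi] at h'
    · rintro h ⟨i, hi⟩ h'
      refine (h i).elim (fun h => h ?_) hi
      rw [happ _ _ hi, h']
  · rw [Perm.subtypeEquivSubtypePerm_apply_coe, numCycles, numCycles, cycleType_ofSubtype]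
  · have : ∀ i, (τ i = i ↔ i = a) ↔ ((¬ i ≠ a → τ i = i) ∧ (τ i ≠ i ∨ i = a)) := fun i => by tauto
    simp only [this, forall_and, and_assoc]

lemma numCycles_decomposeOption_symm {α : Type*} [Fintype α] [DecidableEq α] (a : α) (τ : Perm α) :
    numCycles (decomposeOption.symm (some a, τ)) = numCycles τ + if τ a = a then 1 else 0 := by
  have h0 : (decomposeOption.symm (some a, τ)) none = some a := by simp
  have h1 : (decomposeOption.symm (some a, τ)) (some a) = none ↔ τ a = a := by
    simp [swap_apply_eq_iff]
  rw [← numCycles_swap_mul (x := none) (by rw [h0]; simp), h0]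
  simp only [h1]
  congr 1
  rw [← numCycles_optionCongr τ]
  simp

lemma derangement_decomposeOption_symm {α : Type*} [DecidableEq α] (a : α) (τ : Perm α) :
    (∀ i, (decomposeOption.symm (some a, τ)) i ≠ i) ↔ ∀ i, τ i = i → i = a := by
  rw [Option.forall]
  simp [swap_apply_eq_iff]
  refine forall_congr' fun x => ?_
  by_cases hx : x = a
  · subst hx; simp
  · rw [swap_apply_of_ne_of_ne (by simp) (by simpa using hx)]
    simp [hx]

lemma derangementCount_option {α : Type*} [Fintype α] [DecidableEq α] (q : ℕ) :
    derangementCount (Option α) (q + 1) =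
      ∑ a : α, (derangementCount α (q + 1) + derangementCount {x // x ≠ a} q) := by
  classical
  rw [derangementCount, Fintype.card_subtype, Finset.card_filter,
    ← decomposeOption.symm.sum_comp, Fintype.sum_prod_type, Fintype.sum_option]
  rw [Finset.sum_eq_zero, zero_add]
  · refine Finset.sum_congr rfl fun a _ => ?_
    rw [← card_fixedPoint_eq, derangementCount, Fintype.card_subtype, Finset.card_filter,
      Fintype.card_subtype, Finset.card_filter, ← Finset.sum_add_distrib]
    refine Finset.sum_congr rfl fun τ _ => ?_
    simp only [derangement_decomposeOption_symm, numCycles_decomposeOption_symm]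
    by_cases ha : τ a = a
    · rw [if_pos ha, if_neg (c := (∀ i, τ i ≠ i) ∧ numCycles τ = q + 1) fun h => h.1 a ha, zero_add]
      refine if_congr (and_congr (forall_congr' fun i => ⟨fun h => ⟨h, ?_⟩, fun h => h.1⟩)
        (by simp)) rfl rfl
      rintro rfl; exact ha
    · rw [if_neg ha, if_neg (c := (∀ i, τ i = i ↔ i = a) ∧ numCycles τ = q)
        fun h => ha ((h.1 a).2 rfl), add_zero]
      refine if_congr (and_congr (forall_congr' fun i => ⟨fun h hi => ?_, fun h h' => absurd h' h⟩)
        (by simp)) rfl rfl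
      have := h hi
      subst this
      exact ha hi
  · intro τ _
    exact if_neg fun h => h.1 none (by simp)

lemma assocStirlingFirst_eq (n k : ℕ) : assocStirlingFirst n k = derangementCount (Fin n) k := by
  unfold assocStirlingFirst derangementCount numCycles
  convert rfl

lemma assocStirlingFirst_succ_succ (m q : ℕ) : assocStirlingFirst (m + 1) (q + 1) =
    m * (assocStirlingFirst m (q + 1) + assocStirlingFirst (m - 1) q) := by
  simp only [assocStirlingFirst_eq]
  rw [derangementCount_congr (finSuccEquiv m), derangementCount_option,
    Finset.sum_congr rfl fun a _ => by
      rw [derangementCount_congr (Fintype.equivFinOfCardEq (n := m - 1) (by simp) :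
        {x : Fin m // x ≠ a} ≃ Fin (m - 1)) q], Finset.sum_const]
  simp

lemma assocStirlingFirst_succ_zero (m : ℕ) : assocStirlingFirst (m + 1) 0 = 0 := by
  rw [assocStirlingFirst, Fintype.card_eq_zero_iff]
  refine ⟨fun σ => σ.2.1 0 ?_⟩
  rw [card_cycleType_eq_zero.1 σ.2.2, Perm.one_apply]

lemma assocStirlingFirst_zero_succ (q : ℕ) : assocStirlingFirst 0 (q + 1) = 0 := by
  rw [assocStirlingFirst, Fintype.card_eq_zero_iff]
  refine ⟨fun σ => ?_⟩
  have := σ.2.2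
  rw [Subsingleton.elim σ.1 1, cycleType_one] at this
  simp at this

lemma assocStirlingFirst_zero_zero : assocStirlingFirst 0 0 = 1 := by
  rw [assocStirlingFirst, Fintype.card_eq_one_iff]
  refine ⟨⟨1, fun i => i.elim0, by simp⟩, fun σ => Subtype.ext (Subsingleton.elim _ _)⟩

lemma assocStirlingFirst_eq_zero : ∀ {m q : ℕ}, m < 2 * q → assocStirlingFirst m q = 0
  | 0, q + 1, _ => assocStirlingFirst_zero_succ q
  | 1, q + 1, _ => by rw [assocStirlingFirst_succ_succ, zero_mul]
  | m + 2, q + 1, h => by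
    rw [assocStirlingFirst_succ_succ, assocStirlingFirst_eq_zero (m := m + 1) (by omega),
      Nat.add_sub_cancel, assocStirlingFirst_eq_zero (m := m) (by omega), add_zero, mul_zero]

end Stirling
end SeriesParallel

namespace SeriesParallel

open Finset PowerSeries
open scoped Nat

section Egf

/-- The exponential generating function of a sequence. -/
noncomputable def egf (s : ℕ → ℚ) : ℚ⟦X⟧ := .mk fun n => s n / n !

lemma coeff_egf (s : ℕ → ℚ) (n : ℕ) : coeff n (egf s) = s n / n ! := coeff_mk _ _

lemma egf_mul (f g : ℕ → ℚ) : egf f * egf g =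
    egf fun m => ∑ j ∈ range (m + 1), (m.choose j : ℚ) * (f j * g (m - j)) := by
  ext m
  rw [coeff_mul, Nat.sum_antidiagonal_eq_sum_range_succ_mk, coeff_egf, sum_div]
  refine sum_congr rfl fun j hj => ?_
  have hj : j ≤ m := by simpa [Nat.lt_succ_iff] using hj
  rw [coeff_egf, coeff_egf, Nat.cast_choose ℚ hj]
  have h1 : (m ! : ℚ) ≠ 0 := by positivity
  have h2 : (j ! : ℚ) ≠ 0 := by positivity
  have h3 : ((m - j)! : ℚ) ≠ 0 := by positivity
  field_simp

lemma derivative_egf (s : ℕ → ℚ) : d⁄dX ℚ (egf s) = egf fun m => s (m + 1) := by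
  ext m
  rw [coeff_derivative, coeff_egf, coeff_egf, Nat.factorial_succ]
  have h1 : (m ! : ℚ) ≠ 0 := by positivity
  push_cast
  field_simp

lemma X_mul_egf (s : ℕ → ℚ) : X * egf s = egf fun m => m * s (m - 1) := by
  ext m
  cases m with
  | zero => simp [coeff_egf]
  | succ m =>
    rw [coeff_succ_X_mul, coeff_egf, coeff_egf, Nat.factorial_succ]
    have h1 : (m ! : ℚ) ≠ 0 := by positivity
    push_cast
    field_simp

lemma egf_add (f g : ℕ → ℚ) : egf f + egf g = egf fun m => f m + g m := by
  ext m
  simp [coeff_egf, add_div]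

lemma C_mul_egf (c : ℚ) (f : ℕ → ℚ) : C c * egf f = egf fun m => c * f m := by
  ext m
  simp [coeff_egf, mul_div_assoc]

/-- Uniqueness of the solution of a linear differential equation of order one. -/
lemma eq_of_derivative_eq {U K F G : ℚ⟦X⟧} (hU : U ≠ 0) (hF : U * d⁄dX ℚ F = K * F)
    (hG : U * d⁄dX ℚ G = K * G) (hF0 : constantCoeff F = 1) (hG0 : constantCoeff G = 1) : F = G := by
  have hG' : G * G⁻¹ = 1 := PowerSeries.mul_inv_cancel G (by simp [hG0])
  have : F * G⁻¹ = 1 := by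
    refine derivative.ext ?_ ?_
    · rw [derivative_one]
      refine (mul_eq_zero.1 (?_ : U * _ = 0)).resolve_left hU
      rw [Derivation.leibniz, derivative_inv', smul_eq_mul, smul_eq_mul]
      linear_combination G⁻¹ * hF - F * G⁻¹ ^ 2 * hG - K * F * G⁻¹ * hG'
    · rw [map_mul, hF0, one_mul, map_one, constantCoeff_inv, hG0, inv_one]
  calc F = F * G⁻¹ * G := by rw [mul_assoc, mul_comm G⁻¹, hG', mul_one]
    _ = G := by rw [this, one_mul]

/-- The generating polynomial of the associated Stirling numbers of the first kind. -/
noncomputable def assocStirlingSum (x : ℚ) (m : ℕ) : ℚ :=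
  ∑ q ∈ range (m + 1), x ^ q * assocStirlingFirst m q

lemma assocStirlingSum_succ (x : ℚ) (m : ℕ) : assocStirlingSum x (m + 1) =
    m * (assocStirlingSum x m + x * assocStirlingSum x (m - 1)) := by
  rw [assocStirlingSum, sum_range_succ']
  simp only [assocStirlingFirst_succ_succ, assocStirlingFirst_succ_zero]
  cases m with
  | zero => simp
  | succ m =>
    have h1 : assocStirlingSum x (m + 1) =
        ∑ q ∈ range (m + 1 + 1), x ^ (q + 1) * assocStirlingFirst (m + 1) (q + 1) := by
      rw [assocStirlingSum, sum_range_succ', sum_range_succ _ (m + 1),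
        assocStirlingFirst_eq_zero (m := m + 1) (q := m + 1 + 1) (by omega),
        assocStirlingFirst_succ_zero]
      simp
    have h2 : assocStirlingSum x m = ∑ q ∈ range (m + 1 + 1), x ^ q * assocStirlingFirst m q := by
      rw [assocStirlingSum, sum_range_succ _ (m + 1), assocStirlingFirst_eq_zero (by omega)]
      simp
    rw [h1, Nat.add_sub_cancel, h2, mul_sum, ← sum_add_distrib, mul_sum]
    simp only [Nat.cast_zero, mul_zero, add_zero]
    refine sum_congr rfl fun q _ => ?_
    push_cast
    ring

/-- The series `(exp w) ^ c * (1 + t * w) ^ (- c / t)`. -/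
noncomputable def expSeries (t c : ℚ) : ℚ⟦X⟧ :=
  egf fun m => (-t) ^ m * assocStirlingSum (c / t) m

lemma constantCoeff_expSeries (t c : ℚ) : constantCoeff (expSeries t c) = 1 := by
  rw [← coeff_zero_eq_constantCoeff_apply, expSeries, coeff_egf]
  simp [assocStirlingSum, assocStirlingFirst_zero_zero]

lemma derivative_expSeries {t : ℚ} (ht : t ≠ 0) (c : ℚ) :
    (1 + C t * X) * d⁄dX ℚ (expSeries t c) = C (c * t) * X * expSeries t c := by
  rw [expSeries, derivative_egf, add_mul, one_mul, mul_assoc, X_mul_egf, C_mul_egf, egf_add,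
    mul_assoc, X_mul_egf, C_mul_egf]
  congr 1
  ext m
  rw [assocStirlingSum_succ]
  cases m with
  | zero => simp
  | succ m =>
    simp only [Nat.add_sub_cancel]
    field_simp
    ring

lemma one_add_C_mul_X_ne_zero (t : ℚ) : (1 + C t * X : ℚ⟦X⟧) ≠ 0 := fun h => by
  simpa using congrArg constantCoeff h

lemma expSeries_pow {t : ℚ} (ht : t ≠ 0) (c : ℕ) : expSeries t 1 ^ c = expSeries t c := by
  refine eq_of_derivative_eq (one_add_C_mul_X_ne_zero t) (K := C (c * t) * X) ?_
    (derivative_expSeries ht c) ?_ (constantCoeff_expSeries t c)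
  · rw [derivative_pow]
    cases c with
    | zero => simp
    | succ c =>
      have := derivative_expSeries ht 1
      rw [one_mul] at this
      simp only [Nat.add_sub_cancel, map_mul, map_natCast]
      linear_combination (((c + 1 : ℕ) : ℚ⟦X⟧) * expSeries t 1 ^ c) * this
  · rw [map_pow, constantCoeff_expSeries, one_pow]

end Egf
end SeriesParallel

namespace SeriesParallel

open Finset PowerSeries
open scoped Nat

section Lagrange

lemma coeff_pow_add (g : ℚ⟦X⟧) (s : ℕ) :
    coeff s (g⁻¹ ^ s + X * (d⁄dX ℚ g * g⁻¹ ^ (s + 1))) = if s = 0 then 1 else 0 := by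
  cases s with
  | zero => simp
  | succ s =>
    have h1 : d⁄dX ℚ (g⁻¹ ^ (s + 1)) = -((s : ℚ⟦X⟧) + 1) * (d⁄dX ℚ g * g⁻¹ ^ (s + 2)) := by
      rw [derivative_pow, derivative_inv']
      push_cast
      ring
    have h2 := congrArg (coeff s) h1
    have h3 : (-((s : ℚ⟦X⟧) + 1)) = C (-((s : ℚ) + 1)) := by simp
    rw [coeff_derivative, h3, coeff_C_mul] at h2
    rw [map_add, coeff_succ_X_mul, if_neg (by omega)]
    have h4 : (s : ℚ) + 1 ≠ 0 := by positivity
    refine mul_left_cancel₀ h4 ?_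
    linear_combination h2

lemma coeff_subst_mul_derivative {g : ℚ⟦X⟧} (hg : constantCoeff g ≠ 0) (n j : ℕ) (K : ℚ⟦X⟧) :
    coeff n ((X * g) ^ j * K.subst (X * g) * d⁄dX ℚ (X * g) * g⁻¹ ^ (n + 1)) =
      coeff n (X ^ j * K) := by
  have hs : HasSubst (X * g) := HasSubst.of_constantCoeff_zero' (by simp)
  by_cases hj : n < j
  · rw [mul_pow, mul_assoc, mul_assoc, mul_assoc, coeff_X_pow_mul', if_neg (by omega),
      coeff_X_pow_mul', if_neg (by omega)]
  · have ih := coeff_subst_mul_derivative hg n (j + 1) (.mk fun p => coeff (p + 1) K)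
    have hK : K = X * (.mk fun p => coeff (p + 1) K) + C (constantCoeff K) :=
      eq_X_mul_shift_add_const K
    obtain ⟨K₁, hK₁⟩ : ∃ K₁ : ℚ⟦X⟧, K₁ = .mk fun p => coeff (p + 1) K := ⟨_, rfl⟩
    obtain ⟨s, rfl⟩ : ∃ s, n = s + j := ⟨n - j, by omega⟩
    rw [← hK₁] at hK ih
    have hgg : g * g⁻¹ = 1 := PowerSeries.mul_inv_cancel g hg
    have hgj : g ^ j * g⁻¹ ^ j = 1 := by rw [← mul_pow, hgg, one_pow]
    have core : (X * g) ^ j * d⁄dX ℚ (X * g) * g⁻¹ ^ (s + j + 1) =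
        X ^ j * (g⁻¹ ^ s + X * (d⁄dX ℚ g * g⁻¹ ^ (s + 1))) := by
      rw [Derivation.leibniz, derivative_X, smul_eq_mul, smul_eq_mul]
      calc _ = X ^ j * ((g ^ j * g⁻¹ ^ j) * ((g * g⁻¹) * g⁻¹ ^ s +
            X * (d⁄dX ℚ g * g⁻¹ ^ (s + 1)))) := by ring
        _ = _ := by rw [hgj, hgg]; ring
    have hsub : K.subst (X * g) = X * g * K₁.subst (X * g) + C (constantCoeff K) := by
      conv_lhs => rw [hK]
      rw [subst_add hs, subst_mul hs, subst_X hs, subst_C]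
      rfl
    have h1 : (X * g) ^ j * K.subst (X * g) * d⁄dX ℚ (X * g) * g⁻¹ ^ (s + j + 1) =
        (X * g) ^ (j + 1) * K₁.subst (X * g) * d⁄dX ℚ (X * g) * g⁻¹ ^ (s + j + 1) +
        C (constantCoeff K) * (X ^ j * (g⁻¹ ^ s + X * (d⁄dX ℚ g * g⁻¹ ^ (s + 1)))) := by
      rw [← core, hsub]
      ring
    rw [h1, map_add, ih, coeff_C_mul, coeff_X_pow_mul, coeff_pow_add]
    conv_rhs => rw [hK]
    rw [mul_add, map_add, ← mul_assoc, ← pow_succ, mul_comm (X ^ j) (C _), coeff_C_mul, coeff_X_pow]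
    simp
termination_by n + 1 - j

/-- The Lagrange inversion formula. -/
theorem lagrange_inversion {g : ℚ⟦X⟧} (hg : constantCoeff g ≠ 0) (H : ℚ⟦X⟧) (n : ℕ) :
    ((n : ℚ) + 1) * coeff (n + 1) H =
      coeff n (d⁄dX ℚ (H.subst (X * g)) * g⁻¹ ^ (n + 1)) := by
  have h := coeff_subst_mul_derivative hg n 0 (d⁄dX ℚ H)
  have hs : HasSubst (X * g) := HasSubst.of_constantCoeff_zero' (by simp)
  rw [pow_zero, pow_zero, one_mul, one_mul, ← derivative_subst hs, coeff_derivative] at h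
  rw [h, mul_comm]

end Lagrange

section Inversion

lemma coeff_mul_subst {R : ℚ⟦X⟧} (hR : constantCoeff R = 0) (Z P : ℚ⟦X⟧) {n L : ℕ} (hL : n < L) :
    coeff n (Z * P.subst R) = ∑ p ∈ range L, coeff p P * coeff n (Z * R ^ p) := by
  have hs : HasSubst R := HasSubst.of_constantCoeff_zero' hR
  have key : ∀ L (P : ℚ⟦X⟧), ∃ S : ℚ⟦X⟧,
      P.subst R = ∑ p ∈ range L, C (coeff p P) * R ^ p + R ^ L * S := by
    intro L
    induction L with
    | zero => exact fun P => ⟨P.subst R, by simp⟩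
    | succ L ih =>
      intro P
      obtain ⟨S, hS⟩ := ih (.mk fun p => coeff (p + 1) P)
      refine ⟨S, ?_⟩
      conv_lhs => rw [eq_X_mul_shift_add_const P]
      rw [subst_add hs, subst_mul hs, subst_X hs, subst_C, hS, sum_range_succ', mul_add, mul_sum]
      simp only [coeff_mk, pow_succ, coeff_zero_eq_constantCoeff, pow_zero, mul_one]
      rw [add_right_comm]
      congr 1
      · congr 1
        exact sum_congr rfl fun p _ => by ring
      · ring
  obtain ⟨S, hS⟩ := key L P
  obtain ⟨R', hR'⟩ := X_dvd_iff.2 hR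
  rw [hS, mul_add, map_add, mul_sum, map_sum]
  have : Z * (R ^ L * S) = X ^ L * (Z * (R' ^ L * S)) := by rw [hR']; ring
  rw [this, coeff_X_pow_mul', if_neg (by omega), add_zero]
  refine sum_congr rfl fun p _ => ?_
  rw [mul_left_comm, coeff_C_mul]

variable {t : ℚ}

lemma coeff_derivative_mul_pow {E : ℚ⟦X⟧} (m c : ℕ) :
    coeff m (d⁄dX ℚ E * E ^ c) = ((m : ℚ) + 1) / (c + 1) * coeff (m + 1) (E ^ (c + 1)) := by
  have h := congrArg (coeff m) (derivative_pow E (c + 1))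
  rw [coeff_derivative, Nat.add_sub_cancel, mul_assoc, ← map_natCast C, coeff_C_mul] at h
  push_cast at h
  have : (c : ℚ) + 1 ≠ 0 := by positivity
  field_simp
  rw [mul_comm (E ^ c)] at h
  linear_combination -h

lemma coeff_expSeries_inversion (ht : t ≠ 0) {R : ℚ⟦X⟧} (hR : expSeries t 1 = 1 + X * R)
    (n p : ℕ) : coeff n (d⁄dX ℚ (expSeries t 1) * expSeries t 1 ^ (n + 1) * R ^ p) =
      ∑ i ∈ range (p + 1), (-1) ^ i * (p.choose i : ℚ) *
        (((n + p : ℕ) + 1 : ℚ) / ((n : ℚ) + p + 2 - i) * ((-t) ^ (n + p + 1) *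
          assocStirlingSum (((n : ℚ) + p + 2 - i) / t) (n + p + 1) / (n + p + 1)!)) := by
  obtain ⟨E, hE⟩ : ∃ E, E = expSeries t 1 := ⟨_, rfl⟩
  have h1 : X ^ p * (d⁄dX ℚ E * E ^ (n + 1) * R ^ p) =
      ∑ i ∈ range (p + 1), C ((-1) ^ i * (p.choose i : ℚ)) * (d⁄dX ℚ E * E ^ (n + 1 + (p - i))) := by
    have h2 : X * R = -1 + E := by rw [hE, hR]; ring
    calc _ = d⁄dX ℚ E * E ^ (n + 1) * (X * R) ^ p := by ring
      _ = _ := by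
        rw [h2, add_pow, mul_sum]
        refine sum_congr rfl fun i _ => ?_
        simp only [map_mul, map_pow, map_neg, map_one, map_natCast]
        ring
  rw [← hE, ← coeff_X_pow_mul _ p, h1, map_sum]
  refine sum_congr rfl fun i hi => ?_
  have hi : i ≤ p := by simpa [Nat.lt_succ_iff] using hi
  rw [coeff_C_mul, coeff_derivative_mul_pow, hE, expSeries_pow ht, expSeries, coeff_egf]
  have hc : ((n + 1 + (p - i) : ℕ) : ℚ) + 1 = (n : ℚ) + p + 2 - i := by
    push_cast [Nat.cast_sub hi]; ring
  rw [hc, Nat.cast_succ, hc]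

/-- The explicit solution of the recursive equations. -/
theorem recursion_solution (ht : t ≠ 0) {a d y b : ℕ → ℚ} (ha : a 0 = 1) (hb : b 0 = 1)
    (h1 : ∀ m, b (m + 1) = t * d (m + 1) + y (m + 1))
    (h2 : ∀ m, b (m + 1) = t * (a (m + 1) + (m + 1) * a m))
    (h3 : ∀ m, b (m + 1) = ∑ j ∈ range (m + 1), (m.choose j : ℚ) * (y (j + 1) * b (m - j)))
    (h4 : ∀ m, a (m + 1) = ∑ j ∈ range (m + 1), (m.choose j : ℚ) * (d (j + 1) * a (m - j)))
    {n L : ℕ} (hL : n < L) :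
    a (n + 1) = ∑ p ∈ range L, ∑ i ∈ range (p + 1), (-1) ^ i / ((i ! : ℚ) * (p - i)!) *
      ((-t) ^ (n + p + 1) * assocStirlingSum (((n : ℚ) + p + 2 - i) / t) (n + p + 1) /
        ((n : ℚ) + p + 2 - i)) := by
  obtain ⟨A, hA⟩ : ∃ A, A = egf a := ⟨_, rfl⟩
  obtain ⟨B, hB⟩ : ∃ B, B = egf b := ⟨_, rfl⟩
  obtain ⟨D, hD⟩ : ∃ D, D = egf fun m => d (m + 1) := ⟨_, rfl⟩
  obtain ⟨Y, hY⟩ : ∃ Y, Y = egf fun m => y (m + 1) := ⟨_, rfl⟩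
  obtain ⟨v, hv⟩ : ∃ v, v = (1 + X) * A - 1 := ⟨_, rfl⟩
  obtain ⟨E, hE⟩ : ∃ E, E = expSeries t 1 := ⟨_, rfl⟩
  have hA0 : constantCoeff A = 1 := by
    rw [← coeff_zero_eq_constantCoeff_apply, hA, coeff_egf]; simp [ha]
  have hE0 : constantCoeff E = 1 := by rw [hE, constantCoeff_expSeries]
  have hv0 : constantCoeff v = 0 := by simp [hv, hA0]
  have hsv : HasSubst v := HasSubst.of_constantCoeff_zero' hv0
  have e1 : d⁄dX ℚ B = C t * D + Y := by
    rw [hB, hD, hY, derivative_egf, C_mul_egf, egf_add]; simp only [h1]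
  have e3 : d⁄dX ℚ B = Y * B := by
    rw [hB, hY, derivative_egf, egf_mul]; simp only [h3]
  have e4 : d⁄dX ℚ A = D * A := by
    rw [hA, hD, derivative_egf, egf_mul]; simp only [← h4]
  have e2 : B = 1 + C t * v := by
    refine derivative.ext ?_ ?_
    · rw [hv, add_mul, one_mul, hA, X_mul_egf, egf_add, map_add, derivative_one, zero_add,
        Derivation.leibniz, derivative_C, smul_zero, add_zero, smul_eq_mul, map_sub, derivative_one,
        sub_zero, derivative_egf, C_mul_egf, hB, derivative_egf]
      simp only [h2, Nat.add_sub_cancel, Nat.cast_succ]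
    · rw [map_add, map_mul, hv0, ← coeff_zero_eq_constantCoeff_apply, hB, coeff_egf]; simp [hb]
  have e5 : d⁄dX ℚ B = C t * d⁄dX ℚ v := by
    rw [e2, map_add, derivative_one, zero_add, Derivation.leibniz, derivative_C, smul_zero,
      add_zero, smul_eq_mul]
  have hCt : (C t : ℚ⟦X⟧) ≠ 0 := fun h => ht (by simpa using congrArg constantCoeff h)
  have e6 : C t * v * d⁄dX ℚ v = D * B := by
    refine mul_left_cancel₀ hCt ?_
    have : C t * D = d⁄dX ℚ B - Y := by rw [e1]; ring
    calc _ = (C t * d⁄dX ℚ v) * (C t * v) := by ring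
      _ = d⁄dX ℚ B * (B - 1) := by rw [← e5, e2]; ring
      _ = (d⁄dX ℚ B - Y) * B := by rw [sub_mul, ← e3]; ring
      _ = _ := by rw [← this]; ring
  have hEode : (1 + C t * X) * d⁄dX ℚ E = C t * X * E := by
    have := derivative_expSeries ht 1
    rwa [one_mul, ← hE] at this
  have hAE : A = E.subst v := by
    refine eq_of_derivative_eq (U := B) (K := D * B) ?_ (by rw [e4]; ring) ?_ hA0 ?_
    · rw [e2]
      intro h
      simpa [hv0] using congrArg constantCoeff h
    · have := congrArg (subst v) hEode
      rw [subst_mul hsv, subst_mul hsv, subst_mul hsv, subst_add hsv, subst_mul hsv, subst_X hsv,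
        ← map_one C, subst_C, subst_C] at this
      change (C 1 + C t * v) * _ = C t * v * _ at this
      rw [map_one, ← e2] at this
      rw [derivative_subst hsv, ← mul_assoc, this, ← e6]
      ring
    · have : E = 1 + X * .mk fun p => coeff (p + 1) E := by
        conv_lhs => rw [eq_X_mul_shift_add_const E, hE0, map_one]
        rw [add_comm]
      rw [this, subst_add hsv, subst_mul hsv, subst_X hsv, ← map_one C, subst_C, map_add, map_mul,
        hv0, zero_mul, add_zero]
      exact constantCoeff_C 1
  obtain ⟨R, hR⟩ : ∃ R : ℚ⟦X⟧, R = .mk fun p => coeff (p + 1) E := ⟨_, rfl⟩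
  have hER : E = 1 + X * R := by
    conv_lhs => rw [eq_X_mul_shift_add_const E, hE0, map_one, ← hR]
    rw [add_comm]
  have hR0 : constantCoeff R = 0 := by
    rw [← coeff_zero_eq_constantCoeff_apply, hR, coeff_mk, hE, expSeries, coeff_egf,
      assocStirlingSum_succ]
    simp
  have hEE : E * E⁻¹ = 1 := PowerSeries.mul_inv_cancel E (by simp [hE0])
  obtain ⟨g, hg⟩ : ∃ g, g = (1 - R) * E⁻¹ := ⟨_, rfl⟩
  have hg0 : constantCoeff g = 1 := by simp [hg, hR0, hE0]
  have hgE : X * g * E = 1 + X - E := by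
    rw [hg, hER] at *
    linear_combination (X * (1 - R)) * hEE
  have hs : HasSubst (X * g) := HasSubst.of_constantCoeff_zero' (by simp)
  have hξv : (X * g).subst v = X := by
    have := congrArg (subst v) hgE
    rw [subst_mul hsv, subst_sub hsv, subst_add hsv, subst_X hsv, ← hAE, ← map_one C, subst_C] at this
    change _ = C 1 + v - A at this
    have hA' : A ≠ 0 := fun h => by simp [h] at hA0
    refine mul_right_cancel₀ hA' ?_
    rw [this, hv, map_one]
    ring
  have hvξ : v.subst (X * g) = X := by
    have hu : IsUnit (coeff 1 (X * g)) := by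
      rw [show (1 : ℕ) = 0 + 1 from rfl, coeff_succ_X_mul, coeff_zero_eq_constantCoeff_apply, hg0]
      exact isUnit_one
    have hu1 := subst_substInvOfIsUnit_left (X * g) (by simp) hu
    obtain ⟨u, hu'⟩ : ∃ u, u = (X * g).substInvOfIsUnit hu := ⟨_, rfl⟩
    rw [← hu'] at hu1
    have : v = u := by
      calc v = subst v (X : ℚ⟦X⟧) := (subst_X hsv).symm
        _ = subst v (subst (X * g) u) := by rw [hu1]
        _ = u := by rw [subst_comp_subst_apply hs hsv, hξv, X_subst]
    rw [this, hu1]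
  have hAξ : A.subst (X * g) = E := by
    rw [hAE, subst_comp_subst_apply hsv hs, hvξ, X_subst]
  have hlag := lagrange_inversion (g := g) (by simp [hg0]) A n
  obtain ⟨P, hP⟩ : ∃ P : ℚ⟦X⟧, P = .mk fun p => ((n + p).choose n : ℚ) := ⟨_, rfl⟩
  have hsR : HasSubst R := HasSubst.of_constantCoeff_zero' hR0
  have hPR : P.subst R * (1 - R) ^ (n + 1) = 1 := by
    have := congrArg (subst R) (mk_add_choose_mul_one_sub_pow_eq_one ℚ n)
    rw [subst_mul hsR, subst_pow hsR, subst_sub hsR, subst_X hsR, ← map_one C, subst_C] at this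
    rw [hP]
    simpa using this
  have hginv : g⁻¹ ^ (n + 1) = E ^ (n + 1) * P.subst R := by
    have hgg : g * g⁻¹ = 1 := PowerSeries.mul_inv_cancel g (by simp [hg0])
    have h5 : g ^ (n + 1) * (E ^ (n + 1) * P.subst R) = 1 := by
      calc _ = (E * E⁻¹) ^ (n + 1) * (P.subst R * (1 - R) ^ (n + 1)) := by rw [hg, mul_pow, mul_pow]; ring
        _ = 1 := by rw [hEE, hPR]; simp
    calc _ = g⁻¹ ^ (n + 1) * (g ^ (n + 1) * (E ^ (n + 1) * P.subst R)) := by rw [h5, mul_one]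
      _ = (g * g⁻¹) ^ (n + 1) * (E ^ (n + 1) * P.subst R) := by ring
      _ = _ := by rw [hgg]; simp
  rw [hAξ, hginv, ← mul_assoc, coeff_mul_subst hR0 _ _ hL, hA, coeff_egf, Nat.factorial_succ] at hlag
  have hn0 : (n ! : ℚ) ≠ 0 := by positivity
  have hn1 : (n : ℚ) + 1 ≠ 0 := by positivity
  have : a (n + 1) = n ! * ∑ p ∈ range L, coeff p P * coeff n (d⁄dX ℚ E * E ^ (n + 1) * R ^ p) := by
    rw [← hlag]
    push_cast
    field_simp
  rw [this, mul_sum]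
  refine sum_congr rfl fun p _ => ?_
  rw [hE, coeff_expSeries_inversion ht (by rw [← hE, hER]), mul_sum, mul_sum]
  refine sum_congr rfl fun i hi => ?_
  have hi : i ≤ p := by simpa [Nat.lt_succ_iff] using hi
  rw [hP, coeff_mk, Nat.cast_choose ℚ hi, Nat.cast_add_choose, Nat.factorial_succ (n + p)]
  have hc : (n : ℚ) + p + 2 - i ≠ 0 := by
    have : (i : ℚ) ≤ p := by exact_mod_cast hi
    have : (0 : ℚ) ≤ n := by positivity
    linarith
  have f1 : (i ! : ℚ) ≠ 0 := by positivity
  have f2 : ((p - i)! : ℚ) ≠ 0 := by positivity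
  have f3 : (p ! : ℚ) ≠ 0 := by positivity
  have f4 : ((n + p)! : ℚ) ≠ 0 := by positivity
  have f5 : ((n : ℚ) + p + 1) ≠ 0 := by positivity
  push_cast
  field_simp

end Inversion
end SeriesParallel

namespace SeriesParallel

open Finset
open scoped Nat

section Count

lemma numSimpleSeriesParallel_zero (k : ℕ) : numSimpleSeriesParallel 0 k = 0 := by
  have hno : ∀ G : Graph ℕ (Fin 0), ¬ IsBuiltFromTwoCycle G := by
    intro G hG
    induction hG with
    | twoCycle u v e f huv hef => exact e.elim0
    | series G H hG hGH ih => exact ih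
    | parallel G H hG hGH ih => exact ih
  refine (congrArg Set.ncard (Set.eq_empty_iff_forall_notMem.2 ?_)).trans (Set.ncard_empty _)
  rintro M ⟨-, -, -, G, hG | ⟨u, v, e, -⟩ | ⟨u, e, -⟩, -⟩
  · exact hno G hG
  · exact e.elim0
  · exact e.elim0

lemma numSimpleSeriesParallel_one : numSimpleSeriesParallel 1 1 = 1 := by
  rw [numSimpleSeriesParallel, Set.ncard_eq_one]
  refine ⟨Matroid.freeOn Set.univ, ?_⟩
  ext M
  rw [Set.mem_ofPred_eq, Set.mem_singleton_iff]
  have huniv : (Set.univ : Set (Fin 1)) = {0} := by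
    ext x; simp [Subsingleton.elim x 0]
  constructor
  · rintro ⟨hE, -, hS, -⟩
    rw [Matroid.eq_freeOn_iff]
    refine ⟨hE, ?_⟩
    have := hS 0 (by simp [hE]) 0 (by simp [hE])
    rwa [Set.pair_eq_singleton, ← huniv] at this
  · rintro rfl
    refine ⟨Matroid.freeOn_ground, ?_, ?_, ?_⟩
    · rw [Matroid.eRank_freeOn]; simp
    · intro e _ f _
      simp
    · rw [huniv]; exact isSeriesParallelMatroid_freeOn_singleton 0

lemma numSimpleSeriesParallel_eq_zero {n k : ℕ} (hn : 2 ≤ n) (hk : n ≤ k) :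
    numSimpleSeriesParallel n k = 0 := by
  rw [numSimpleSeriesParallel_eq_ncard hn ⟨0, by omega⟩, Set.ncard_eq_zero (Set.toFinite _),
    Set.eq_empty_iff_forall_notMem]
  rintro G ⟨-, hG, -⟩
  have := hG.rank_le_card
  rw [card_erase_of_mem (mem_univ _), card_univ, Fintype.card_fin] at this
  omega

lemma pow_mul_assocStirlingSum_div {t c : ℚ} (ht : t ≠ 0) (hc : c ≠ 0) (M : ℕ) :
    (-t) ^ (M + 1) * assocStirlingSum (c / t) (M + 1) / c = ∑ q ∈ range (M + 1),
      (-1) ^ (M + 1) * c ^ q * assocStirlingFirst (M + 1) (q + 1) * t ^ (M - q) := by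
  rw [assocStirlingSum, sum_range_succ', assocStirlingFirst_succ_zero, Nat.cast_zero, mul_zero,
    add_zero, mul_sum, sum_div]
  refine sum_congr rfl fun q hq => ?_
  obtain ⟨j, rfl⟩ : ∃ j, M = q + j := ⟨M - q, by have := mem_range.1 hq; omega⟩
  rw [Nat.add_sub_cancel_left, div_pow, neg_pow]
  field_simp
  ring

lemma sub_ne_zero_of_mem_range {n p i : ℕ} (hi : i ∈ range (p + 1)) : (n : ℚ) + p + 2 - i ≠ 0 := by
  have hi : i ≤ p := by simpa [Nat.lt_succ_iff] using hi
  have : (i : ℚ) ≤ p := by exact_mod_cast hi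
  have : (0 : ℚ) ≤ n := by positivity
  linarith

open Polynomial in
/-- An explicit formula for the numbers of simple series-parallel matroids. -/
theorem numSimpleSeriesParallel_eq {n L k : ℕ} (hL : n < L) (hk : k ≤ n + 1) :
    (numSimpleSeriesParallel (n + 2) (k + 1) : ℚ) =
      ∑ p ∈ range L, ∑ i ∈ range (p + 1), (-1) ^ i / ((i ! : ℚ) * (p - i)!) *
        if k ≤ n + p then (-1) ^ (n + p + 1) * ((n : ℚ) + p + 2 - i) ^ (n + p - k) *
          assocStirlingFirst (n + p + 1) (n + p - k + 1) else 0 := by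
  obtain ⟨F, hF⟩ : ∃ F : ℚ[X], F = ∑ k ∈ range (n + 2),
    Polynomial.C (numSimpleSeriesParallel (n + 2) (k + 1) : ℚ) * Polynomial.X ^ k := ⟨_, rfl⟩
  obtain ⟨H, hH⟩ : ∃ H : ℚ[X], H = ∑ p ∈ range L, ∑ i ∈ range (p + 1),
    Polynomial.C ((-1) ^ i / ((i ! : ℚ) * (p - i)!)) * ∑ q ∈ range (n + p + 1),
      Polynomial.C ((-1) ^ (n + p + 1) * ((n : ℚ) + p + 2 - i) ^ q *
        assocStirlingFirst (n + p + 1) (q + 1)) * Polynomial.X ^ (n + p - q) := ⟨_, rfl⟩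
  have heval : ∀ t : ℚ, t ≠ 0 → F.eval t = H.eval t := by
    intro t ht
    obtain ⟨a, d, y, b, ha, hb, h1, h2, h3, h4, h5⟩ := exists_recursion ht
    have h6 := recursion_solution ht ha hb h1 h2 h3 h4 hL
    rw [h5 (n + 1) (by omega)] at h6
    rw [hF, hH]
    simp only [eval_finsetSum, eval_mul, eval_C, eval_pow, eval_X]
    rw [sum_range_succ, numSimpleSeriesParallel_eq_zero (by omega) le_rfl, Nat.cast_zero, zero_mul,
      add_zero, h6]
    refine sum_congr rfl fun p _ => sum_congr rfl fun i hi => ?_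
    rw [pow_mul_assocStirlingSum_div ht (sub_ne_zero_of_mem_range hi)]
  have hFH : F = H := by
    refine eq_of_infinite_eval_eq F H ((Set.finite_singleton (0 : ℚ)).infinite_compl.mono ?_)
    exact fun t ht => heval t ht
  have hcoeff := congrArg (fun p : ℚ[X] => p.coeff k) hFH
  simp only [hF, hH, finsetSum_coeff, coeff_C_mul, coeff_X_pow] at hcoeff
  rw [sum_eq_single_of_mem k (mem_range.2 (by omega)) (fun j _ hj => by rw [if_neg hj.symm, mul_zero]),
    if_pos rfl, mul_one] at hcoeff
  rw [hcoeff]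
  refine sum_congr rfl fun p _ => sum_congr rfl fun i _ => ?_
  congr 1
  split_ifs with h
  · rw [sum_eq_single_of_mem (n + p - k) (mem_range.2 (by omega)), if_pos (by omega), mul_one]
    intro j hj hjk
    have := mem_range.1 hj
    rw [if_neg (by omega), mul_zero]
  · refine sum_eq_zero fun q _ => ?_
    rw [if_neg (by omega), mul_zero]

end Count
end SeriesParallel

/-- For `0 ≤ r ≤ k`, a formula for the number of simple series-parallel matroids of rank `k` on
`[2k - r]`. The identity is one of rational numbers, and the exponent `k - p - 1` is an integer,
equal to `-1` when `p = k`. -/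
theorem theorem1p5 (r k : ℕ) (hrk : r ≤ k) :
    (SeriesParallel.numSimpleSeriesParallel (2 * k - r) k : ℚ) =
      ∑ p ∈ Finset.Icc 1 r,
        (SeriesParallel.assocStirlingFirst (2 * k - p - 1) (k - p) : ℚ) *
          ∑ i ∈ Finset.range (r - p + 1),
            (-1 : ℚ) ^ (i + p + 1) * (2 * (k : ℚ) - (p : ℚ) - (i : ℚ)) ^ ((k : ℤ) - (p : ℤ) - 1) /
              ((Nat.factorial i : ℚ) * (Nat.factorial (r - p - i) : ℚ)) := by
  open SeriesParallel in
  obtain _ | k := k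
  · obtain rfl : r = 0 := by omega
    simp [numSimpleSeriesParallel_zero]
  by_cases hn : 2 * (k + 1) - r = 1
  · obtain rfl : k = 0 := by omega
    obtain rfl : r = 1 := by omega
    simp [numSimpleSeriesParallel_one, assocStirlingFirst_zero_zero]
    norm_num
  obtain ⟨n, hn⟩ : ∃ n, 2 * (k + 1) - r = n + 2 := ⟨2 * (k + 1) - r - 2, by omega⟩
  rw [hn, numSimpleSeriesParallel_eq (L := n + r + 1) (by omega) (by omega)]
  have hsub : Finset.range r ⊆ Finset.range (n + r + 1) := Finset.range_mono (by omega)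
  rw [← Finset.sum_subset hsub]
  · refine Finset.sum_nbij' (fun p => r - p) (fun p => r - p) ?_ ?_ ?_ ?_ ?_
    · intro p hp
      rw [Finset.mem_range] at hp
      rw [Finset.mem_Icc]
      omega
    · intro p hp
      rw [Finset.mem_Icc] at hp
      rw [Finset.mem_range]
      omega
    · intro p hp
      rw [Finset.mem_range] at hp
      omega
    · intro p hp
      rw [Finset.mem_Icc] at hp
      omega
    · intro p hp
      have hp := Finset.mem_range.1 hp
      have hrp : ((r - p : ℕ) : ℚ) = r - p := by push_cast [Nat.cast_sub hp.le]; ring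
      have hnq : (n : ℚ) + 2 = 2 * (k + 1) - r := by
        have : n + 2 + r = 2 * (k + 1) := by omega
        have : (n : ℚ) + 2 + r = 2 * (k + 1) := by exact_mod_cast this
        linarith
      rw [show r - (r - p) = p by omega, show 2 * (k + 1) - (r - p) - 1 = n + p + 1 by omega,
        Finset.mul_sum]
      refine Finset.sum_congr rfl fun i _ => ?_
      by_cases hk : k ≤ n + p
      · rw [if_pos hk, show k + 1 - (r - p) = n + p - k + 1 by omega,
          show ((k + 1 : ℕ) : ℤ) - ((r - p : ℕ) : ℤ) - 1 = ((n + p - k : ℕ) : ℤ) by omega,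
          zpow_natCast, show 2 * ((k + 1 : ℕ) : ℚ) - ((r - p : ℕ) : ℚ) - i = (n : ℚ) + p + 2 - i by
            rw [hrp]; push_cast; linarith]
        have hs : (-1 : ℚ) ^ (i + (r - p) + 1) = (-1) ^ i * (-1) ^ (n + p + 1) := by
          rw [← pow_add]
          refine neg_one_pow_congr ?_
          rw [Nat.even_iff, Nat.even_iff]
          omega
        rw [hs]
        ring
      · obtain ⟨m, rfl⟩ : ∃ m, k = m + 1 := ⟨k - 1, by omega⟩
        rw [if_neg hk, show m + 1 + 1 - (r - p) = 0 by omega, assocStirlingFirst_succ_zero]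
        simp
  · intro p _ hp
    rw [Finset.mem_range] at hp
    refine Finset.sum_eq_zero fun i _ => ?_
    rw [assocStirlingFirst_eq_zero (m := n + p + 1) (by omega)]
    simp
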